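/- Notation. For a qubit state $\rho$ (a $2\times2$ density matrix) let $S(\rho)=-\operatorname{Tr}(\rho\log_2\rho)$, let $\rho^D$ be its diagonal part in the standard basis, $C_r(\rho)=S(\rho^D)-S(\rho)$ its relative entropy of coherence, and $H_2(x)=-x\log_2x-(1-x)\log_2(1-x)$. Let $\mathcal E_{2,2}$ be the law of the reduced state on $\mathbb C^2$ (partial trace over the second factor) of a Haar-distributed pure state of $\mathbb C^2\otimes\mathbb C^2$. For $0<a<\frac12$, "uniform on the orbit $\mathcal O_a$" is the law of $U\,\mathrm{diag}(1-a,a)\,U^\dagger$ with $U\in SU(2)$ Haar-distributed. All states below are independent. For $\rho_1,\dots,\rho_n$ in $\mathcal E_{2,2}$ put $$\overline S_n=\mathbb E\Big[S\Big(\tfrac{\rho_1+\cdots+\rho_n}n\Big)\Big],\quad \overline S^D_n=\mathbb E\Big[S\Big(\tfrac{\rho^D_1+\cdots+\rho^D_n}n\Big)\Big],\quad \overline C^{(n)}_r=\mathbb E\Big[C_r\Big(\tfrac{\rho_1+\cdots+\rho_n}n\Big)\Big].$$ For $r_1,r_2,r_3\in(0,1)$ let $\overline S_3(r_1,r_2,r_3)$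 and $\overline S_3^D(r_1,r_2,r_3)$ be the corresponding averages for three states uniform on $\mathcal O_{(1-r_1)/2},\mathcal O_{(1-r_2)/2},\mathcal O_{(1-r_3)/2}$. Define, for $r_1\le r_2\le r_3$ and $r\ge 0$ (and for other orders by symmetry in $r_1,r_2,r_3$), $$p(r|r_1,r_2,r_3)=\frac{9}{4r_1r_2r_3}\begin{cases}6r^2\ \text{ if } r_1+r_2\ge r_3,\quad 0\ \text{ if } r_1+r_2<r_3, & 0\le r\le\frac{|r_1+r_2-r_3|}3,\\ 3r^2+(r_1+r_2-r_3)r,&\frac{|r_1+r_2-r_3|}3<r\le\frac{r_1-r_2+r_3}3,\\ 2r_1r,&\frac{r_1-r_2+r_3}3<r\le\frac{-r_1+r_2+r_3}3,\\ -3r^2+(r_1+r_2+r_3)r,&\frac{-r_1+r_2+r_3}3<r\le\frac{r_1+r_2+r_3}3,\\ 0,&r>\frac{r_1+r_2+r_3}3.\end{cases}$$ With $a=\frac{1-r_1}2\ge b=\frac{1-r_2}2\ge c=\frac{1-r_3}2$, $T_0=\frac{a+b+c}3$, $T_1=\frac13-\frac{a-b-c}3$, $T_2=\frac13-\frac{-a+b-c}3$,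 $T_3=\frac12-\left|\frac16-\frac{a+b-c}3\right|$, define $q(x|r_1,r_2,r_3)=\frac{27}{16(\frac12-a)(\frac12-b)(\frac12-c)}\Psi(x)$, where $\Psi(x)=\Psi(1-x)$ and, for $x\le\frac12$, $$\Psi(x)=\begin{cases}0,&x<T_0,\\(x-T_0)^2,&T_0\le x\le T_1,\\(T_1-T_0)(2x-T_0-T_1),&T_1<x\le T_2,\\-x^2+2x(T_1+T_2-T_0)+T_0^2-T_1^2-T_2^2,&T_2<x\le T_3,\\-2x^2+2x+T_0^2-T_1^2-T_2^2-T_3^2,&T_3<x\le\frac12,\ a+b-c\le\frac12,\\T_0^2-T_1^2-T_2^2+T_3^2,&T_3<x\le\frac12,\ a+b-c>\frac12\end{cases}$$ (again extended symmetrically to other orders of $r_1,r_2,r_3$). Finally let $$p^{(3)}(r)=\begin{cases}-\frac{243}{1120}r^2(243r^6-1701r^4+945r^2-175),&0\le r\le\frac13,\\ \frac{6561}{2240}(1-r)^4r(9r^3+36r^2+27r-2),&\frac13<r\le1.\end{cases}$$ Proposition. (i) For all $r_1,r_2,r_3\in(0,1)$, $$\overline S_3(r_1,r_2,r_3)=\int_0^{\frac{r_1+r_2+r_3}3}H_2\Big(\frac{1-r}2\Big)\,p(r|r_1,r_2,r_3)\,dr,$$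 and $$\overline S_3=\int_0^1\!\int_0^1\!\int_0^1\overline S_3(r_1,r_2,r_3)\,3r_1^2\,3r_2^2\,3r_3^2\,dr_1dr_2dr_3=\int_0^1H_2\Big(\frac{1-r}2\Big)p^{(3)}(r)\,dr=\frac{57821+94464\ln2-105498\ln3}{12600\ln2},$$ with $|\overline S_3-0.84696|<5\cdot10^{-6}$. (ii) For all $r_1,r_2,r_3\in(0,1)$, $$\overline S^D_3(r_1,r_2,r_3)=\int_0^1H_2(x)\,q(x|r_1,r_2,r_3)\,dx,$$ and $$\overline S^D_3=\int_0^1\!\int_0^1\!\int_0^1\overline S^D_3(r_1,r_2,r_3)\,3r_1^2\,3r_2^2\,3r_3^2\,dr_1dr_2dr_3,\qquad |\overline S^D_3-0.95026|<5\cdot10^{-6}.$$ Consequently $\overline C^{(3)}_r=\overline S^D_3-\overline S_3$ satisfies $0.10329<\overline C^{(3)}_r<0.10330$, and $\overline C^{(3)}_r<\overline C^{(2)}_r$. -/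

import Mathlib

open MeasureTheory

noncomputable section

namespace QubitMixture

/-! ### Entropy, dephasing and coherence of complex matrices -/

/-- The von Neumann entropy `-Tr(ρ log₂ ρ)`, in bits (functional calculus, `0 log₂ 0 = 0`). -/
def vonNeumannEntropy {d : ℕ} (ρ : Matrix (Fin d) (Fin d) ℂ) : ℝ :=
  -(Matrix.trace (cfc (fun x : ℝ => x * Real.logb 2 x) ρ)).re

/-- The diagonal part `ρᴰ` of `ρ` with respect to the standard basis. -/
def diagPart {d : ℕ} (ρ : Matrix (Fin d) (Fin d) ℂ) : Matrix (Fin d) (Fin d) ℂ :=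
  Matrix.diagonal ρ.diag

/-- The relative entropy of coherence `S(ρᴰ) - S(ρ)`. -/
def coherence {d : ℕ} (ρ : Matrix (Fin d) (Fin d) ℂ) : ℝ :=
  vonNeumannEntropy (diagPart ρ) - vonNeumannEntropy ρ

/-- The equiprobable mixture `(ρ₁ + ⋯ + ρₙ) / n`. -/
def mixture {d n : ℕ} (ρ : Fin n → Matrix (Fin d) (Fin d) ℂ) : Matrix (Fin d) (Fin d) ℂ :=
  (n : ℂ)⁻¹ • ∑ j, ρ j

/-! ### The measurable structure on matrices -/

instance instMeasurableSpaceMatrix (m n : Type*) : MeasurableSpace (Matrix m n ℂ) :=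
  inferInstanceAs (MeasurableSpace (m → n → ℂ))

instance instBorelSpaceMatrix (m n : Type*) [Fintype m] [Fintype n] :
    BorelSpace (Matrix m n ℂ) :=
  inferInstanceAs (BorelSpace (m → n → ℂ))

/-! ### The ensemble of reduced states of Haar-distributed pure states -/

/-- The normalized (unitarily invariant) surface measure on the unit sphere of
`ℂᵈ ⊗ ℂᵏ = ℂ^(Fin d × Fin k)`: the law of a Haar-distributed unit vector. -/
def haarPure (d k : ℕ) :
    Measure (Metric.sphere (0 : EuclideanSpace ℂ (Fin d × Fin k)) 1) :=
  ((volume : Measure (EuclideanSpace ℂ (Fin d × Fin k))).toSphere Set.univ)⁻¹ •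
    (volume : Measure (EuclideanSpace ℂ (Fin d × Fin k))).toSphere

/-- The rank-one projection `|ψ⟩⟨ψ|`. -/
def pureState {d k : ℕ} (ψ : EuclideanSpace ℂ (Fin d × Fin k)) :
    Matrix (Fin d × Fin k) (Fin d × Fin k) ℂ :=
  Matrix.of fun p q => ψ p * star (ψ q)

/-- The partial trace over the second tensor factor. -/
def partialTrace {d k : ℕ} (X : Matrix (Fin d × Fin k) (Fin d × Fin k) ℂ) :
    Matrix (Fin d) (Fin d) ℂ :=
  Matrix.of fun i j => ∑ a, X (i, a) (j, a)

/-- The random state ensemble `𝓔_{d,k}`: the law of the partial trace over `ℂᵏ` of a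
Haar-distributed pure state of `ℂᵈ ⊗ ℂᵏ`. -/
def stateEnsemble (d k : ℕ) : Measure (Matrix (Fin d) (Fin d) ℂ) :=
  (haarPure d k).map fun ψ => partialTrace (pureState ψ.1)

/-! ### Haar measure on `SU(d)` and uniformly distributed elements of unitary orbits -/

/-- The special unitary group `SU(d)`. -/
abbrev SU (d : ℕ) := Matrix.specialUnitaryGroup (Fin d) ℂ

instance instIsTopologicalGroupSU (d : ℕ) : IsTopologicalGroup (SU d) where
  continuous_inv := by
    refine Continuous.subtype_mk (f := fun U : SU d => star U.1) ?_ _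
    exact continuous_star.comp continuous_subtype_val

instance instCompactSpaceSU (d : ℕ) : CompactSpace (SU d) := by
  suffices h : IsCompact ((Matrix.specialUnitaryGroup (Fin d) ℂ : Submonoid _) :
      Set (Matrix (Fin d) (Fin d) ℂ)) from isCompact_iff_compactSpace.mp h
  have hK : IsCompact {A : Matrix (Fin d) (Fin d) ℂ |
      ∀ i j, A i j ∈ Metric.closedBall (0 : ℂ) 1} := by
    have h := isCompact_univ_pi (fun _ : Fin d =>
      isCompact_univ_pi (fun _ : Fin d => isCompact_closedBall (0 : ℂ) 1))
    have e : {A : Matrix (Fin d) (Fin d) ℂ | ∀ i j, A i j ∈ Metric.closedBall (0 : ℂ) 1} =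
        (Set.univ.pi fun _ : Fin d => Set.univ.pi fun _ : Fin d =>
          Metric.closedBall (0 : ℂ) 1 : Set (Fin d → Fin d → ℂ)) := by
      refine Set.ext fun A => ?_
      exact ⟨fun h i _ j _ => h i j, fun h i j => h i trivial j trivial⟩
    rw [e]
    exact h
  refine hK.of_isClosed_subset ?_ ?_
  · have h : ((Matrix.specialUnitaryGroup (Fin d) ℂ : Submonoid _) :
        Set (Matrix (Fin d) (Fin d) ℂ)) = {A | A * star A = 1} ∩ {A | A.det = 1} := by
      ext A
      simp [Matrix.mem_specialUnitaryGroup_iff, Matrix.mem_unitaryGroup_iff]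
    rw [h]
    refine IsClosed.inter (isClosed_eq ?_ continuous_const) (isClosed_eq ?_ continuous_const)
    · exact continuous_id.mul continuous_star
    · exact Continuous.matrix_det continuous_id
  · intro A hA i j
    have h := entry_norm_bound_of_unitary (Matrix.specialUnitaryGroup_le_unitaryGroup hA) i j
    simpa using h

/-- The Haar probability measure on `SU(d)`. -/
def haarSU (d : ℕ) : Measure (SU d) := Measure.haarMeasure ⊤

/-- The law of `U diag(1-a, a) U†` with `U ∈ SU(2)` Haar-distributed, i.e. the uniform law on the
unitary orbit `𝓞_a` of qubit states with spectrum `{1-a, a}`. -/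
def orbitMeasure (a : ℝ) : Measure (Matrix (Fin 2) (Fin 2) ℂ) :=
  (haarSU 2).map fun U =>
    U.1 * Matrix.diagonal ![((1 - a : ℝ) : ℂ), ((a : ℝ) : ℂ)] * star U.1

/-! ### Averages over independent random states `ρ₁ ∼ μ₁, …, ρₙ ∼ μₙ` -/

/-- The average entropy `𝔼[S((ρ₁ + ⋯ + ρₙ)/n)]`. -/
def avgEntropy {d n : ℕ} (μ : Fin n → Measure (Matrix (Fin d) (Fin d) ℂ)) : ℝ :=
  ∫ ρ, vonNeumannEntropy (mixture ρ) ∂(Measure.pi μ)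

/-- The average entropy of the diagonal part, `𝔼[S((ρ₁ᴰ + ⋯ + ρₙᴰ)/n)]`. -/
def avgDiagEntropy {d n : ℕ} (μ : Fin n → Measure (Matrix (Fin d) (Fin d) ℂ)) : ℝ :=
  ∫ ρ, vonNeumannEntropy (mixture fun j => diagPart (ρ j)) ∂(Measure.pi μ)

/-- The average coherence of the equiprobable mixture. -/
def avgCoherence {d n : ℕ} (μ : Fin n → Measure (Matrix (Fin d) (Fin d) ℂ)) : ℝ :=
  ∫ ρ, coherence (mixture ρ) ∂(Measure.pi μ)

/-- The laws of `n` independent states of the ensemble `𝓔_{2,2}`. -/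
def iidQubits (n : ℕ) : Fin n → Measure (Matrix (Fin 2) (Fin 2) ℂ) :=
  fun _ => stateEnsemble 2 2

/-- The laws of three independent qubit states, uniform on the orbits `𝓞_{(1-rᵢ)/2}`. -/
def orbitTriple (r₁ r₂ r₃ : ℝ) : Fin 3 → Measure (Matrix (Fin 2) (Fin 2) ℂ) :=
  ![orbitMeasure ((1 - r₁) / 2), orbitMeasure ((1 - r₂) / 2), orbitMeasure ((1 - r₃) / 2)]

/-! ### The explicit functions -/

/-- The binary entropy function with base-two logarithms. -/
def H₂ (x : ℝ) : ℝ := -x * Real.logb 2 x - (1 - x) * Real.logb 2 (1 - x)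

/-- Density of the length of the Bloch vector of a mixture of three states of `𝓔_{2,2}`. -/
def p₃ (r : ℝ) : ℝ :=
  if r ≤ 1 / 3 then
    -(243 / 1120) * r ^ 2 * (243 * r ^ 6 - 1701 * r ^ 4 + 945 * r ^ 2 - 175)
  else
    6561 / 2240 * (1 - r) ^ 4 * r * (9 * r ^ 3 + 36 * r ^ 2 + 27 * r - 2)

/-- Conditional density at `r` of the length of the Bloch vector of a mixture of three states with
Bloch vectors of lengths `r₁ ≤ r₂ ≤ r₃`. -/
def pOrdered (r₁ r₂ r₃ r : ℝ) : ℝ :=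
  9 / 4 * (1 / (r₁ * r₂ * r₃)) *
    (if r < 0 then 0
    else if r ≤ |r₁ + r₂ - r₃| / 3 then (if r₃ ≤ r₁ + r₂ then 6 * r ^ 2 else 0)
    else if r ≤ (r₁ - r₂ + r₃) / 3 then 3 * r ^ 2 + (r₁ + r₂ - r₃) * r
    else if r ≤ (-r₁ + r₂ + r₃) / 3 then 2 * r₁ * r
    else if r ≤ (r₁ + r₂ + r₃) / 3 then -3 * r ^ 2 + (r₁ + r₂ + r₃) * r
    else 0)

/-- Density at `x` of a diagonal entry of a mixture of three states from the orbits
`𝓞_a`, `𝓞_b`, `𝓞_c` with `a ≥ b ≥ c`. -/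
def qOrdered (a b c x : ℝ) : ℝ :=
  let T₀ := (a + b + c) / 3
  let T₁ := 1 / 3 - (a - b - c) / 3
  let T₂ := 1 / 3 - (-a + b - c) / 3
  let T₃ := 1 / 2 - |1 / 6 - (a + b - c) / 3|
  let y := min x (1 - x)
  27 / 16 * (1 / ((1 / 2 - a) * (1 / 2 - b) * (1 / 2 - c))) *
    (if y < T₀ then 0
    else if y ≤ T₁ then (y - T₀) ^ 2
    else if y ≤ T₂ then (T₁ - T₀) * (2 * y - T₀ - T₁)
    else if y ≤ T₃ then -y ^ 2 + T₀ ^ 2 - T₁ ^ 2 - T₂ ^ 2 + 2 * y * (T₁ + T₂ - T₀)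
    else if a + b - c ≤ 1 / 2 then -2 * y ^ 2 + 2 * y + T₀ ^ 2 - T₁ ^ 2 - T₂ ^ 2 - T₃ ^ 2
    else T₀ ^ 2 - T₁ ^ 2 - T₂ ^ 2 + T₃ ^ 2)

/-- The smallest of three numbers. -/
def lo (x y z : ℝ) : ℝ := min x (min y z)

/-- The largest of three numbers. -/
def hi (x y z : ℝ) : ℝ := max x (max y z)

/-- The median of three numbers. -/
def med (x y z : ℝ) : ℝ := max (min x y) (min (max x y) z)

/-- The conditional density `p(r | r₁, r₂, r₃)`, symmetric in `r₁, r₂, r₃`. -/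
def pCond (r₁ r₂ r₃ r : ℝ) : ℝ :=
  pOrdered (lo r₁ r₂ r₃) (med r₁ r₂ r₃) (hi r₁ r₂ r₃) r

/-- The conditional density `q(x | r₁, r₂, r₃)` of a diagonal entry, symmetric in
`r₁, r₂, r₃`; a Bloch length `r` corresponds to the orbit parameter `(1-r)/2`. -/
def qCond (r₁ r₂ r₃ x : ℝ) : ℝ :=
  qOrdered ((1 - lo r₁ r₂ r₃) / 2) ((1 - med r₁ r₂ r₃) / 2) ((1 - hi r₁ r₂ r₃) / 2) x

end QubitMixture

end

open QubitMixture

noncomputable section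

namespace QubitMixture

open Set

/-! Everything reduces to one scalar, the upper left entry of a state. If `ρ` has eigenvalues `l`
and `1 - l`, the entry of `U ρ U†` under Haar measure is uniform between them (Archimedes' theorem
on the sphere). The derivative `isoEntropy` of `(x - 1/2) H₂(x)` has average `H₂ l` over that
interval, so `S(ρ)` is the Haar average of `isoEntropy` at the entry of `U ρ U†`
(`integral_isoEntropy_conj`). By Fubini, a unitarily invariant law satisfies `𝔼[S(ρ)] = 𝔼[isoEntropy
(entry ρ)]` (`integral_vonNeumannEntropy`). The law of a mixture is invariant and its entry is the
mean of the independent entries. Hence the average entropy and the average diagonal entropy are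
expectations of `isoEntropy` and of `H₂` at the same mean of independent scalars, and no sum of
Bloch vectors has to be studied.

The entries are `Beta(2,2)` for the ensemble and uniform on an interval for an orbit. Both laws are
identified by their moments, computed from a Gaussian integral in polar coordinates
(`integral_blockWeight_pow`, `map_norm_SU`, `map_entry_stateEnsemble`). The ensemble is a mixture of
orbits because `Beta(2,2)` is the law of `(1 - r)/2 + r t` with `t` uniform and `r` of density `3
r²` (`betaLaw_eq_map`).

Averaging a function over such densities is integration by parts: the result is a finite combination
of its iterated primitives at a few points (`betaStep`, `unifStep`), and any primitives will do.
Explicit logarithmic primitives give the closed forms. Cauchy's repeated integrals turn the same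
combination into an integral against a spline, which is the stated density `p₃`, `pCond` or `qCond`.
The numerical claims then follow from bounds on `log 2` and `log 3`. -/

/-! ### Chains of successive primitives -/

/-- `F 0, F 1, F 2, …` are successive primitives of each other on `[a, b]`. -/
structure IsPrimitiveChain (F : ℕ → ℝ → ℝ) (a b : ℝ) : Prop where
  cont : ∀ k, ContinuousOn (F (k + 1)) (Icc a b)
  deriv : ∀ k, ∀ x ∈ Ioo a b, HasDerivAt (F (k + 1)) (F k x) x
  int : IntervalIntegrable (F 0) volume a b

theorem intervalIntegrable_comp_affine {f : ℝ → ℝ} {a b s w : ℝ}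
    (hf : IntervalIntegrable f volume a b) (hw : 0 < w) (has : a ≤ s) (hsb : s + w ≤ b) :
    IntervalIntegrable (fun u => f (s + w * u)) volume 0 1 := by
  have h1 : IntervalIntegrable f volume s (s + w) := by
    refine hf.mono_set ?_
    rw [uIcc_of_le (by linarith), uIcc_of_le (by linarith)]
    exact Icc_subset_Icc has hsb
  have h2 := (h1.comp_add_left s).comp_mul_left (c := w)
  simpa [hw.ne'] using h2

/-- The effect on a chain of averaging `x ↦ F (s + w u)` over the density `6 u (1 - u)`. -/
def betaStep (w : ℝ) (F : ℕ → ℝ → ℝ) (k : ℕ) (s : ℝ) : ℝ :=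
  6 / w ^ 2 * (F (k + 2) (s + w) + F (k + 2) s) - 12 / w ^ 3 * (F (k + 3) (s + w) - F (k + 3) s)

/-- The effect on a chain of averaging `x ↦ F (s + c + w u)` over the uniform density. -/
def unifStep (c w : ℝ) (F : ℕ → ℝ → ℝ) (k : ℕ) (s : ℝ) : ℝ :=
  (F (k + 1) (s + c + w) - F (k + 1) (s + c)) / w

theorem IsPrimitiveChain.continuousOn_shift {F : ℕ → ℝ → ℝ} {a b : ℝ}
    (hF : IsPrimitiveChain F a b) (k : ℕ) {v d : ℝ} (hv : 0 ≤ v) (hd : v ≤ d) :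
    ContinuousOn (fun s => F (k + 1) (s + v)) (Icc a (b - d)) :=
  (hF.cont k).comp (by fun_prop) fun s hs => ⟨by linarith [hs.1], by linarith [hs.2]⟩

theorem IsPrimitiveChain.hasDerivAt_shift {F : ℕ → ℝ → ℝ} {a b : ℝ}
    (hF : IsPrimitiveChain F a b) (k : ℕ) {v d : ℝ} (hv : 0 ≤ v) (hd : v ≤ d) {s : ℝ}
    (hs : s ∈ Ioo a (b - d)) : HasDerivAt (fun s => F (k + 1) (s + v)) (F k (s + v)) s :=
  (hF.deriv k (s + v) ⟨by linarith [hs.1], by linarith [hs.2]⟩).comp_add_const s v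

/-- A step is a fixed linear combination of shifts, so it commutes with differentiation and can be
iterated; the interval shrinks by the length of the shift. It uses only primitives, so the new
zeroth function is continuous even when `F 0` is merely integrable. -/
theorem IsPrimitiveChain.betaStep {F : ℕ → ℝ → ℝ} {a b w : ℝ} (hF : IsPrimitiveChain F a b)
    (hw : 0 < w) (hab : w ≤ b - a) : IsPrimitiveChain (betaStep w F) a (b - w) := by
  have hc : ∀ k, ContinuousOn (QubitMixture.betaStep w F k) (Icc a (b - w)) := fun k => by
    have e0 := fun k => hF.continuousOn_shift k (v := 0) (d := w) le_rfl hw.le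
    have e1 := fun k => hF.continuousOn_shift k (v := w) (d := w) hw.le le_rfl
    simp only [add_zero] at e0
    exact (continuousOn_const.mul ((e1 (k + 1)).add (e0 (k + 1)))).sub
      (continuousOn_const.mul ((e1 (k + 2)).sub (e0 (k + 2))))
  refine ⟨fun k => hc _, fun k s hs => ?_, ?_⟩
  · have e0 := fun k => hF.hasDerivAt_shift k (v := 0) (d := w) le_rfl hw.le hs
    have e1 := fun k => hF.hasDerivAt_shift k (v := w) (d := w) hw.le le_rfl hs
    simp only [add_zero] at e0
    exact (((e1 (k + 2)).add (e0 (k + 2))).const_mul _).sub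
      (((e1 (k + 3)).sub (e0 (k + 3))).const_mul _)
  · exact ContinuousOn.intervalIntegrable (by rw [uIcc_of_le (by linarith)]; exact hc 0)

/-- Repeated integration by parts. The terms with `F 1` drop out because `6 u (1 - u)` vanishes at
both ends. Derivatives are needed only in the open interval, so logarithmic singularities of `F 0`
at the ends are allowed. -/
theorem IsPrimitiveChain.integral_beta {F : ℕ → ℝ → ℝ} {a b w s : ℝ}
    (hF : IsPrimitiveChain F a b) (hw : 0 < w) (has : a ≤ s) (hsb : s + w ≤ b) :
    ∫ u in (0 : ℝ)..1, 6 * u * (1 - u) * F 0 (s + w * u) = QubitMixture.betaStep w F 0 s := by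
  have hin : ∀ u ∈ Icc (0 : ℝ) 1, s + w * u ∈ Icc a b := fun u hu =>
    ⟨by nlinarith [hu.1], by nlinarith [hu.2]⟩
  have hin' : ∀ u ∈ Ioo (0 : ℝ) 1, s + w * u ∈ Ioo a b := fun u hu =>
    ⟨by nlinarith [mul_pos hw hu.1], by nlinarith [mul_pos hw (sub_pos.2 hu.2)]⟩
  have hc : ∀ k, ContinuousOn (fun u => F (k + 1) (s + w * u)) (Icc 0 1) := fun k =>
    (hF.cont k).comp (by fun_prop) hin
  have hd : ∀ k, ∀ u ∈ Ioo (0 : ℝ) 1,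
      HasDerivAt (fun u => F (k + 1) (s + w * u)) (F k (s + w * u) * w) u := fun k u hu => by
    have h1 : HasDerivAt (fun u : ℝ => s + w * u) w u := by
      simpa using ((hasDerivAt_id u).const_mul w).const_add s
    exact (hF.deriv k _ (hin' u hu)).comp u h1
  have key := intervalIntegral.integral_eq_sub_of_hasDerivAt_of_le (zero_le_one' ℝ)
    (f := fun u => 6 * u * (1 - u) / w * F 1 (s + w * u) - (6 - 12 * u) / w ^ 2 * F 2 (s + w * u)
      - 12 / w ^ 3 * F 3 (s + w * u)) (f' := fun u => 6 * u * (1 - u) * F 0 (s + w * u))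
    ?_ ?_ ?_
  · rw [key]
    simp only [QubitMixture.betaStep, mul_zero, mul_one, add_zero, zero_add, sub_zero]
    ring
  · refine ((ContinuousOn.mul (by fun_prop) (hc 0)).sub (ContinuousOn.mul (by fun_prop) (hc 1))).sub
      (ContinuousOn.mul (by fun_prop) (hc 2))
  · intro u hu
    have p1 : HasDerivAt (fun u : ℝ => 6 * u * (1 - u) / w) ((6 - 12 * u) / w) u := by
      have := ((((hasDerivAt_id u).const_mul 6).mul ((hasDerivAt_id u).const_sub 1)).div_const w)
      refine this.congr_deriv ?_
      simp only [id]; ring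
    have p2 : HasDerivAt (fun u : ℝ => (6 - 12 * u) / w ^ 2) (-12 / w ^ 2) u := by
      have := (((hasDerivAt_id u).const_mul 12).const_sub 6).div_const (w ^ 2)
      refine this.congr_deriv ?_
      ring
    have := ((p1.mul (hd 0 u hu)).sub (p2.mul (hd 1 u hu))).sub ((hd 2 u hu).const_mul (12 / w ^ 3))
    refine this.congr_deriv ?_
    field_simp
    ring
  · exact (intervalIntegrable_comp_affine hF.int hw has hsb).continuousOn_mul (by fun_prop)

theorem IsPrimitiveChain.unifStep {F : ℕ → ℝ → ℝ} {a b c w : ℝ} (hF : IsPrimitiveChain F a b)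
    (hc : 0 ≤ c) (hw : 0 < w) (hab : c + w ≤ b - a) :
    IsPrimitiveChain (unifStep c w F) a (b - (c + w)) := by
  have hct : ∀ k, ContinuousOn (QubitMixture.unifStep c w F k) (Icc a (b - (c + w))) := fun k => by
    have e0 := hF.continuousOn_shift k (v := c) (d := c + w) hc (by linarith)
    have e1 := hF.continuousOn_shift k (v := c + w) (d := c + w) (by linarith) le_rfl
    simp only [← add_assoc] at e1
    exact (e1.sub (by simpa only [add_assoc] using e0)).div_const w
  refine ⟨fun k => hct _, fun k s hs => ?_, ?_⟩
  · have e0 := hF.hasDerivAt_shift (k + 1) (v := c) (d := c + w) hc (by linarith) hs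
    have e1 := hF.hasDerivAt_shift (k + 1) (v := c + w) (d := c + w) (by linarith) le_rfl hs
    simp only [← add_assoc] at e1
    exact (e1.sub e0).div_const w
  · exact ContinuousOn.intervalIntegrable (by rw [uIcc_of_le (by linarith)]; exact hct 0)

theorem IsPrimitiveChain.integral_unif {F : ℕ → ℝ → ℝ} {a b c w s : ℝ}
    (hF : IsPrimitiveChain F a b) (hc : 0 ≤ c) (hw : 0 < w) (has : a ≤ s) (hsb : s + c + w ≤ b) :
    ∫ u in (0 : ℝ)..1, F 0 (s + (c + w * u)) = QubitMixture.unifStep c w F 0 s := by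
  have e : ∀ u, s + (c + w * u) = (s + c) + w * u := fun u => by ring
  simp only [e]
  have key := intervalIntegral.integral_eq_sub_of_hasDerivAt_of_le (zero_le_one' ℝ)
    (f := fun u => F 1 (s + c + w * u) / w) (f' := fun u => F 0 (s + c + w * u)) ?_ ?_ ?_
  · rw [key, QubitMixture.unifStep]
    simp only [mul_one, mul_zero, add_zero, zero_add]
    ring
  · refine ContinuousOn.div_const ((hF.cont 0).comp (by fun_prop) fun u hu =>
      ⟨by nlinarith [hu.1], by nlinarith [hu.2]⟩) _
  · intro u hu
    have h1 : HasDerivAt (fun u : ℝ => s + c + w * u) w u := by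
      simpa using ((hasDerivAt_id u).const_mul w).const_add (s + c)
    have := ((hF.deriv 0 (s + c + w * u) ⟨by nlinarith [mul_pos hw hu.1],
      by nlinarith [mul_pos hw (sub_pos.2 hu.2)]⟩).comp u h1).div_const w
    refine this.congr_deriv ?_
    field_simp
  · exact intervalIntegrable_comp_affine hF.int hw (by linarith) hsb

/-! ### Linear combinations and reflections of chains -/

theorem IsPrimitiveChain.add {F G : ℕ → ℝ → ℝ} {a b : ℝ} (hF : IsPrimitiveChain F a b)
    (hG : IsPrimitiveChain G a b) : IsPrimitiveChain (fun k x => F k x + G k x) a b :=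
  ⟨fun k => (hF.cont k).add (hG.cont k), fun k x hx => (hF.deriv k x hx).add (hG.deriv k x hx),
    hF.int.add hG.int⟩

theorem IsPrimitiveChain.const_mul {F : ℕ → ℝ → ℝ} {a b : ℝ} (hF : IsPrimitiveChain F a b)
    (c : ℝ) : IsPrimitiveChain (fun k x => c * F k x) a b :=
  ⟨fun k => continuousOn_const.mul (hF.cont k), fun k x hx => (hF.deriv k x hx).const_mul c,
    hF.int.const_mul c⟩

/-- Each differentiation of `F k (1 - x)` produces a factor `-1`, which the sign `(-1) ^ k` absorbs.
-/
theorem IsPrimitiveChain.reflect {F : ℕ → ℝ → ℝ} (hF : IsPrimitiveChain F 0 1) :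
    IsPrimitiveChain (fun k x => (-1) ^ k * F k (1 - x)) 0 1 := by
  refine ⟨fun k => continuousOn_const.mul ((hF.cont k).comp (by fun_prop) fun x hx =>
    ⟨by linarith [hx.2], by linarith [hx.1]⟩), fun k x hx => ?_, ?_⟩
  · have h1 : HasDerivAt (fun x : ℝ => 1 - x) (-1) x := by
      simpa using (hasDerivAt_id x).const_sub 1
    have := ((hF.deriv k (1 - x) ⟨by linarith [hx.2], by linarith [hx.1]⟩).comp x h1).const_mul
      ((-1) ^ (k + 1))
    refine this.congr_deriv ?_
    ring
  · have := (hF.int.comp_sub_left 1).symm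
    simpa using this

/-! ### Primitives of logarithms -/

/-- The `k`-th iterated primitive of `log`. -/
def logChain (k : ℕ) (x : ℝ) : ℝ :=
  x ^ k / (k.factorial : ℝ) * (Real.log x - ((harmonic k : ℚ) : ℝ))

/-- The `k`-th iterated primitive of `x ↦ x * log x`. -/
def mulLogChain (k : ℕ) (x : ℝ) : ℝ :=
  x ^ (k + 1) / ((k + 1).factorial : ℝ) * (Real.log x - ((harmonic (k + 1) : ℚ) : ℝ) + 1)

theorem continuous_pow_succ_mul_log (k : ℕ) :
    Continuous fun x : ℝ => x ^ (k + 1) * Real.log x := by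
  have : (fun x : ℝ => x ^ (k + 1) * Real.log x) = fun x => x ^ k * (x * Real.log x) := by
    funext x; ring
  rw [this]
  exact (continuous_pow k).mul Real.continuous_mul_log

theorem continuous_logChain_succ (k : ℕ) : Continuous (logChain (k + 1)) := by
  have : logChain (k + 1) = fun x : ℝ => (x ^ (k + 1) * Real.log x) / ((k + 1).factorial : ℝ) -
      x ^ (k + 1) / ((k + 1).factorial : ℝ) * ((harmonic (k + 1) : ℚ) : ℝ) := by
    funext x; rw [logChain]; ring
  rw [this]
  exact ((continuous_pow_succ_mul_log k).div_const _).sub (by fun_prop)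

theorem hasDerivAt_logChain_succ (k : ℕ) {x : ℝ} (hx : x ≠ 0) :
    HasDerivAt (logChain (k + 1)) (logChain k x) x := by
  have h1 := ((hasDerivAt_pow (k + 1) x).div_const ((k + 1).factorial : ℝ)).mul
    ((Real.hasDerivAt_log hx).sub_const ((harmonic (k + 1) : ℚ) : ℝ))
  have hf : (k.factorial : ℝ) ≠ 0 := by positivity
  refine h1.congr_deriv ?_
  simp only [logChain, harmonic_succ, Nat.factorial_succ]
  push_cast
  have : ((k : ℝ) + 1) ≠ 0 := by positivity
  field_simp
  ring

theorem isPrimitiveChain_logChain : IsPrimitiveChain logChain 0 1 := by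
  refine ⟨fun k => (continuous_logChain_succ k).continuousOn,
    fun k x hx => hasDerivAt_logChain_succ k hx.1.ne', ?_⟩
  have : logChain 0 = Real.log := by funext x; simp [logChain]
  rw [this]
  exact intervalIntegral.intervalIntegrable_log'

theorem mulLogChain_zero (x : ℝ) : mulLogChain 0 x = x * Real.log x := by
  simp [mulLogChain, harmonic]

theorem logChain_zero (x : ℝ) : logChain 0 x = Real.log x := by
  simp [logChain]

theorem isPrimitiveChain_mulLogChain : IsPrimitiveChain mulLogChain 0 1 := by
  -- `x log x` is the primitive `x log x - x` of `log` plus `x`, so the two chains differ by an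
  -- index shift and a monomial.
  have e : ∀ k, mulLogChain k = fun x => logChain (k + 1) x + x ^ (k + 1) / ((k + 1).factorial : ℝ) :=
    fun k => by funext x; rw [mulLogChain, logChain]; ring
  have hc : ∀ k, Continuous (mulLogChain k) := fun k => by
    rw [e]
    exact (continuous_logChain_succ k).add (by fun_prop)
  refine ⟨fun k => (hc _).continuousOn, fun k x hx => ?_, (hc 0).intervalIntegrable 0 1⟩
  rw [e, e]
  have h1 := (hasDerivAt_pow (k + 2) x).div_const ((k + 2).factorial : ℝ)
  have := (hasDerivAt_logChain_succ (k + 1) hx.1.ne').add h1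
  refine this.congr_deriv ?_
  rw [Nat.factorial_succ (k + 1)]
  push_cast
  have h2 : ((k : ℝ) + 1 + 1) ≠ 0 := by positivity
  have hf : ((k + 1).factorial : ℝ) ≠ 0 := by positivity
  field_simp
  ring

/-! ### Iterated primitives of the two entropy functions. -/

/-- The `k`-th iterated primitive of the binary entropy. -/
def entropyChain (k : ℕ) (x : ℝ) : ℝ :=
  -1 / Real.log 2 * (mulLogChain k x + (-1) ^ k * mulLogChain k (1 - x))

/-- The function whose average over an interval `[x, 1 - x]` is the binary entropy at `x`. -/
def isoEntropy (x : ℝ) : ℝ :=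
  1 / Real.log 2 * (1 / 2 * (Real.log x + Real.log (1 - x)) -
    2 * (x * Real.log x + (1 - x) * Real.log (1 - x)))

/-- The `k`-th iterated primitive of `isoEntropy`. -/
def isoEntropyChain (k : ℕ) (x : ℝ) : ℝ :=
  1 / Real.log 2 * (1 / 2 * (logChain k x + (-1) ^ k * logChain k (1 - x)) +
    -2 * (mulLogChain k x + (-1) ^ k * mulLogChain k (1 - x)))

theorem isPrimitiveChain_entropyChain : IsPrimitiveChain entropyChain 0 1 :=
  (isPrimitiveChain_mulLogChain.add isPrimitiveChain_mulLogChain.reflect).const_mul _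

theorem isPrimitiveChain_isoEntropyChain : IsPrimitiveChain isoEntropyChain 0 1 :=
  (((isPrimitiveChain_logChain.add isPrimitiveChain_logChain.reflect).const_mul _).add
    ((isPrimitiveChain_mulLogChain.add isPrimitiveChain_mulLogChain.reflect).const_mul _)).const_mul _

theorem entropyChain_zero : entropyChain 0 = H₂ := by
  funext x
  simp only [entropyChain, mulLogChain_zero, H₂, Real.logb]
  ring

theorem isoEntropyChain_zero : isoEntropyChain 0 = isoEntropy := by
  funext x
  simp only [isoEntropyChain, mulLogChain_zero, logChain_zero, isoEntropy]
  ring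

theorem continuous_H₂ : Continuous H₂ := by
  have : H₂ = fun x => -1 / Real.log 2 * (x * Real.log x + (1 - x) * Real.log (1 - x)) := by
    funext x
    simp only [H₂, Real.logb]
    ring
  rw [this]
  exact continuous_const.mul (Real.continuous_mul_log.add
    (Real.continuous_mul_log.comp (continuous_const.sub continuous_id)))

theorem H₂_one_sub (x : ℝ) : H₂ (1 - x) = H₂ x := by
  simp only [H₂, sub_sub_cancel]
  ring

theorem isoEntropy_one_sub (x : ℝ) : isoEntropy (1 - x) = isoEntropy x := by
  simp only [isoEntropy, sub_sub_cancel]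
  ring

/-- A primitive of `isoEntropy`. -/
theorem hasDerivAt_mul_H₂ {x : ℝ} (hx : x ≠ 0) (hx1 : x ≠ 1) :
    HasDerivAt (fun x => (x - 1 / 2) * H₂ x) (isoEntropy x) x := by
  have hx' : 1 - x ≠ 0 := sub_ne_zero.2 (Ne.symm hx1)
  have e : (fun x => (x - 1 / 2) * H₂ x) = fun x => -1 / Real.log 2 * ((x - 1 / 2) *
      (x * Real.log x + (1 - x) * Real.log (1 - x))) := by
    funext x
    simp only [H₂, Real.logb]
    ring
  rw [e]
  have h0 : HasDerivAt (fun x : ℝ => x - 1 / 2) 1 x := (hasDerivAt_id x).sub_const _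
  have h1 := Real.hasDerivAt_mul_log hx
  have h2 := (Real.hasDerivAt_mul_log hx').comp x ((hasDerivAt_id x).const_sub 1)
  have := (h0.mul (h1.add h2)).const_mul (-1 / Real.log 2)
  refine this.congr_deriv ?_
  simp only [isoEntropy, Pi.add_apply, Function.comp_apply]
  ring

/-! ### Primitives as integrals against truncated powers -/

/-- The `k`-th iterated primitive of `f` vanishing at `0`, by Cauchy's formula. -/
def kernelChain (f : ℝ → ℝ) (k : ℕ) (t : ℝ) : ℝ :=
  match k with
  | 0 => f t
  | k + 1 => ∫ x in (0 : ℝ)..t, f x * ((t - x) ^ k / (k.factorial : ℝ))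

/-- Integration by parts moves one primitive from the kernel to `f`. The boundary terms vanish: the
kernel is zero at `x = t` and the primitive is zero at `0`. -/
theorem kernelChain_succ_primitive {f : ℝ → ℝ} (hf : Continuous f) (k : ℕ) (t : ℝ) :
    kernelChain f (k + 2) t = kernelChain (fun s => ∫ x in (0 : ℝ)..s, f x) (k + 1) t := by
  simp only [kernelChain]
  have hF : ∀ x, HasDerivAt (fun s => ∫ x in (0 : ℝ)..s, f x) (f x) x := fun x =>
    intervalIntegral.integral_hasDerivAt_right (hf.intervalIntegrable _ _)
      hf.aestronglyMeasurable.stronglyMeasurableAtFilter hf.continuousAt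
  have hv : ∀ x, HasDerivAt (fun x => (t - x) ^ (k + 1) / ((k + 1).factorial : ℝ))
      (-((t - x) ^ k / (k.factorial : ℝ))) x := fun x => by
    have := (((hasDerivAt_id x).const_sub t).pow (k + 1)).div_const ((k + 1).factorial : ℝ)
    refine this.congr_deriv ?_
    rw [Nat.factorial_succ]
    push_cast
    have : ((k : ℝ) + 1) ≠ 0 := by positivity
    have : (k.factorial : ℝ) ≠ 0 := by positivity
    simp only [id]
    field_simp
  have key := intervalIntegral.integral_mul_deriv_eq_deriv_mul (a := 0) (b := t)
    (fun x _ => hF x) (fun x _ => hv x) (hf.intervalIntegrable _ _)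
    (Continuous.intervalIntegrable (by fun_prop) _ _)
  simp only [sub_self, intervalIntegral.integral_same, zero_mul, mul_neg,
    intervalIntegral.integral_neg] at key
  simp only [ne_eq, Nat.add_eq_zero_iff, one_ne_zero, and_false, not_false_eq_true, zero_pow,
    zero_div, mul_zero, sub_zero, zero_sub, neg_inj] at key
  exact key.symm

/-- Induction on `k` for all continuous `f` at once, passing from `f` to its primitive. This avoids
differentiating an integral whose endpoint and integrand both depend on `t`. -/
theorem hasDerivAt_kernelChain {f : ℝ → ℝ} (hf : Continuous f) (k : ℕ) (t : ℝ) :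
    HasDerivAt (kernelChain f (k + 1)) (kernelChain f k t) t := by
  have h1 : ∀ {g : ℝ → ℝ}, Continuous g →
      ∀ x, HasDerivAt (fun s => ∫ x in (0 : ℝ)..s, g x) (g x) x := fun hg x =>
    intervalIntegral.integral_hasDerivAt_right (hg.intervalIntegrable _ _)
      hg.aestronglyMeasurable.stronglyMeasurableAtFilter hg.continuousAt
  have h0 : ∀ g : ℝ → ℝ, kernelChain g 1 = fun s => ∫ x in (0 : ℝ)..s, g x := fun g => by
    funext s; simp [kernelChain]
  induction k generalizing f with
  | zero => rw [h0]; exact h1 hf t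
  | succ k ih =>
    have hc : Continuous (fun s => ∫ x in (0 : ℝ)..s, f x) :=
      continuous_iff_continuousAt.2 fun x => (h1 hf x).continuousAt
    rw [show kernelChain f (k + 1 + 1) = _ from funext (kernelChain_succ_primitive hf k)]
    refine (ih hc).congr_deriv ?_
    cases k with
    | zero => rw [h0]; rfl
    | succ k => exact (kernelChain_succ_primitive hf k t).symm

theorem isPrimitiveChain_kernelChain {f : ℝ → ℝ} (hf : Continuous f) (a b : ℝ) :
    IsPrimitiveChain (kernelChain f) a b :=
  ⟨fun k x _ => (hasDerivAt_kernelChain hf k x).continuousAt.continuousWithinAt,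
    fun k x _ => hasDerivAt_kernelChain hf k x, hf.intervalIntegrable _ _⟩

/-- The truncated power `(t - x)₊ ^ k / k!`. -/
def truncPow (k : ℕ) (x t : ℝ) : ℝ := max (t - x) 0 ^ k / (k.factorial : ℝ)

/-- The exponent must be at least `1` for the truncated power to vanish beyond `t`, since `0 ^ 0 =
1`; hence the index starts at `2`. -/
theorem kernelChain_eq_integral_truncPow {f : ℝ → ℝ} (hf : Continuous f) (k : ℕ) {t : ℝ}
    (ht : t ∈ Icc (0 : ℝ) 1) :
    kernelChain f (k + 2) t = ∫ x in (0 : ℝ)..1, f x * truncPow (k + 1) x t := by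
  have hc : Continuous fun x => f x * truncPow (k + 1) x t := by
    unfold truncPow; fun_prop
  rw [← intervalIntegral.integral_add_adjacent_intervals (hc.intervalIntegrable 0 t)
    (hc.intervalIntegrable t 1)]
  have h1 : ∫ x in t..1, f x * truncPow (k + 1) x t = 0 := by
    rw [intervalIntegral.integral_congr (g := fun _ => 0), intervalIntegral.integral_zero]
    intro x hx
    rw [uIcc_of_le ht.2] at hx
    simp [truncPow, max_eq_right (sub_nonpos.2 hx.1)]
  rw [h1, add_zero]
  simp only [kernelChain]
  refine intervalIntegral.integral_congr fun x hx => ?_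
  rw [uIcc_of_le ht.1] at hx
  simp only [truncPow, max_eq_left (sub_nonneg.2 hx.2)]

/-! ### Averaging steps acting on integral kernels. -/

/-- From index `m` on, the functions `F k` are integrals of `f` against the kernels `G · k`. -/
structure IsKernelOf (f : ℝ → ℝ) (F : ℕ → ℝ → ℝ) (G : ℝ → ℕ → ℝ → ℝ) (m : ℕ) (b : ℝ) : Prop where
  cont : ∀ k t, m ≤ k → Continuous fun x => f x * G x k t
  eq : ∀ k, ∀ t ∈ Icc 0 b, m ≤ k → F k t = ∫ x in (0 : ℝ)..1, f x * G x k t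

/-- A step is linear in the chain, so it passes under the integral and acts on the kernel alone. It
raises the index, so the threshold `m` drops. -/
theorem IsKernelOf.betaStep {f : ℝ → ℝ} {F : ℕ → ℝ → ℝ} {G : ℝ → ℕ → ℝ → ℝ} {m : ℕ} {b w : ℝ}
    (h : IsKernelOf f F G (m + 1) b) (hw : 0 < w) :
    IsKernelOf f (betaStep w F) (fun x => betaStep w (G x)) m (b - w) := by
  have e : ∀ x k t, f x * QubitMixture.betaStep w (G x) k t =
      6 / w ^ 2 * (f x * G x (k + 2) (t + w) + f x * G x (k + 2) t) -
        12 / w ^ 3 * (f x * G x (k + 3) (t + w) - f x * G x (k + 3) t) := fun x k t => by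
    simp only [QubitMixture.betaStep]; ring
  refine ⟨fun k t hk => ?_, fun k t ht hk => ?_⟩
  · simp only [e]
    have c2 := fun t => h.cont (k + 2) t (by omega)
    have c3 := fun t => h.cont (k + 3) t (by omega)
    exact (continuous_const.mul ((c2 _).add (c2 _))).sub (continuous_const.mul ((c3 _).sub (c3 _)))
  · simp only [e]
    have c2 := fun t => (h.cont (k + 2) t (by omega)).intervalIntegrable (μ := volume) 0 1
    have c3 := fun t => (h.cont (k + 3) t (by omega)).intervalIntegrable (μ := volume) 0 1
    have m0 : t ∈ Icc 0 b := ⟨ht.1, by linarith [ht.2]⟩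
    have m1 : t + w ∈ Icc 0 b := ⟨by linarith [ht.1], by linarith [ht.2]⟩
    rw [intervalIntegral.integral_sub (((c2 _).add (c2 _)).const_mul _)
      (((c3 _).sub (c3 _)).const_mul _), intervalIntegral.integral_const_mul,
      intervalIntegral.integral_const_mul, intervalIntegral.integral_add (c2 _) (c2 _),
      intervalIntegral.integral_sub (c3 _) (c3 _), ← h.eq _ _ m0 (by omega),
      ← h.eq _ _ m1 (by omega), ← h.eq _ _ m0 (by omega), ← h.eq _ _ m1 (by omega)]
    rfl

theorem IsKernelOf.unifStep {f : ℝ → ℝ} {F : ℕ → ℝ → ℝ} {G : ℝ → ℕ → ℝ → ℝ} {m : ℕ} {b c w : ℝ}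
    (h : IsKernelOf f F G (m + 1) b) (hc : 0 ≤ c) (hw : 0 < w) :
    IsKernelOf f (unifStep c w F) (fun x => unifStep c w (G x)) m (b - (c + w)) := by
  have e : ∀ x k t, f x * QubitMixture.unifStep c w (G x) k t =
      (f x * G x (k + 1) (t + c + w) - f x * G x (k + 1) (t + c)) / w := fun x k t => by
    simp only [QubitMixture.unifStep]; ring
  refine ⟨fun k t hk => ?_, fun k t ht hk => ?_⟩
  · simp only [e]
    have c1 := fun t => h.cont (k + 1) t (by omega)
    exact ((c1 _).sub (c1 _)).div_const _
  · simp only [e]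
    have c1 := fun t => (h.cont (k + 1) t (by omega)).intervalIntegrable (μ := volume) 0 1
    have m0 : t + c ∈ Icc 0 b := ⟨by linarith [ht.1], by linarith [ht.2]⟩
    have m1 : t + c + w ∈ Icc 0 b := ⟨by linarith [ht.1], by linarith [ht.2]⟩
    rw [intervalIntegral.integral_div, intervalIntegral.integral_sub (c1 _) (c1 _),
      ← h.eq _ _ m0 (by omega), ← h.eq _ _ m1 (by omega)]
    rfl

theorem isKernelOf_kernelChain {f : ℝ → ℝ} (hf : Continuous f) :
    IsKernelOf f (kernelChain f) (fun x k t => truncPow (k - 1) x t) 2 1 := by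
  refine ⟨fun k t _ => by unfold truncPow; fun_prop, fun k t ht hk => ?_⟩
  obtain ⟨k, rfl⟩ := Nat.exists_eq_add_of_le' hk
  exact kernelChain_eq_integral_truncPow hf k ht

/-- The function `(x - 1/2) H₂(x)`, a primitive of `isoEntropy`. -/
def momentEntropy (x : ℝ) : ℝ := (x - 1 / 2) * H₂ x

theorem continuous_momentEntropy : Continuous momentEntropy :=
  (continuous_id.sub continuous_const).mul continuous_H₂

/-- The iterated primitives of `isoEntropy` obtained from Cauchy's formula. -/
def isoKernelChain (k : ℕ) : ℝ → ℝ :=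
  match k with
  | 0 => isoEntropy
  | k + 1 => kernelChain momentEntropy k

theorem isPrimitiveChain_isoKernelChain : IsPrimitiveChain isoKernelChain 0 1 := by
  have h := isPrimitiveChain_kernelChain continuous_momentEntropy 0 1
  refine ⟨fun k => ?_, fun k x hx => ?_, ?_⟩
  · cases k with
    | zero => exact continuous_momentEntropy.continuousOn
    | succ k => exact h.cont k
  · cases k with
    | zero => exact hasDerivAt_mul_H₂ hx.1.ne' hx.2.ne
    | succ k => exact h.deriv k x hx
  · have := isPrimitiveChain_isoEntropyChain.int
    rwa [isoEntropyChain_zero] at this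

/-- Cauchy's formula is applied to the continuous function `momentEntropy` instead of its unbounded
derivative `isoEntropy`. This costs one power in the kernel, hence `k - 2` and the threshold `3`,
which is exactly what three averaging steps consume. -/
theorem isKernelOf_isoKernelChain :
    IsKernelOf momentEntropy isoKernelChain (fun x k t => truncPow (k - 2) x t) 3 1 := by
  have h := isKernelOf_kernelChain continuous_momentEntropy
  refine ⟨fun k t hk => ?_, fun k t ht hk => ?_⟩
  · obtain ⟨k, rfl⟩ := Nat.exists_eq_add_of_le' hk
    exact h.cont (k + 2) t (by omega)
  · obtain ⟨k, rfl⟩ := Nat.exists_eq_add_of_le' hk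
    exact h.eq (k + 2) t ht (by omega)

/-- An integral of `momentEntropy` against an odd kernel, in terms of the Bloch length. -/
theorem integral_momentEntropy_mul {V : ℝ → ℝ} (hV : Continuous V)
    (hodd : ∀ x ∈ Icc (0 : ℝ) (1 / 2), V (1 - x) = -V x) :
    ∫ x in (0 : ℝ)..1, momentEntropy x * V x =
      ∫ r in (0 : ℝ)..1, H₂ ((1 - r) / 2) * (-(r / 2) * V ((1 - r) / 2)) := by
  have hc : Continuous fun x => momentEntropy x * V x := continuous_momentEntropy.mul hV
  -- Both factors change sign under `x ↦ 1 - x`, so the two halves contribute equally.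
  have h1 : ∫ x in (1 / 2 : ℝ)..1, momentEntropy x * V x =
      ∫ x in (0 : ℝ)..1 / 2, momentEntropy x * V x := by
    have := intervalIntegral.integral_comp_sub_left (a := 0) (b := 1 / 2)
      (fun x => momentEntropy x * V x) 1
    rw [show (1 : ℝ) - 1 / 2 = 1 / 2 by norm_num, sub_zero] at this
    rw [← this]
    refine intervalIntegral.integral_congr fun x hx => ?_
    rw [uIcc_of_le (by norm_num)] at hx
    simp only [momentEntropy, H₂_one_sub, hodd x hx]
    ring
  -- Substitution `x = (1 - r) / 2`, for which `x - 1 / 2 = -r / 2`; its Jacobian cancels the factor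
  -- `2` from the two halves.
  have h2 := intervalIntegral.integral_comp_sub_mul (a := 0) (b := 1)
      (fun x => momentEntropy x * V x) (c := 1 / 2) (by norm_num) (1 / 2)
  norm_num at h2
  rw [← intervalIntegral.integral_add_adjacent_intervals (hc.intervalIntegrable 0 (1 / 2))
    (hc.intervalIntegrable (1 / 2) 1), h1, ← two_mul]
  rw [← h2]
  refine intervalIntegral.integral_congr fun r _ => ?_
  simp only [momentEntropy]
  rw [show (1 / 2 - 1 / 2 * r : ℝ) = (1 - r) / 2 by ring]
  ring

/-! ### Evaluation of the beta averages -/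

/-- The average of `F 0` at the mean of three independent `Beta(2,2)` variables. -/
def betaTriple (F : ℕ → ℝ → ℝ) : ℝ :=
  betaStep (1 / 3) (betaStep (1 / 3) (betaStep (1 / 3) F)) 0 0

/-- The average of `F 0` at the mean of two independent `Beta(2,2)` variables. -/
def betaPair (F : ℕ → ℝ → ℝ) : ℝ := betaStep (1 / 2) (betaStep (1 / 2) F) 0 0

/-- For `w = 1 / 3` the coefficients of a step are `54` and `324`. The right side expands the cube
of `54 (E + 1) - 324 (E - 1)`, with `E` the shift by `1 / 3`; each second term used raises the index
by one, from `6` up to `9`. -/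
theorem betaTriple_eq (F : ℕ → ℝ → ℝ) :
    betaTriple F = 157464 * F 6 0 + 472392 * F 6 (1 / 3) + 472392 * F 6 (2 / 3) + 157464 * F 6 1
      + 2834352 * F 7 0 + 2834352 * F 7 (1 / 3) - 2834352 * F 7 (2 / 3) - 2834352 * F 7 1
      + 17006112 * F 8 0 - 17006112 * F 8 (1 / 3) - 17006112 * F 8 (2 / 3) + 17006112 * F 8 1
      + 34012224 * F 9 0 - 102036672 * F 9 (1 / 3) + 102036672 * F 9 (2 / 3) - 34012224 * F 9 1 := by
  simp only [betaTriple, betaStep]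
  norm_num
  ring

theorem betaPair_eq (F : ℕ → ℝ → ℝ) :
    betaPair F = 576 * F 4 0 + 1152 * F 4 (1 / 2) + 576 * F 4 1 + 4608 * F 5 0 - 4608 * F 5 1
      + 9216 * F 6 0 - 18432 * F 6 (1 / 2) + 9216 * F 6 1 := by
  simp only [betaPair, betaStep]
  norm_num
  ring

theorem log_one_third : Real.log (1 / 3) = -Real.log 3 := by
  rw [one_div, Real.log_inv]

theorem log_two_thirds : Real.log (2 / 3) = Real.log 2 - Real.log 3 :=
  Real.log_div (by norm_num) (by norm_num)

theorem log_one_half : Real.log (1 / 2) = -Real.log 2 := by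
  rw [one_div, Real.log_inv]

/-- Only logarithms at `1 / 3` and `2 / 3` survive: `log 1 = 0`, and the convention `log 0 = 0` is
harmless because it is multiplied by a positive power of `0`. The harmonic numbers give the rational
part. -/
theorem betaTriple_entropyChain : betaTriple entropyChain =
    (-1951 / 1800 - 704 / 175 * Real.log 2 + 2887 / 700 * Real.log 3) / Real.log 2 := by
  have h2 : Real.log 2 ≠ 0 := (Real.log_pos (by norm_num)).ne'
  rw [betaTriple_eq]
  simp only [entropyChain, mulLogChain, harmonic, Finset.sum_range_succ, Finset.sum_range_zero,
    sub_self, sub_zero, show (1 - 1 / 3 : ℝ) = 2 / 3 by norm_num,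
    show (1 - 2 / 3 : ℝ) = 1 / 3 by norm_num, log_one_third, log_two_thirds, Real.log_one,
    Real.log_zero]
  norm_num [Nat.factorial]
  field_simp
  ring

theorem betaTriple_isoEntropyChain : betaTriple isoEntropyChain =
    (57821 + 94464 * Real.log 2 - 105498 * Real.log 3) / (12600 * Real.log 2) := by
  have h2 : Real.log 2 ≠ 0 := (Real.log_pos (by norm_num)).ne'
  rw [betaTriple_eq]
  simp only [isoEntropyChain, logChain, mulLogChain, harmonic, Finset.sum_range_succ,
    Finset.sum_range_zero,
    sub_self, sub_zero, show (1 - 1 / 3 : ℝ) = 2 / 3 by norm_num,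
    show (1 - 2 / 3 : ℝ) = 1 / 3 by norm_num, log_one_third, log_two_thirds, Real.log_one,
    Real.log_zero]
  norm_num [Nat.factorial]
  field_simp
  ring

theorem betaPair_entropyChain : betaPair entropyChain =
    (37 / 140 + 19 / 35 * Real.log 2) / Real.log 2 := by
  have h2 : Real.log 2 ≠ 0 := (Real.log_pos (by norm_num)).ne'
  rw [betaPair_eq]
  simp only [entropyChain, mulLogChain, harmonic, Finset.sum_range_succ, Finset.sum_range_zero,
    sub_self, sub_zero, show (1 - 1 / 2 : ℝ) = 1 / 2 by norm_num, log_one_half, Real.log_one,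
    Real.log_zero]
  norm_num [Nat.factorial]
  field_simp
  ring

theorem betaPair_isoEntropyChain : betaPair isoEntropyChain =
    (221 / 140 - 53 / 35 * Real.log 2) / Real.log 2 := by
  have h2 : Real.log 2 ≠ 0 := (Real.log_pos (by norm_num)).ne'
  rw [betaPair_eq]
  simp only [isoEntropyChain, logChain, mulLogChain, harmonic, Finset.sum_range_succ,
    Finset.sum_range_zero,
    sub_self, sub_zero, show (1 - 1 / 2 : ℝ) = 1 / 2 by norm_num, log_one_half, Real.log_one,
    Real.log_zero]
  norm_num [Nat.factorial]
  field_simp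
  ring

/-! ### Numerical bounds from nine digits of `log 2` and `log 3`. -/

theorem abs_betaTriple_entropyChain_sub_lt : |betaTriple entropyChain - 0.95026| < 0.000005 := by
  have h2 : 0 < Real.log 2 := Real.log_pos (by norm_num)
  rw [betaTriple_entropyChain, abs_lt, lt_sub_iff_add_lt, sub_lt_iff_lt_add, lt_div_iff₀ h2,
    div_lt_iff₀ h2]
  constructor <;> linarith [Real.log_two_gt_d9, Real.log_two_lt_d9, Real.log_three_gt_d9,
    Real.log_three_lt_d9]

theorem abs_betaTriple_isoEntropyChain_sub_lt :
    |betaTriple isoEntropyChain - 0.84696| < 0.000005 := by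
  have h2 : 0 < Real.log 2 := Real.log_pos (by norm_num)
  rw [betaTriple_isoEntropyChain, abs_lt, lt_sub_iff_add_lt, sub_lt_iff_lt_add,
    lt_div_iff₀ (by positivity), div_lt_iff₀ (by positivity)]
  constructor <;> linarith [Real.log_two_gt_d9, Real.log_two_lt_d9, Real.log_three_gt_d9,
    Real.log_three_lt_d9]

theorem betaTriple_sub_eq : betaTriple entropyChain - betaTriple isoEntropyChain =
    (-71478 - 145152 * Real.log 2 + 157464 * Real.log 3) / (12600 * Real.log 2) := by
  have h2 : Real.log 2 ≠ 0 := (Real.log_pos (by norm_num)).ne'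
  rw [betaTriple_entropyChain, betaTriple_isoEntropyChain]
  field_simp
  ring

theorem lt_betaTriple_sub : 0.10329 < betaTriple entropyChain - betaTriple isoEntropyChain := by
  have h2 : 0 < Real.log 2 := Real.log_pos (by norm_num)
  rw [betaTriple_sub_eq, lt_div_iff₀ (by positivity)]
  linarith [Real.log_two_gt_d9, Real.log_two_lt_d9, Real.log_three_gt_d9, Real.log_three_lt_d9]

/-- The value lies only about `7 · 10⁻⁸` below `0.10330`. Subtracting the two separate estimates
would not suffice; the exact combination of logarithms is bounded instead. -/
theorem betaTriple_sub_lt : betaTriple entropyChain - betaTriple isoEntropyChain < 0.10330 := by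
  have h2 : 0 < Real.log 2 := Real.log_pos (by norm_num)
  rw [betaTriple_sub_eq, div_lt_iff₀ (by positivity)]
  linarith [Real.log_two_gt_d9, Real.log_two_lt_d9, Real.log_three_gt_d9, Real.log_three_lt_d9]

/-- There is ample room: the difference for two states is about `0.161`. -/
theorem lt_betaPair_sub : 0.10330 < betaPair entropyChain - betaPair isoEntropyChain := by
  have h2 : 0 < Real.log 2 := Real.log_pos (by norm_num)
  rw [betaPair_entropyChain, betaPair_isoEntropyChain, ← sub_div, lt_div_iff₀ h2]
  linarith [Real.log_two_gt_d9, Real.log_two_lt_d9]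

/-! ### The densities as combinations of truncated powers -/

/-- The alternating sum of `(r ± r₁/3 ± r₂/3 ± r₃/3)₊ ^ k` over the eight choices of signs. -/
def altSum (k : ℕ) (r₁ r₂ r₃ r : ℝ) : ℝ :=
  max (r + (r₁ + r₂ + r₃) / 3) 0 ^ k - max (r + (r₁ + r₂ - r₃) / 3) 0 ^ k
    - max (r + (r₁ - r₂ + r₃) / 3) 0 ^ k - max (r + (-r₁ + r₂ + r₃) / 3) 0 ^ k
    + max (r + (r₁ - r₂ - r₃) / 3) 0 ^ k + max (r + (-r₁ + r₂ - r₃) / 3) 0 ^ k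
    + max (r + (-r₁ - r₂ + r₃) / 3) 0 ^ k - max (r + (-r₁ - r₂ - r₃) / 3) 0 ^ k

theorem altSum_swap₁₂ (k : ℕ) (r₁ r₂ r₃ r : ℝ) : altSum k r₂ r₁ r₃ r = altSum k r₁ r₂ r₃ r := by
  simp only [altSum]
  rw [show r₂ + r₁ = r₁ + r₂ by ring, show r₂ - r₁ = -r₁ + r₂ by ring,
    show -r₂ + r₁ = r₁ - r₂ by ring, show -r₂ - r₁ = -r₁ - r₂ by ring]
  ring

theorem altSum_swap₂₃ (k : ℕ) (r₁ r₂ r₃ r : ℝ) : altSum k r₁ r₃ r₂ r = altSum k r₁ r₂ r₃ r := by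
  simp only [altSum]
  rw [show r₁ + r₃ + r₂ = r₁ + r₂ + r₃ by ring, show r₁ + r₃ - r₂ = r₁ - r₂ + r₃ by ring,
    show r₁ - r₃ + r₂ = r₁ + r₂ - r₃ by ring, show -r₁ + r₃ + r₂ = -r₁ + r₂ + r₃ by ring,
    show r₁ - r₃ - r₂ = r₁ - r₂ - r₃ by ring, show -r₁ + r₃ - r₂ = -r₁ - r₂ + r₃ by ring,
    show -r₁ - r₃ + r₂ = -r₁ + r₂ - r₃ by ring, show -r₁ - r₃ - r₂ = -r₁ - r₂ - r₃ by ring]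
  ring

/-! ### Sorting three numbers. -/

theorem lo_med_hi_cases (x y z : ℝ) {P : ℝ → ℝ → ℝ → Prop}
    (h₁ : x ≤ y → y ≤ z → P x y z) (h₂ : x ≤ z → z ≤ y → P x z y) (h₃ : y ≤ x → x ≤ z → P y x z)
    (h₄ : y ≤ z → z ≤ x → P y z x) (h₅ : z ≤ x → x ≤ y → P z x y) (h₆ : z ≤ y → y ≤ x → P z y x) :
    P (lo x y z) (med x y z) (hi x y z) := by
  simp only [lo, med, hi]
  rcases le_total x y with hxy | hxy
  · rcases le_total y z with hyz | hyz
    · simpa [hxy, hyz, hxy.trans hyz] using h₁ hxy hyz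
    · rcases le_total x z with hxz | hxz
      · simpa [hxy, hyz, hxz] using h₂ hxz hyz
      · simpa [hxy, hyz, hxz] using h₅ hxz hxy
  · rcases le_total y z with hyz | hyz
    · rcases le_total x z with hxz | hxz
      · simpa [hxy, hyz, hxz] using h₃ hxy hxz
      · simpa [hxy, hyz, hxz] using h₄ hyz hxz
    · simpa [hxy, hyz, hyz.trans hxy] using h₆ hyz hxy

/-- The two adjacent transpositions generate all permutations, so sorting the arguments of a
symmetric function changes nothing. It removes the ordering from the formulas for the densities. -/
theorem apply_lo_med_hi {α : Type*} (f : ℝ → ℝ → ℝ → α) (h₁₂ : ∀ x y z, f y x z = f x y z)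
    (h₂₃ : ∀ x y z, f x z y = f x y z) (x y z : ℝ) :
    f (lo x y z) (med x y z) (hi x y z) = f x y z :=
  lo_med_hi_cases x y z (P := fun u v w => f u v w = f x y z) (fun _ _ => rfl) (fun _ _ => h₂₃ _ _ _)
    (fun _ _ => h₁₂ _ _ _) (fun _ _ => (h₂₃ _ _ _).trans (h₁₂ _ _ _))
    (fun _ _ => (h₁₂ _ _ _).trans (h₂₃ _ _ _))
    (fun _ _ => ((h₁₂ _ _ _).trans (h₂₃ _ _ _)).trans (h₁₂ _ _ _))

theorem lo_le_med (x y z : ℝ) : lo x y z ≤ med x y z :=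
  lo_med_hi_cases x y z (P := fun u v _ => u ≤ v) (fun h _ => h) (fun h _ => h) (fun h _ => h)
    (fun h _ => h) (fun h _ => h) (fun h _ => h)

theorem med_le_hi (x y z : ℝ) : med x y z ≤ hi x y z :=
  lo_med_hi_cases x y z (P := fun _ v w => v ≤ w) (fun _ h => h) (fun _ h => h) (fun _ h => h)
    (fun _ h => h) (fun _ h => h) (fun _ h => h)

theorem lo_pos {x y z : ℝ} (hx : 0 < x) (hy : 0 < y) (hz : 0 < z) : 0 < lo x y z := by
  simp [lo, hx, hy, hz]

/-- For ordered lengths and `r ≥ 0` three of the eight arguments of the truncations are nonnegative.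
On each piece the sign of the other five is also fixed, so the claim becomes a polynomial identity
piece by piece. -/
theorem pOrdered_eq_altSum {r₁ r₂ r₃ r : ℝ} (h₁ : 0 < r₁) (h₁₂ : r₁ ≤ r₂) (h₂₃ : r₂ ≤ r₃)
    (hr : 0 ≤ r) :
    pOrdered r₁ r₂ r₃ r = -(27 / 4) * (1 / (r₁ * r₂ * r₃)) * r * altSum 1 r₁ r₂ r₃ r := by
  have key : (if r < 0 then 0
      else if r ≤ |r₁ + r₂ - r₃| / 3 then (if r₃ ≤ r₁ + r₂ then 6 * r ^ 2 else 0)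
      else if r ≤ (r₁ - r₂ + r₃) / 3 then 3 * r ^ 2 + (r₁ + r₂ - r₃) * r
      else if r ≤ (-r₁ + r₂ + r₃) / 3 then 2 * r₁ * r
      else if r ≤ (r₁ + r₂ + r₃) / 3 then -3 * r ^ 2 + (r₁ + r₂ + r₃) * r
      else 0) = -3 * r * altSum 1 r₁ r₂ r₃ r := by
    rw [if_neg hr.not_gt]
    simp only [altSum, pow_one]
    rw [max_eq_left (show 0 ≤ r + (r₁ + r₂ + r₃) / 3 by linarith),
      max_eq_left (show 0 ≤ r + (r₁ - r₂ + r₃) / 3 by linarith),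
      max_eq_left (show 0 ≤ r + (-r₁ + r₂ + r₃) / 3 by linarith)]
    rcases abs_cases (r₁ + r₂ - r₃) with ⟨e, he⟩ | ⟨e, he⟩ <;> rw [e] <;> split_ifs <;>
    try (exfalso; linarith)
    all_goals first
      | rw [max_eq_right (show r + (r₁ + r₂ - r₃) / 3 ≤ 0 by linarith)]
      | rw [max_eq_left (show 0 ≤ r + (r₁ + r₂ - r₃) / 3 by linarith)]
    all_goals first
      | rw [max_eq_right (show r + (-r₁ - r₂ + r₃) / 3 ≤ 0 by linarith)]
      | rw [max_eq_left (show 0 ≤ r + (-r₁ - r₂ + r₃) / 3 by linarith)]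
    all_goals first
      | rw [max_eq_right (show r + (-r₁ + r₂ - r₃) / 3 ≤ 0 by linarith)]
      | rw [max_eq_left (show 0 ≤ r + (-r₁ + r₂ - r₃) / 3 by linarith)]
    all_goals first
      | rw [max_eq_right (show r + (r₁ - r₂ - r₃) / 3 ≤ 0 by linarith)]
      | rw [max_eq_left (show 0 ≤ r + (r₁ - r₂ - r₃) / 3 by linarith)]
    all_goals first
      | rw [max_eq_right (show r + (-r₁ - r₂ - r₃) / 3 ≤ 0 by linarith)]
      | rw [max_eq_left (show 0 ≤ r + (-r₁ - r₂ - r₃) / 3 by linarith)]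
    all_goals ring
  rw [pOrdered, key]
  ring

theorem pCond_eq_altSum {r₁ r₂ r₃ r : ℝ} (h₁ : 0 < r₁) (h₂ : 0 < r₂) (h₃ : 0 < r₃) (hr : 0 ≤ r) :
    pCond r₁ r₂ r₃ r = -(27 / 4) * (1 / (r₁ * r₂ * r₃)) * r * altSum 1 r₁ r₂ r₃ r := by
  rw [pCond, pOrdered_eq_altSum (lo_pos h₁ h₂ h₃) (lo_le_med _ _ _) (med_le_hi _ _ _) hr]
  refine apply_lo_med_hi
    (fun r₁ r₂ r₃ => -(27 / 4) * (1 / (r₁ * r₂ * r₃)) * r * altSum 1 r₁ r₂ r₃ r) ?_ ?_ r₁ r₂ r₃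
  · intro x y z
    rw [altSum_swap₁₂, mul_comm y x]
  · intro x y z
    rw [altSum_swap₂₃, mul_right_comm x z y]

set_option maxHeartbeats 2000000 in
-- Under `x = (1 - r) / 2` the thresholds `T₀, T₁, T₂, T₃` become the breakpoints of `pOrdered` in
-- reverse order, and `a + b - c ≤ 1 / 2` becomes `r₃ ≤ r₁ + r₂`. The same sign analysis then
-- applies.
theorem qOrdered_eq_altSum_of_le_half {r₁ r₂ r₃ r : ℝ} (h₁ : 0 < r₁) (h₁₂ : r₁ ≤ r₂) (h₂₃ : r₂ ≤ r₃)
    (hr : 0 ≤ r) :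
    qOrdered ((1 - r₁) / 2) ((1 - r₂) / 2) ((1 - r₃) / 2) ((1 - r) / 2) =
      27 / 8 * (1 / (r₁ * r₂ * r₃)) * altSum 2 r₁ r₂ r₃ r := by
  have ea : |1 / 6 - ((1 - r₁) / 2 + (1 - r₂) / 2 - (1 - r₃) / 2) / 3| = |r₁ + r₂ - r₃| / 6 := by
    rw [show 1 / 6 - ((1 - r₁) / 2 + (1 - r₂) / 2 - (1 - r₃) / 2) / 3 = (r₁ + r₂ - r₃) / 6 by ring,
      abs_div, abs_of_pos (by norm_num : (0 : ℝ) < 6)]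
  have em : min ((1 - r) / 2) (1 - (1 - r) / 2) = (1 - r) / 2 := min_eq_left (by linarith)
  have ec : 27 / 16 * (1 / ((1 / 2 - (1 - r₁) / 2) * (1 / 2 - (1 - r₂) / 2) *
      (1 / 2 - (1 - r₃) / 2))) = 27 / 8 * (1 / (r₁ * r₂ * r₃)) * 4 := by
    have h₂ := h₁.trans_le h₁₂
    have h₃ := h₂.trans_le h₂₃
    rw [show 1 / 2 - (1 - r₁) / 2 = r₁ / 2 by ring, show 1 / 2 - (1 - r₂) / 2 = r₂ / 2 by ring,
      show 1 / 2 - (1 - r₃) / 2 = r₃ / 2 by ring]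
    field_simp
    norm_num
  simp only [qOrdered, ea, em, ec]
  rw [mul_assoc (27 / 8 * (1 / (r₁ * r₂ * r₃)))]
  congr 1
  simp only [altSum]
  rw [max_eq_left (show 0 ≤ r + (r₁ + r₂ + r₃) / 3 by linarith),
    max_eq_left (show 0 ≤ r + (r₁ - r₂ + r₃) / 3 by linarith),
    max_eq_left (show 0 ≤ r + (-r₁ + r₂ + r₃) / 3 by linarith)]
  rcases abs_cases (r₁ + r₂ - r₃) with ⟨e, he⟩ | ⟨e, he⟩ <;> rw [e] <;> split_ifs <;>
  try (exfalso; linarith)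
  all_goals first
    | rw [max_eq_right (show r + (r₁ + r₂ - r₃) / 3 ≤ 0 by linarith)]
    | rw [max_eq_left (show 0 ≤ r + (r₁ + r₂ - r₃) / 3 by linarith)]
  all_goals first
    | rw [max_eq_right (show r + (-r₁ - r₂ + r₃) / 3 ≤ 0 by linarith)]
    | rw [max_eq_left (show 0 ≤ r + (-r₁ - r₂ + r₃) / 3 by linarith)]
  all_goals first
    | rw [max_eq_right (show r + (-r₁ + r₂ - r₃) / 3 ≤ 0 by linarith)]
    | rw [max_eq_left (show 0 ≤ r + (-r₁ + r₂ - r₃) / 3 by linarith)]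
  all_goals first
    | rw [max_eq_right (show r + (r₁ - r₂ - r₃) / 3 ≤ 0 by linarith)]
    | rw [max_eq_left (show 0 ≤ r + (r₁ - r₂ - r₃) / 3 by linarith)]
  all_goals first
    | rw [max_eq_right (show r + (-r₁ - r₂ - r₃) / 3 ≤ 0 by linarith)]
    | rw [max_eq_left (show 0 ≤ r + (-r₁ - r₂ - r₃) / 3 by linarith)]
  all_goals ring

/-- Negating `r` exchanges opposite sign patterns, whose coefficients are opposite. Since `(-y)₊ =
y₊ - y`, the remainder is a third difference of a linear function, which is zero. -/
theorem altSum_one_neg (r₁ r₂ r₃ r : ℝ) : altSum 1 r₁ r₂ r₃ (-r) = -altSum 1 r₁ r₂ r₃ r := by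
  have e : ∀ y : ℝ, max (-y) 0 = max y 0 - y := fun y => by
    rcases le_total y 0 with h | h
    · rw [max_eq_left (by linarith), max_eq_right h]; ring
    · rw [max_eq_right (by linarith), max_eq_left h]; ring
  simp only [altSum, pow_one]
  rw [show -r + (r₁ + r₂ + r₃) / 3 = -(r + (-r₁ - r₂ - r₃) / 3) by ring, e,
    show -r + (r₁ + r₂ - r₃) / 3 = -(r + (-r₁ - r₂ + r₃) / 3) by ring, e,
    show -r + (r₁ - r₂ + r₃) / 3 = -(r + (-r₁ + r₂ - r₃) / 3) by ring, e,
    show -r + (-r₁ + r₂ + r₃) / 3 = -(r + (r₁ - r₂ - r₃) / 3) by ring, e,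
    show -r + (r₁ - r₂ - r₃) / 3 = -(r + (-r₁ + r₂ + r₃) / 3) by ring, e,
    show -r + (-r₁ + r₂ - r₃) / 3 = -(r + (r₁ - r₂ + r₃) / 3) by ring, e,
    show -r + (-r₁ - r₂ + r₃) / 3 = -(r + (r₁ + r₂ - r₃) / 3) by ring, e,
    show -r + (-r₁ - r₂ - r₃) / 3 = -(r + (r₁ + r₂ + r₃) / 3) by ring, e]
  ring

/-- The same argument with `(-y)₊² = y² - y₊²`: third differences also kill quadratics, and the
minus sign makes the sum even. -/
theorem altSum_two_neg (r₁ r₂ r₃ r : ℝ) : altSum 2 r₁ r₂ r₃ (-r) = altSum 2 r₁ r₂ r₃ r := by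
  have e : ∀ y : ℝ, max (-y) 0 ^ 2 = y ^ 2 - max y 0 ^ 2 := fun y => by
    rcases le_total y 0 with h | h
    · rw [max_eq_left (by linarith), max_eq_right h]; ring
    · rw [max_eq_right (by linarith), max_eq_left h]; ring
  simp only [altSum]
  rw [show -r + (r₁ + r₂ + r₃) / 3 = -(r + (-r₁ - r₂ - r₃) / 3) by ring, e,
    show -r + (r₁ + r₂ - r₃) / 3 = -(r + (-r₁ - r₂ + r₃) / 3) by ring, e,
    show -r + (r₁ - r₂ + r₃) / 3 = -(r + (-r₁ + r₂ - r₃) / 3) by ring, e,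
    show -r + (-r₁ + r₂ + r₃) / 3 = -(r + (r₁ - r₂ - r₃) / 3) by ring, e,
    show -r + (r₁ - r₂ - r₃) / 3 = -(r + (-r₁ + r₂ + r₃) / 3) by ring, e,
    show -r + (-r₁ + r₂ - r₃) / 3 = -(r + (r₁ - r₂ + r₃) / 3) by ring, e,
    show -r + (-r₁ - r₂ + r₃) / 3 = -(r + (r₁ + r₂ - r₃) / 3) by ring, e,
    show -r + (-r₁ - r₂ - r₃) / 3 = -(r + (r₁ + r₂ + r₃) / 3) by ring, e]
  ring

theorem qOrdered_one_sub (a b c x : ℝ) : qOrdered a b c (1 - x) = qOrdered a b c x := by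
  simp only [qOrdered, sub_sub_cancel, min_comm (1 - x) x]

theorem qOrdered_eq_altSum {r₁ r₂ r₃ : ℝ} (h₁ : 0 < r₁) (h₁₂ : r₁ ≤ r₂) (h₂₃ : r₂ ≤ r₃) (x : ℝ) :
    qOrdered ((1 - r₁) / 2) ((1 - r₂) / 2) ((1 - r₃) / 2) x =
      27 / 8 * (1 / (r₁ * r₂ * r₃)) * altSum 2 r₁ r₂ r₃ (1 - 2 * x) := by
  rcases le_total x (1 / 2) with hx | hx
  · rw [← qOrdered_eq_altSum_of_le_half h₁ h₁₂ h₂₃ (by linarith)]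
    ring_nf
  · rw [← altSum_two_neg, ← qOrdered_eq_altSum_of_le_half h₁ h₁₂ h₂₃ (by linarith),
      ← qOrdered_one_sub]
    ring_nf

/-- In the variable `z = 1 - 2 x` this is the density of a sum of three independent variables
uniform on `[-rᵢ / 3, rᵢ / 3]`. The formula in `pCond_eq_altSum` is `-2 r` times the derivative of
that density, the relation between the radial and the marginal density of an isotropic vector in
space. -/
theorem qCond_eq_altSum {r₁ r₂ r₃ : ℝ} (h₁ : 0 < r₁) (h₂ : 0 < r₂) (h₃ : 0 < r₃) (x : ℝ) :
    qCond r₁ r₂ r₃ x = 27 / 8 * (1 / (r₁ * r₂ * r₃)) * altSum 2 r₁ r₂ r₃ (1 - 2 * x) := by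
  rw [qCond, qOrdered_eq_altSum (lo_pos h₁ h₂ h₃) (lo_le_med _ _ _) (med_le_hi _ _ _)]
  refine apply_lo_med_hi
    (fun r₁ r₂ r₃ => 27 / 8 * (1 / (r₁ * r₂ * r₃)) * altSum 2 r₁ r₂ r₃ (1 - 2 * x)) ?_ ?_ r₁ r₂ r₃
  · intro x y z
    rw [altSum_swap₁₂, mul_comm y x]
  · intro x y z
    rw [altSum_swap₂₃, mul_right_comm x z y]

/-! ### Averages as integrals against explicit densities. -/

theorem IsKernelOf.mono {f : ℝ → ℝ} {F : ℕ → ℝ → ℝ} {G : ℝ → ℕ → ℝ → ℝ} {m n : ℕ} {b : ℝ}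
    (h : IsKernelOf f F G m b) (hmn : m ≤ n) : IsKernelOf f F G n b :=
  ⟨fun k t hk => h.cont k t (hmn.trans hk), fun k t ht hk => h.eq k t ht (hmn.trans hk)⟩

/-- The average of `F 0` at the mean of three independent variables, uniform on the intervals
`[(1 - rᵢ) / 2, (1 + rᵢ) / 2]`. -/
def unifTriple (r₁ r₂ r₃ : ℝ) (F : ℕ → ℝ → ℝ) : ℝ :=
  unifStep ((1 - r₁) / 6) (r₁ / 3) (unifStep ((1 - r₂) / 6) (r₂ / 3)
    (unifStep ((1 - r₃) / 6) (r₃ / 3) F)) 0 0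

theorem unifTriple_eq (r₁ r₂ r₃ : ℝ) (F : ℕ → ℝ → ℝ) :
    unifTriple r₁ r₂ r₃ F = 27 * (1 / (r₁ * r₂ * r₃)) *
      (F 3 (1 / 2 + (r₁ + r₂ + r₃) / 6) - F 3 (1 / 2 + (r₁ + r₂ - r₃) / 6)
      - F 3 (1 / 2 + (r₁ - r₂ + r₃) / 6) - F 3 (1 / 2 + (-r₁ + r₂ + r₃) / 6)
      + F 3 (1 / 2 + (r₁ - r₂ - r₃) / 6) + F 3 (1 / 2 + (-r₁ + r₂ - r₃) / 6)
      + F 3 (1 / 2 + (-r₁ - r₂ + r₃) / 6) - F 3 (1 / 2 + (-r₁ - r₂ - r₃) / 6)) := by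
  simp only [unifTriple, unifStep, zero_add]
  rw [show (1 - r₁) / 6 + r₁ / 3 + (1 - r₂) / 6 + r₂ / 3 + (1 - r₃) / 6 + r₃ / 3 =
      1 / 2 + (r₁ + r₂ + r₃) / 6 by ring,
    show (1 - r₁) / 6 + r₁ / 3 + (1 - r₂) / 6 + r₂ / 3 + (1 - r₃) / 6 =
      1 / 2 + (r₁ + r₂ - r₃) / 6 by ring,
    show (1 - r₁) / 6 + r₁ / 3 + (1 - r₂) / 6 + (1 - r₃) / 6 + r₃ / 3 =
      1 / 2 + (r₁ - r₂ + r₃) / 6 by ring,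
    show (1 - r₁) / 6 + r₁ / 3 + (1 - r₂) / 6 + (1 - r₃) / 6 =
      1 / 2 + (r₁ - r₂ - r₃) / 6 by ring,
    show (1 - r₁) / 6 + (1 - r₂) / 6 + r₂ / 3 + (1 - r₃) / 6 + r₃ / 3 =
      1 / 2 + (-r₁ + r₂ + r₃) / 6 by ring,
    show (1 - r₁) / 6 + (1 - r₂) / 6 + r₂ / 3 + (1 - r₃) / 6 =
      1 / 2 + (-r₁ + r₂ - r₃) / 6 by ring,
    show (1 - r₁) / 6 + (1 - r₂) / 6 + (1 - r₃) / 6 + r₃ / 3 =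
      1 / 2 + (-r₁ - r₂ + r₃) / 6 by ring,
    show (1 - r₁) / 6 + (1 - r₂) / 6 + (1 - r₃) / 6 =
      1 / 2 + (-r₁ - r₂ - r₃) / 6 by ring]
  field_simp
  ring

theorem max_half (y : ℝ) : max (y / 2) 0 = max y 0 / 2 := by
  rw [← max_div_div_right (by norm_num : (0 : ℝ) ≤ 2), zero_div]

theorem unifTriple_truncPow (k : ℕ) (r₁ r₂ r₃ x : ℝ) :
    unifTriple r₁ r₂ r₃ (fun j t => truncPow (j - k) x t) =
      27 * (1 / (r₁ * r₂ * r₃)) * (altSum (3 - k) r₁ r₂ r₃ (1 - 2 * x) /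
        (2 ^ (3 - k) * ((3 - k).factorial : ℝ))) := by
  have e : ∀ z : ℝ, 1 / 2 + z / 6 - x = (1 - 2 * x + z / 3) / 2 := fun z => by ring
  simp only [unifTriple_eq, truncPow, altSum, e, max_half, div_pow]
  field_simp

theorem unifTriple_kernelChain {f : ℝ → ℝ} (hf : Continuous f) {r₁ r₂ r₃ : ℝ}
    (h₁ : r₁ ∈ Ioo (0 : ℝ) 1) (h₂ : r₂ ∈ Ioo (0 : ℝ) 1) (h₃ : r₃ ∈ Ioo (0 : ℝ) 1) :
    unifTriple r₁ r₂ r₃ (kernelChain f) =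
      ∫ x in (0 : ℝ)..1, f x * (27 / 8 * (1 / (r₁ * r₂ * r₃)) *
        altSum 2 r₁ r₂ r₃ (1 - 2 * x)) := by
  have hw : ∀ {r : ℝ}, r ∈ Ioo (0 : ℝ) 1 → 0 ≤ (1 - r) / 6 ∧ 0 < r / 3 := fun h =>
    ⟨by linarith [h.2], by linarith [h.1]⟩
  have h0 := (((((isKernelOf_kernelChain hf).mono (Nat.le_succ 2)).unifStep
    (hw h₃).1 (hw h₃).2).unifStep (hw h₂).1 (hw h₂).2).unifStep (hw h₁).1 (hw h₁).2).eq 0 0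
      ⟨le_rfl, by linarith [h₁.2, h₂.2, h₃.2]⟩ le_rfl
  have h0' : unifTriple r₁ r₂ r₃ (kernelChain f) = ∫ x in (0 : ℝ)..1, f x *
      unifTriple r₁ r₂ r₃ (fun j t => truncPow (j - 1) x t) := h0
  rw [h0']
  simp only [unifTriple_truncPow]
  refine intervalIntegral.integral_congr fun x _ => ?_
  norm_num
  left
  ring

theorem unifTriple_entropy {r₁ r₂ r₃ : ℝ}
    (h₁ : r₁ ∈ Ioo (0 : ℝ) 1) (h₂ : r₂ ∈ Ioo (0 : ℝ) 1) (h₃ : r₃ ∈ Ioo (0 : ℝ) 1) :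
    unifTriple r₁ r₂ r₃ (kernelChain H₂) = ∫ x in (0 : ℝ)..1, H₂ x * qCond r₁ r₂ r₃ x := by
  rw [unifTriple_kernelChain continuous_H₂ h₁ h₂ h₃]
  simp only [qCond_eq_altSum h₁.1 h₂.1 h₃.1]

/-- No truncation is active here, and the third difference of a linear function is zero. -/
theorem altSum_eq_zero {k : ℕ} (hk : k = 1) {r₁ r₂ r₃ r : ℝ} (h₁ : 0 < r₁) (h₂ : 0 < r₂)
    (h₃ : 0 < r₃) (hr : (r₁ + r₂ + r₃) / 3 ≤ r) : altSum k r₁ r₂ r₃ r = 0 := by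
  subst hk
  simp only [altSum, pow_one]
  repeat rw [max_eq_left (by linarith)]
  ring

/-- The kernel is odd about `1 / 2` by `altSum_one_neg`, so the integral folds to Bloch lengths in
`[0, 1]`; beyond `(r₁ + r₂ + r₃) / 3` the kernel vanishes. -/
theorem unifTriple_isoKernelChain {r₁ r₂ r₃ : ℝ}
    (h₁ : r₁ ∈ Ioo (0 : ℝ) 1) (h₂ : r₂ ∈ Ioo (0 : ℝ) 1) (h₃ : r₃ ∈ Ioo (0 : ℝ) 1) :
    unifTriple r₁ r₂ r₃ isoKernelChain =
      ∫ r in (0 : ℝ)..((r₁ + r₂ + r₃) / 3), H₂ ((1 - r) / 2) * pCond r₁ r₂ r₃ r := by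
  have hw : ∀ {r : ℝ}, r ∈ Ioo (0 : ℝ) 1 → 0 ≤ (1 - r) / 6 ∧ 0 < r / 3 := fun h =>
    ⟨by linarith [h.2], by linarith [h.1]⟩
  have hk := (((isKernelOf_isoKernelChain.unifStep (hw h₃).1 (hw h₃).2).unifStep
    (hw h₂).1 (hw h₂).2).unifStep (hw h₁).1 (hw h₁).2)
  have h0 := hk.eq 0 0 ⟨le_rfl, by linarith [h₁.2, h₂.2, h₃.2]⟩ le_rfl
  have hc : Continuous fun x => altSum 1 r₁ r₂ r₃ x := by unfold altSum; fun_prop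
  have h0' : unifTriple r₁ r₂ r₃ isoKernelChain = ∫ x in (0 : ℝ)..1, momentEntropy x *
      unifTriple r₁ r₂ r₃ (fun j t => truncPow (j - 2) x t) := h0
  simp only [unifTriple_truncPow] at h0'
  have hodd := integral_momentEntropy_mul
    (V := fun x => 27 * (1 / (r₁ * r₂ * r₃)) * (altSum (3 - 2) r₁ r₂ r₃ (1 - 2 * x) /
        (2 ^ (3 - 2) * ((3 - 2).factorial : ℝ)))) (by
      norm_num
      exact continuous_const.mul ((hc.comp (by fun_prop)).div_const _)) (fun x _ => by
      norm_num
      rw [show 1 - 2 * (1 - x) = -(1 - 2 * x) by ring, altSum_one_neg]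
      ring)
  rw [h0', hodd]
  have hc' : Continuous fun r => H₂ ((1 - r) / 2) *
      (-(27 / 4) * (1 / (r₁ * r₂ * r₃)) * r * altSum 1 r₁ r₂ r₃ r) := by
    exact (continuous_H₂.comp (by fun_prop)).mul ((by fun_prop : Continuous fun r =>
      -(27 / 4) * (1 / (r₁ * r₂ * r₃)) * r).mul hc)
  have hR : 0 ≤ (r₁ + r₂ + r₃) / 3 := by linarith [h₁.1, h₂.1, h₃.1]
  have hR1 : (r₁ + r₂ + r₃) / 3 ≤ 1 := by linarith [h₁.2, h₂.2, h₃.2]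
  have e1 : ∫ r in (0 : ℝ)..((r₁ + r₂ + r₃) / 3), H₂ ((1 - r) / 2) * pCond r₁ r₂ r₃ r =
      ∫ r in (0 : ℝ)..((r₁ + r₂ + r₃) / 3), H₂ ((1 - r) / 2) *
        (-(27 / 4) * (1 / (r₁ * r₂ * r₃)) * r * altSum 1 r₁ r₂ r₃ r) := by
    refine intervalIntegral.integral_congr fun r hr => ?_
    rw [uIcc_of_le hR] at hr
    simp only [pCond_eq_altSum h₁.1 h₂.1 h₃.1 hr.1]
  have e2 : ∫ r in ((r₁ + r₂ + r₃) / 3)..1, H₂ ((1 - r) / 2) *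
      (-(27 / 4) * (1 / (r₁ * r₂ * r₃)) * r * altSum 1 r₁ r₂ r₃ r) = 0 := by
    rw [intervalIntegral.integral_congr (g := fun _ => 0), intervalIntegral.integral_zero]
    intro r hr
    rw [uIcc_of_le hR1] at hr
    simp only [altSum_eq_zero rfl h₁.1 h₂.1 h₃.1 hr.1, mul_zero]
  rw [e1, ← add_zero (∫ r in (0 : ℝ)..((r₁ + r₂ + r₃) / 3), _), ← e2,
    intervalIntegral.integral_add_adjacent_intervals (hc'.intervalIntegrable _ _)
      (hc'.intervalIntegrable _ _)]
  refine intervalIntegral.integral_congr fun r _ => ?_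
  norm_num
  left
  rw [show 1 - 2 * ((1 - r) / 2) = r by ring]
  ring

/-- The kernel is a spline with knots `1 / 3` and `2 / 3`. Under `x = (1 - r) / 2` the pieces `hmid`
and `hlow` give the two branches of `p₃`; `hhigh` is needed only to see that the spline is odd about
`1 / 2`. -/
theorem betaTriple_isoKernelChain :
    betaTriple isoKernelChain = ∫ r in (0 : ℝ)..1, H₂ ((1 - r) / 2) * p₃ r := by
  have hk := ((isKernelOf_isoKernelChain.betaStep (w := 1 / 3) (by norm_num)).betaStep
    (w := 1 / 3) (by norm_num)).betaStep (w := 1 / 3) (by norm_num)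
  have h0 : betaTriple isoKernelChain = ∫ x in (0 : ℝ)..1, momentEntropy x *
      betaTriple (fun j t => truncPow (j - 2) x t) := hk.eq 0 0 ⟨le_rfl, by norm_num⟩ le_rfl
  have hc : Continuous fun x => betaTriple (fun j t => truncPow (j - 2) x t) := by
    simp only [betaTriple_eq, truncPow]
    fun_prop
  have hlow : ∀ x ∈ Icc (0 : ℝ) (1 / 3), betaTriple (fun j t => truncPow (j - 2) x t) =
      472392 * ((1 / 3 - x) ^ 4 / 24) + 472392 * ((2 / 3 - x) ^ 4 / 24)
      + 157464 * ((1 - x) ^ 4 / 24) + 2834352 * ((1 / 3 - x) ^ 5 / 120)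
      - 2834352 * ((2 / 3 - x) ^ 5 / 120) - 2834352 * ((1 - x) ^ 5 / 120)
      - 17006112 * ((1 / 3 - x) ^ 6 / 720) - 17006112 * ((2 / 3 - x) ^ 6 / 720)
      + 17006112 * ((1 - x) ^ 6 / 720) - 102036672 * ((1 / 3 - x) ^ 7 / 5040)
      + 102036672 * ((2 / 3 - x) ^ 7 / 5040) - 34012224 * ((1 - x) ^ 7 / 5040) := fun x hx => by
    have h := hx.1
    have h' := hx.2
    simp only [betaTriple_eq, truncPow]
    rw [max_eq_right (show 0 - x ≤ 0 by linarith), max_eq_left (show 0 ≤ 1 / 3 - x by linarith),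
      max_eq_left (show 0 ≤ 2 / 3 - x by linarith), max_eq_left (show 0 ≤ 1 - x by linarith)]
    norm_num [Nat.factorial]
  have hmid : ∀ x ∈ Icc (1 / 3 : ℝ) (2 / 3), betaTriple (fun j t => truncPow (j - 2) x t) =
      472392 * ((2 / 3 - x) ^ 4 / 24) + 157464 * ((1 - x) ^ 4 / 24)
      - 2834352 * ((2 / 3 - x) ^ 5 / 120) - 2834352 * ((1 - x) ^ 5 / 120)
      - 17006112 * ((2 / 3 - x) ^ 6 / 720) + 17006112 * ((1 - x) ^ 6 / 720)
      + 102036672 * ((2 / 3 - x) ^ 7 / 5040) - 34012224 * ((1 - x) ^ 7 / 5040) := fun x hx => by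
    have h := hx.1
    have h' := hx.2
    simp only [betaTriple_eq, truncPow]
    rw [max_eq_right (show 0 - x ≤ 0 by linarith), max_eq_right (show 1 / 3 - x ≤ 0 by linarith),
      max_eq_left (show 0 ≤ 2 / 3 - x by linarith), max_eq_left (show 0 ≤ 1 - x by linarith)]
    norm_num [Nat.factorial]
  have hhigh : ∀ x ∈ Icc (2 / 3 : ℝ) 1, betaTriple (fun j t => truncPow (j - 2) x t) =
      157464 * ((1 - x) ^ 4 / 24) - 2834352 * ((1 - x) ^ 5 / 120)
      + 17006112 * ((1 - x) ^ 6 / 720) - 34012224 * ((1 - x) ^ 7 / 5040) := fun x hx => by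
    have h := hx.1
    have h' := hx.2
    simp only [betaTriple_eq, truncPow]
    rw [max_eq_right (show 0 - x ≤ 0 by linarith), max_eq_right (show 1 / 3 - x ≤ 0 by linarith),
      max_eq_right (show 2 / 3 - x ≤ 0 by linarith), max_eq_left (show 0 ≤ 1 - x by linarith)]
    norm_num [Nat.factorial]
  rw [h0, integral_momentEntropy_mul hc]
  · refine intervalIntegral.integral_congr fun r hr => ?_
    rw [uIcc_of_le zero_le_one] at hr
    have h := hr.1
    have h' := hr.2
    simp only [p₃]
    congr 1
    split_ifs with hr3
    · rw [hmid _ ⟨by linarith, by linarith⟩]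
      ring
    · rw [hlow _ ⟨by linarith, by linarith⟩]
      ring
  · intro x hx
    have h := hx.1
    have h' := hx.2
    rcases le_total x (1 / 3) with h3 | h3
    · rw [hlow x ⟨h, h3⟩, hhigh (1 - x) ⟨by linarith, by linarith⟩]
      ring
    · rw [hmid x ⟨h3, by linarith⟩, hmid (1 - x) ⟨by linarith, by linarith⟩]
      ring

/-! ### Iterated integrals evaluated by chains. -/

theorem IsPrimitiveChain.integral_beta_pair {F : ℕ → ℝ → ℝ} (hF : IsPrimitiveChain F 0 1) :
    ∫ x in (0 : ℝ)..1, 6 * x * (1 - x) * ∫ y in (0 : ℝ)..1, 6 * y * (1 - y) *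
      F 0 (1 / 2 * x + 1 / 2 * y) = betaPair F := by
  have h1 := hF.betaStep (w := 1 / 2) (by norm_num) (by norm_num)
  rw [betaPair, ← h1.integral_beta (by norm_num) le_rfl (by norm_num)]
  refine intervalIntegral.integral_congr fun x hx => ?_
  rw [uIcc_of_le zero_le_one] at hx
  simp only [zero_add]
  rw [hF.integral_beta (by norm_num) (by linarith [hx.1]) (by linarith [hx.2])]

theorem IsPrimitiveChain.integral_beta_triple {F : ℕ → ℝ → ℝ} (hF : IsPrimitiveChain F 0 1) :
    ∫ x in (0 : ℝ)..1, 6 * x * (1 - x) * ∫ y in (0 : ℝ)..1, 6 * y * (1 - y) *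
      ∫ z in (0 : ℝ)..1, 6 * z * (1 - z) * F 0 (1 / 3 * x + 1 / 3 * y + 1 / 3 * z) =
      betaTriple F := by
  have h1 := hF.betaStep (w := 1 / 3) (by norm_num) (by norm_num)
  have h2 := h1.betaStep (w := 1 / 3) (by norm_num) (by norm_num)
  rw [betaTriple, ← h2.integral_beta (by norm_num) le_rfl (by norm_num)]
  refine intervalIntegral.integral_congr fun x hx => ?_
  rw [uIcc_of_le zero_le_one] at hx
  simp only [zero_add]
  rw [← h1.integral_beta (by norm_num) (by linarith [hx.1]) (by linarith [hx.2])]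
  congr 1
  refine intervalIntegral.integral_congr fun y hy => ?_
  rw [uIcc_of_le zero_le_one] at hy
  rw [hF.integral_beta (by norm_num) (by linarith [hx.1, hy.1]) (by linarith [hx.2, hy.2])]

theorem IsPrimitiveChain.integral_unif_triple {F : ℕ → ℝ → ℝ} (hF : IsPrimitiveChain F 0 1)
    {r₁ r₂ r₃ : ℝ} (h₁ : r₁ ∈ Ioo (0 : ℝ) 1) (h₂ : r₂ ∈ Ioo (0 : ℝ) 1) (h₃ : r₃ ∈ Ioo (0 : ℝ) 1) :
    ∫ x in (0 : ℝ)..1, ∫ y in (0 : ℝ)..1, ∫ z in (0 : ℝ)..1,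
      F 0 (((1 - r₁) / 6 + r₁ / 3 * x) + ((1 - r₂) / 6 + r₂ / 3 * y) +
        ((1 - r₃) / 6 + r₃ / 3 * z)) = unifTriple r₁ r₂ r₃ F := by
  obtain ⟨a₁, b₁⟩ := h₁
  obtain ⟨a₂, b₂⟩ := h₂
  obtain ⟨a₃, b₃⟩ := h₃
  have i1 := hF.unifStep (c := (1 - r₃) / 6) (w := r₃ / 3) (by linarith) (by linarith) (by linarith)
  have i2 := i1.unifStep (c := (1 - r₂) / 6) (w := r₂ / 3) (by linarith) (by linarith) (by linarith)
  rw [unifTriple, ← i2.integral_unif (by linarith) (by linarith) le_rfl (by linarith)]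
  refine intervalIntegral.integral_congr fun x hx => ?_
  rw [uIcc_of_le zero_le_one] at hx
  have x1 : 0 ≤ r₁ / 3 * x := mul_nonneg (by linarith) hx.1
  have x2 : r₁ / 3 * x ≤ r₁ / 3 := mul_le_of_le_one_right (by linarith) hx.2
  simp only [zero_add]
  rw [← i1.integral_unif (by linarith) (by linarith) (by linarith) (by linarith)]
  refine intervalIntegral.integral_congr fun y hy => ?_
  rw [uIcc_of_le zero_le_one] at hy
  have y1 : 0 ≤ r₂ / 3 * y := mul_nonneg (by linarith) hy.1
  have y2 : r₂ / 3 * y ≤ r₂ / 3 := mul_le_of_le_one_right (by linarith) hy.2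
  rw [hF.integral_unif (by linarith) (by linarith) (by linarith) (by linarith)]

/-! ### Moments on the unit interval -/

/-- Two finite measures on `[0, 1]` with the same moments are equal. -/
theorem ext_of_moments {P Q : Measure ℝ} [IsFiniteMeasure P] [IsFiniteMeasure Q]
    (hP : ∀ᵐ x ∂P, x ∈ Icc (0 : ℝ) 1) (hQ : ∀ᵐ x ∂Q, x ∈ Icc (0 : ℝ) 1)
    (h : ∀ n : ℕ, ∫ x, x ^ n ∂P = ∫ x, x ^ n ∂Q) : P = Q := by
  have hint : ∀ {ν : Measure ℝ} [IsFiniteMeasure ν], (∀ᵐ x ∂ν, x ∈ Icc (0 : ℝ) 1) →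
      ∀ {f : ℝ → ℝ}, Continuous f → Integrable f ν := fun {ν} _ hR {f} hf => by
    obtain ⟨C, hC⟩ := isCompact_Icc.exists_bound_of_continuousOn (s := Icc (0 : ℝ) 1) hf.continuousOn
    exact Integrable.of_bound hf.aestronglyMeasurable C (hR.mono fun x hx => hC x hx)
  have hpoly : ∀ p : Polynomial ℝ, ∫ x, p.eval x ∂P = ∫ x, p.eval x ∂Q := fun p => by
    simp only [Polynomial.eval_eq_sum_range]
    rw [integral_finsetSum _ fun i _ => (hint hP (by fun_prop)),
      integral_finsetSum _ fun i _ => (hint hQ (by fun_prop))]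
    simp only [integral_const_mul, h]
  refine ext_of_forall_integral_eq_of_IsFiniteMeasure fun f => ?_
  have hbound : ∀ {ν : Measure ℝ} [IsFiniteMeasure ν], (∀ᵐ x ∂ν, x ∈ Icc (0 : ℝ) 1) →
      ∀ {p : Polynomial ℝ} {ε : ℝ}, (∀ x ∈ Icc (0 : ℝ) 1, |p.eval x - f x| < ε) →
      |∫ x, p.eval x ∂ν - ∫ x, f x ∂ν| ≤ ε * ν.real univ := fun {ν} _ hR {p ε} hp => by
    rw [← integral_sub (hint hR p.continuous) (hint hR f.continuous)]
    exact norm_integral_le_of_norm_le_const (f := fun x => p.eval x - f x)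
      (hR.mono fun x hx => (hp x hx).le)
  refine eq_of_forall_dist_le fun ε hε => ?_
  have hM : 0 < P.real univ + Q.real univ + 1 := by positivity
  -- Weierstrass approximation on `[0, 1]`. The tolerance is scaled so that the errors under both
  -- measures add up to at most `ε`; the `+ 1` keeps the denominator positive.
  obtain ⟨p, hp⟩ := exists_polynomial_near_of_continuousOn 0 1 f f.continuous.continuousOn
    (ε / (P.real univ + Q.real univ + 1)) (by positivity)
  have h1 := hbound hP hp
  have h2 := hbound hQ hp
  rw [hpoly] at h1
  rw [Real.dist_eq]
  have h3 : ε / (P.real univ + Q.real univ + 1) * (P.real univ + Q.real univ) ≤ ε := by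
    rw [div_mul_eq_mul_div, div_le_iff₀ hM]
    nlinarith [hε.le]
  have h4 := abs_sub_le (∫ x, f x ∂P) (∫ x, p.eval x ∂Q) (∫ x, f x ∂Q)
  rw [abs_sub_comm (∫ x, f x ∂P) (∫ x, p.eval x ∂Q)] at h4
  rw [mul_add] at h3
  linarith

/-! ### Gaussian moments and the surface measure -/

section Sphere

/-- The action of a linear isometry on the unit sphere. -/
def sphereMap {E : Type*} [NormedAddCommGroup E] [InnerProductSpace ℝ E]
    (T : E ≃ₗᵢ[ℝ] E) (x : Metric.sphere (0 : E) 1) : Metric.sphere (0 : E) 1 :=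
  ⟨T x, by simp⟩

theorem continuous_sphereMap {E : Type*} [NormedAddCommGroup E] [InnerProductSpace ℝ E]
    (T : E ≃ₗᵢ[ℝ] E) : Continuous (sphereMap T) :=
  (T.continuous.comp continuous_subtype_val).subtype_mk _

variable {E : Type*} [NormedAddCommGroup E] [InnerProductSpace ℝ E] [FiniteDimensional ℝ E]
  [MeasurableSpace E] [BorelSpace E]

theorem integral_pow_mul_exp_neg_sq (j : ℕ) :
    ∫ r in Ioi (0 : ℝ), r ^ (2 * j + 1) * Real.exp (-r ^ 2) = (j.factorial : ℝ) / 2 := by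
  have h := integral_rpow_mul_exp_neg_rpow (p := 2) (q := 2 * j + 1) (by norm_num)
    (by have : (0 : ℝ) ≤ j := by positivity
        linarith)
  rw [show ((2 * j + 1 + 1 : ℝ) / 2) = j + 1 by ring, Real.Gamma_nat_eq_factorial] at h
  rw [div_eq_inv_mul, ← one_div, ← h]
  refine setIntegral_congr_fun measurableSet_Ioi fun r _ => ?_
  rw [← Real.rpow_natCast, Real.rpow_two]
  push_cast
  rfl

/-- Integration of a homogeneous function against a Gaussian, in polar coordinates. -/
theorem integral_homogeneous_mul_gaussian [Nontrivial E] {g : E → ℝ} {n j : ℕ}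
    (hg : ∀ (r : ℝ) (x : E), 0 < r → g (r • x) = r ^ (2 * n) * g x)
    (hd : Module.finrank ℝ E = 2 * (j + 1)) :
    ∫ x, g x * Real.exp (-‖x‖ ^ 2) =
      (∫ x, g x ∂(volume : Measure E).toSphere) * (((j + n).factorial : ℝ) / 2) := by
  have key := (volume : Measure E).measurePreserving_homeomorphUnitSphereProd.integral_comp
        (Homeomorph.measurableEmbedding _)
        (fun p : Metric.sphere (0 : E) 1 × Ioi (0 : ℝ) =>
          g p.1 * ((p.2 : ℝ) ^ (2 * n) * Real.exp (-(p.2 : ℝ) ^ 2)))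
  rw [integral_prod_mul (fun x : Metric.sphere (0 : E) 1 => g x)
    (fun r : Ioi (0 : ℝ) => (r : ℝ) ^ (2 * n) * Real.exp (-(r : ℝ) ^ 2))] at key
  -- The radial density `r ^ (2 j + 1)` and the homogeneity factor `r ^ (2 n)` combine to the odd
  -- power `2 (j + n) + 1`, whose Gaussian integral is a factorial.
  have hrad : ∫ r : Ioi (0 : ℝ), (r : ℝ) ^ (2 * n) * Real.exp (-(r : ℝ) ^ 2)
      ∂(Measure.volumeIoiPow (Module.finrank ℝ E - 1)) = ((j + n).factorial : ℝ) / 2 := by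
    simp only [Measure.volumeIoiPow, ENNReal.ofReal]
    rw [integral_withDensity_eq_integral_smul (by fun_prop),
      integral_subtype_comap measurableSet_Ioi fun a : ℝ =>
        Real.toNNReal (a ^ (Module.finrank ℝ E - 1)) • (a ^ (2 * n) * Real.exp (-a ^ 2)),
      ← integral_pow_mul_exp_neg_sq]
    refine setIntegral_congr_fun measurableSet_Ioi fun r hr => ?_
    rw [NNReal.smul_def, Real.coe_toNNReal _ (pow_nonneg (le_of_lt hr) _), hd, smul_eq_mul,
      ← mul_assoc, ← pow_add]
    congr 2
    omega
  rw [hrad] at key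
  -- Polar coordinates are defined off the origin, which is a null set.
  rw [← key, ← restrict_compl_singleton (μ := (volume : Measure E)) 0,
    ← integral_subtype_comap (measurableSet_singleton _).compl
      fun x : E => g x * Real.exp (-‖x‖ ^ 2), restrict_compl_singleton]
  refine integral_congr_ae (Filter.Eventually.of_forall fun x => ?_)
  have hx : 0 < ‖(x : E)‖ := norm_pos_iff.2 x.2
  have h1 := hg ‖(x : E)‖ (‖(x : E)‖⁻¹ • (x : E)) hx
  rw [smul_inv_smul₀ hx.ne'] at h1
  simp only [homeomorphUnitSphereProd_apply_fst_coe, homeomorphUnitSphereProd_apply_snd_coe]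
  rw [h1]
  ring

open scoped Pointwise in
-- The surface measure of a set is a multiple of the volume of the cone over it, and a linear
-- isometry maps cones to cones and preserves volume.
theorem measurePreserving_sphereMap (T : E ≃ₗᵢ[ℝ] E) :
    MeasurePreserving (sphereMap T) (volume : Measure E).toSphere (volume : Measure E).toSphere := by
  refine ⟨(continuous_sphereMap T).measurable, Measure.ext fun s hs => ?_⟩
  rw [Measure.map_apply (continuous_sphereMap T).measurable hs,
    Measure.toSphere_apply' _ ((continuous_sphereMap T).measurable hs),
    Measure.toSphere_apply' _ hs]
  congr 1
  rw [← MeasurePreserving.measure_preimage_equiv (f := T.toMeasurableEquiv) T.measurePreserving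
    (Ioo (0 : ℝ) 1 • (Subtype.val '' s : Set E))]
  congr 1
  ext x
  simp only [Set.mem_smul, Set.mem_image, Set.mem_preimage]
  constructor
  · rintro ⟨r, hr, _, ⟨y, hy, rfl⟩, rfl⟩
    exact ⟨r, hr, _, ⟨sphereMap T y, hy, rfl⟩, (map_smul T r (y : E)).symm⟩
  · rintro ⟨r, hr, _, ⟨y, hy, rfl⟩, h⟩
    refine ⟨r, hr, _, ⟨sphereMap T.symm y, ?_, rfl⟩, ?_⟩
    · simpa [sphereMap] using hy
    · simp only [sphereMap]
      rw [← map_smul, h]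
      exact T.symm_apply_apply x

end Sphere

/-! ### The weight of a Haar-distributed pure state on the first basis vector -/

/-- The splitting of `ℂ² ⊗ ℂᵏ` into two orthogonal copies of `ℂᵏ`. -/
def splitIsometry (k : ℕ) : EuclideanSpace ℂ (Fin 2 × Fin k) ≃ₗᵢ[ℝ]
    WithLp 2 (EuclideanSpace ℂ (Fin k) × EuclideanSpace ℂ (Fin k)) where
  toFun x := WithLp.toLp 2 (WithLp.toLp 2 fun a => x (0, a), WithLp.toLp 2 fun a => x (1, a))
  invFun p := WithLp.toLp 2 fun q => if q.1 = 0 then p.fst q.2 else p.snd q.2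
  map_add' _ _ := rfl
  map_smul' _ _ := rfl
  left_inv x := by
    ext ⟨i, a⟩
    fin_cases i <;> simp
  right_inv p := by
    apply WithLp.ofLp_injective
    ext a <;> simp
  norm_map' x := by
    change ‖WithLp.toLp 2 ((WithLp.toLp 2 fun a => x (0, a) : EuclideanSpace ℂ (Fin k)),
      (WithLp.toLp 2 fun a => x (1, a) : EuclideanSpace ℂ (Fin k)))‖ = ‖x‖
    rw [← sq_eq_sq₀ (norm_nonneg _) (norm_nonneg _), WithLp.prod_norm_sq_eq_of_L2,
      EuclideanSpace.norm_sq_eq, EuclideanSpace.norm_sq_eq, EuclideanSpace.norm_sq_eq,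
      Fintype.sum_prod_type, Fin.sum_univ_two]
    rfl

/-- The squared norm of the first block of a vector of `ℂ² ⊗ ℂᵏ`. -/
def blockWeight {k : ℕ} (x : EuclideanSpace ℂ (Fin 2 × Fin k)) : ℝ := ∑ a, ‖x (0, a)‖ ^ 2

theorem blockWeight_eq {k : ℕ} (x : EuclideanSpace ℂ (Fin 2 × Fin k)) :
    blockWeight x = ‖(splitIsometry k x).fst‖ ^ 2 := by
  rw [EuclideanSpace.norm_sq_eq]
  rfl

theorem continuous_blockWeight {k : ℕ} :
    Continuous (blockWeight : EuclideanSpace ℂ (Fin 2 × Fin k) → ℝ) := by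
  unfold blockWeight
  fun_prop

theorem blockWeight_nonneg {k : ℕ} (x : EuclideanSpace ℂ (Fin 2 × Fin k)) : 0 ≤ blockWeight x :=
  Finset.sum_nonneg fun _ _ => by positivity

theorem blockWeight_le {k : ℕ} (x : EuclideanSpace ℂ (Fin 2 × Fin k)) : blockWeight x ≤ ‖x‖ ^ 2 := by
  rw [EuclideanSpace.norm_sq_eq, Fintype.sum_prod_type, Fin.sum_univ_two, blockWeight]
  exact le_add_of_nonneg_right (Finset.sum_nonneg fun _ _ => by positivity)

theorem blockWeight_smul {k : ℕ} (r : ℝ) (x : EuclideanSpace ℂ (Fin 2 × Fin k)) :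
    blockWeight (r • x) = r ^ 2 * blockWeight x := by
  simp only [blockWeight, PiLp.smul_apply, norm_smul, mul_pow, Finset.mul_sum, Real.norm_eq_abs,
    sq_abs]

theorem finrank_euclideanSpace_complex (ι : Type*) [Fintype ι] :
    Module.finrank ℝ (EuclideanSpace ℂ ι) = 2 * Fintype.card ι := by
  rw [← Module.finrank_mul_finrank ℝ ℂ (EuclideanSpace ℂ ι), Complex.finrank_real_complex,
    finrank_euclideanSpace]

theorem toSphere_univ_ne_zero (k : ℕ) :
    (volume : Measure (EuclideanSpace ℂ (Fin 2 × Fin (k + 1)))).toSphere univ ≠ 0 := by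
  rw [Ne, Measure.measure_univ_eq_zero]
  exact Measure.toSphere_ne_zero _

instance isProbabilityMeasure_haarPure (k : ℕ) : IsProbabilityMeasure (haarPure 2 (k + 1)) := by
  refine ⟨?_⟩
  rw [haarPure, Measure.smul_apply, smul_eq_mul]
  exact ENNReal.inv_mul_cancel (toSphere_univ_ne_zero k) (measure_ne_top _ _)

/-- The Gaussian integral of `blockWeight ^ n` is computed twice: in polar coordinates on the whole
space, and as a product over the two blocks with polar coordinates on the first. The constant `c`
does not depend on `n`, so it need not be evaluated. -/
theorem integral_blockWeight_mul_gaussian (k : ℕ) :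
    ∃ c : ℝ, ∀ n : ℕ, (∫ x, blockWeight (x : EuclideanSpace ℂ (Fin 2 × Fin (k + 1))) ^ n
      ∂(volume : Measure (EuclideanSpace ℂ (Fin 2 × Fin (k + 1)))).toSphere) *
        (((2 * k + 1 + n).factorial : ℝ) / 2) = c * (k + n).factorial := by
  set U := EuclideanSpace ℂ (Fin (k + 1))
  refine ⟨(volume : Measure U).toSphere.real univ / 2 * ∫ v : U, Real.exp (-‖v‖ ^ 2), fun n => ?_⟩
  have hU : Module.finrank ℝ U = 2 * (k + 1) := by
    rw [finrank_euclideanSpace_complex, Fintype.card_fin]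
  have hE : Module.finrank ℝ (EuclideanSpace ℂ (Fin 2 × Fin (k + 1))) = 2 * ((2 * k + 1) + 1) := by
    rw [finrank_euclideanSpace_complex, Fintype.card_prod, Fintype.card_fin, Fintype.card_fin]
    ring
  rw [← integral_homogeneous_mul_gaussian (g := fun x => blockWeight x ^ n) (n := n)
    (fun r x _ => by rw [blockWeight_smul, mul_pow, ← pow_mul]) hE]
  have h1 := integral_homogeneous_mul_gaussian (E := U) (g := fun x => ‖x‖ ^ (2 * n)) (n := n)
    (fun r x hr => by rw [norm_smul, mul_pow, Real.norm_of_nonneg hr.le]) hU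
  have h2 : ∫ x : Metric.sphere (0 : U) 1, ‖(x : U)‖ ^ (2 * n) ∂(volume : Measure U).toSphere =
      (volume : Measure U).toSphere.real univ := by
    simp
  rw [h2] at h1
  have h3 := integral_prod_mul (μ := (volume : Measure U)) (ν := (volume : Measure U))
    (fun u => ‖u‖ ^ (2 * n) * Real.exp (-‖u‖ ^ 2)) (fun v => Real.exp (-‖v‖ ^ 2))
  rw [h1] at h3
  have hmp := ((WithLp.volume_preserving_ofLp U U).comp (splitIsometry (k + 1)).measurePreserving)
  have h4 := hmp.integral_comp (((MeasurableEquiv.toLp 2 (U × U)).symm.measurableEmbedding).comp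
    (splitIsometry (k + 1)).toMeasurableEquiv.measurableEmbedding)
    (fun z : U × U => ‖z.1‖ ^ (2 * n) * Real.exp (-‖z.1‖ ^ 2) * Real.exp (-‖z.2‖ ^ 2))
  rw [Measure.volume_eq_prod, h3] at h4
  rw [show ∀ A B C : ℝ, A / 2 * B * C = A * (C / 2) * B from fun A B C => by ring, ← h4]
  refine integral_congr_ae (Filter.Eventually.of_forall fun x => ?_)
  have hn : ‖x‖ ^ 2 = ‖(splitIsometry (k + 1) x).fst‖ ^ 2 + ‖(splitIsometry (k + 1) x).snd‖ ^ 2 := by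
    rw [← WithLp.prod_norm_sq_eq_of_L2, LinearIsometryEquiv.norm_map]
  simp only [blockWeight_eq, hn, Function.comp_apply]
  rw [neg_add, Real.exp_add, ← pow_mul, mul_assoc]
  rfl

/-- The moments of the weight of the first block of a Haar-distributed unit vector. -/
theorem integral_blockWeight_pow (k n : ℕ) :
    ∫ x, blockWeight (x : EuclideanSpace ℂ (Fin 2 × Fin (k + 1))) ^ n ∂(haarPure 2 (k + 1)) =
      ((k + n).factorial * (2 * k + 1).factorial : ℝ) /
        (k.factorial * (2 * k + 1 + n).factorial) := by
  obtain ⟨c, hc⟩ := integral_blockWeight_mul_gaussian k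
  have hn := hc n
  have h0 := hc 0
  simp only [pow_zero, add_zero] at h0
  rw [integral_const, smul_eq_mul, mul_one] at h0
  have hS : (volume : Measure (EuclideanSpace ℂ (Fin 2 × Fin (k + 1)))).toSphere.real univ ≠ 0 :=
    (ENNReal.toReal_pos (toSphere_univ_ne_zero k) (measure_ne_top _ _)).ne'
  rw [haarPure, integral_smul_measure, smul_eq_mul, ENNReal.toReal_inv, ← measureReal_def]
  have hk : (k.factorial : ℝ) ≠ 0 := by positivity
  have hk2 : ((2 * k + 1).factorial : ℝ) ≠ 0 := by positivity
  have hk3 : ((2 * k + 1 + n).factorial : ℝ) ≠ 0 := by positivity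
  -- The case `n = 0` expresses `c` through the total surface measure, which cancels after
  -- normalization.
  have ec : c = (volume : Measure (EuclideanSpace ℂ (Fin 2 × Fin (k + 1)))).toSphere.real univ *
      ((2 * k + 1).factorial / 2) / k.factorial := by
    rw [h0]; field_simp
  rw [ec] at hn
  rw [inv_mul_eq_div, div_eq_div_iff hS (by positivity)]
  field_simp at hn
  linear_combination hn

/-! ### Haar measure on `SU(2)` -/

instance instSecondCountableMatrix (m n : Type*) [Fintype m] [Fintype n] :
    SecondCountableTopology (Matrix m n ℂ) :=
  inferInstanceAs (SecondCountableTopology (m → n → ℂ))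

instance isProbabilityMeasure_haarSU (d : ℕ) : IsProbabilityMeasure (haarSU d) :=
  ⟨Measure.haarMeasure_self⟩

instance isHaarMeasure_haarSU (d : ℕ) : (haarSU d).IsHaarMeasure := by
  unfold haarSU; infer_instance

/-- A right translate of the Haar probability is again a Haar probability, and that measure is
unique. -/
instance isMulRightInvariant_haarSU (d : ℕ) : (haarSU d).IsMulRightInvariant := by
  refine ⟨fun g => ?_⟩
  have : IsProbabilityMeasure ((haarSU d).map (· * g)) :=
    Measure.isProbabilityMeasure_map (measurable_mul_const g).aemeasurable
  exact Measure.isHaarMeasure_eq_of_isProbabilityMeasure _ _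

theorem continuous_SU_apply {d : ℕ} (i j : Fin d) : Continuous fun U : SU d => U.1 i j :=
  continuous_subtype_val.matrix_elem i j

/-- Every unit vector of `ℂ²` is the first column of an element of `SU(2)`. -/
theorem exists_SU_column {v : Fin 2 → ℂ} (hv : ‖v 0‖ ^ 2 + ‖v 1‖ ^ 2 = 1) :
    ∃ V : SU 2, ∀ i, V.1 i 0 = v i := by
  have h : v 0 * star (v 0) + v 1 * star (v 1) = 1 := by
    have e : ∀ z : ℂ, z * star z = ((‖z‖ ^ 2 : ℝ) : ℂ) := fun z => by
      rw [Complex.star_def, Complex.mul_conj, Complex.normSq_eq_norm_sq]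
    rw [e, e, ← Complex.ofReal_add, hv, Complex.ofReal_one]
  simp only [Complex.star_def] at h
  refine ⟨⟨!![v 0, -star (v 1); v 1, star (v 0)], ?_⟩, fun i => by fin_cases i <;> rfl⟩
  rw [Matrix.mem_specialUnitaryGroup_iff, Matrix.mem_unitaryGroup_iff']
  constructor
  · ext i j
    fin_cases i <;> fin_cases j <;>
      simp [Matrix.mul_apply, Fin.sum_univ_two, Matrix.star_apply] <;>
      first | linear_combination h | ring
  · rw [Matrix.det_fin_two_of, Complex.star_def]
    linear_combination h

/-- If `v` is the first column of `V`, the combination is the upper left entry of `U V`, and Haar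
measure is right invariant. -/
theorem integral_haarSU_column {v : Fin 2 → ℂ} (hv : ‖v 0‖ ^ 2 + ‖v 1‖ ^ 2 = 1) (f : ℝ → ℝ) :
    ∫ U : SU 2, f (‖U.1 0 0 * v 0 + U.1 0 1 * v 1‖ ^ 2) ∂haarSU 2 =
      ∫ U : SU 2, f (‖U.1 0 0‖ ^ 2) ∂haarSU 2 := by
  obtain ⟨V, hV⟩ := exists_SU_column hv
  symm
  rw [← integral_mul_right_eq_self _ V]
  refine integral_congr_ae (Filter.Eventually.of_forall fun U => ?_)
  simp only [Submonoid.coe_mul, Matrix.mul_apply, Fin.sum_univ_two, hV]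

/-! ### Local unitaries acting on pure states -/

/-- The coefficient matrix of a vector of `ℂᵈ ⊗ ℂᵏ`. -/
def coeffMatrix {d k : ℕ} (x : EuclideanSpace ℂ (Fin d × Fin k)) : Matrix (Fin d) (Fin k) ℂ :=
  Matrix.of fun i a => x (i, a)

open Matrix in
theorem partialTrace_pureState {d k : ℕ} (x : EuclideanSpace ℂ (Fin d × Fin k)) :
    partialTrace (pureState x) = coeffMatrix x * (coeffMatrix x)ᴴ := by
  ext i j
  simp [partialTrace, pureState, coeffMatrix, Matrix.mul_apply]

theorem norm_sq_eq_trace {d k : ℕ} (x : EuclideanSpace ℂ (Fin d × Fin k)) :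
    ((‖x‖ ^ 2 : ℝ) : ℂ) = (partialTrace (pureState x)).trace := by
  rw [EuclideanSpace.norm_sq_eq, Fintype.sum_prod_type]
  simp only [partialTrace, pureState, Matrix.trace, Matrix.diag, Matrix.of_apply, Complex.ofReal_sum]
  refine Finset.sum_congr rfl fun i _ => Finset.sum_congr rfl fun a _ => ?_
  rw [Complex.star_def, Complex.mul_conj, Complex.normSq_eq_norm_sq]

/-- The vector `(U ⊗ 1) x`. -/
def localVector {d k : ℕ} (U : SU d) (x : EuclideanSpace ℂ (Fin d × Fin k)) :
    EuclideanSpace ℂ (Fin d × Fin k) :=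
  WithLp.toLp 2 fun q => ∑ j, U.1 q.1 j * x (j, q.2)

theorem coeffMatrix_localVector {d k : ℕ} (U : SU d) (x : EuclideanSpace ℂ (Fin d × Fin k)) :
    coeffMatrix (localVector U x) = U.1 * coeffMatrix x := by
  ext i a
  simp [coeffMatrix, localVector, Matrix.mul_apply]

theorem partialTrace_localVector {d k : ℕ} (U : SU d) (x : EuclideanSpace ℂ (Fin d × Fin k)) :
    partialTrace (pureState (localVector U x)) =
      U.1 * partialTrace (pureState x) * star U.1 := by
  simp only [partialTrace_pureState, coeffMatrix_localVector, Matrix.conjTranspose_mul,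
    Matrix.star_eq_conjTranspose, Matrix.mul_assoc]

theorem star_mul_self_SU {d : ℕ} (U : SU d) : star U.1 * U.1 = 1 :=
  Matrix.mem_unitaryGroup_iff'.1 (Matrix.specialUnitaryGroup_le_unitaryGroup U.2)

theorem mul_star_self_SU {d : ℕ} (U : SU d) : U.1 * star U.1 = 1 :=
  Matrix.mem_unitaryGroup_iff.1 (Matrix.specialUnitaryGroup_le_unitaryGroup U.2)

theorem norm_localVector {d k : ℕ} (U : SU d) (x : EuclideanSpace ℂ (Fin d × Fin k)) :
    ‖localVector U x‖ = ‖x‖ := by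
  rw [← sq_eq_sq₀ (norm_nonneg _) (norm_nonneg _), ← Complex.ofReal_inj, norm_sq_eq_trace,
    norm_sq_eq_trace, partialTrace_localVector, Matrix.trace_mul_cycle, star_mul_self_SU, one_mul]

/-- The real linear isometry `U ⊗ 1`. -/
def localIsometry {d k : ℕ} (U : SU d) :
    EuclideanSpace ℂ (Fin d × Fin k) ≃ₗᵢ[ℝ] EuclideanSpace ℂ (Fin d × Fin k) :=
  LinearIsometry.toLinearIsometryEquiv
    { toFun := localVector U
      map_add' := fun x y => by
        ext q
        simp [localVector, mul_add, Finset.sum_add_distrib]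
      map_smul' := fun r x => by
        ext q
        simp [localVector, Finset.mul_sum, mul_left_comm]
      norm_map' := norm_localVector U } rfl

theorem measurePreserving_haarPure (k : ℕ) (U : SU 2) :
    MeasurePreserving (sphereMap (localIsometry U)) (haarPure 2 (k + 1)) (haarPure 2 (k + 1)) :=
  (measurePreserving_sphereMap (localIsometry U)).smul_measure _

theorem continuous_partialTrace_pureState {d k : ℕ} :
    Continuous fun x : EuclideanSpace ℂ (Fin d × Fin k) => partialTrace (pureState x) := by
  refine continuous_matrix fun i j => ?_
  simp only [partialTrace, pureState, Matrix.of_apply]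
  fun_prop

theorem continuous_reducedState {d k : ℕ} :
    Continuous fun x : Metric.sphere (0 : EuclideanSpace ℂ (Fin d × Fin k)) 1 =>
      partialTrace (pureState x.1) :=
  continuous_partialTrace_pureState.comp continuous_subtype_val

instance isProbabilityMeasure_stateEnsemble (k : ℕ) :
    IsProbabilityMeasure (stateEnsemble 2 (k + 1)) :=
  Measure.isProbabilityMeasure_map continuous_reducedState.measurable.aemeasurable

theorem continuous_conj_SU {d : ℕ} (U : SU d) :
    Continuous fun ρ : Matrix (Fin d) (Fin d) ℂ => U.1 * ρ * star U.1 := by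
  fun_prop

theorem measurePreserving_conj_stateEnsemble (k : ℕ) (U : SU 2) :
    MeasurePreserving (fun ρ : Matrix (Fin 2) (Fin 2) ℂ => U.1 * ρ * star U.1)
      (stateEnsemble 2 (k + 1)) (stateEnsemble 2 (k + 1)) := by
  refine ⟨(continuous_conj_SU U).measurable, ?_⟩
  rw [stateEnsemble, Measure.map_map (continuous_conj_SU U).measurable
    continuous_reducedState.measurable]
  conv_rhs => rw [← (measurePreserving_haarPure k U).map_eq]
  rw [Measure.map_map continuous_reducedState.measurable (measurePreserving_haarPure k U).measurable]
  congr 1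
  funext x
  exact (partialTrace_localVector U x.1).symm

/-! ### The laws of the first diagonal entry -/

/-- The uniform law on the unit interval. -/
def unifLaw : Measure ℝ := volume.restrict (Ioc 0 1)

/-- The `Beta(2,2)` law on the unit interval. -/
def betaLaw : Measure ℝ := unifLaw.withDensity fun x => ENNReal.ofReal (6 * x * (1 - x))

instance isProbabilityMeasure_unifLaw : IsProbabilityMeasure unifLaw := ⟨by simp [unifLaw]⟩

theorem integral_unifLaw (f : ℝ → ℝ) : ∫ x, f x ∂unifLaw = ∫ x in (0 : ℝ)..1, f x := by
  rw [unifLaw, intervalIntegral.integral_of_le zero_le_one]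

theorem integral_withDensity_unifLaw {g : ℝ → ℝ} (hg : Continuous g)
    (h0 : ∀ x ∈ Ioc (0 : ℝ) 1, 0 ≤ g x) (f : ℝ → ℝ) :
    ∫ x, f x ∂(unifLaw.withDensity fun x => ENNReal.ofReal (g x)) =
      ∫ x in (0 : ℝ)..1, g x * f x := by
  simp only [ENNReal.ofReal]
  rw [integral_withDensity_eq_integral_smul (by fun_prop),
    intervalIntegral.integral_of_le zero_le_one, unifLaw]
  refine setIntegral_congr_fun measurableSet_Ioc fun x hx => ?_
  simp only [NNReal.smul_def, Real.coe_toNNReal _ (h0 x hx), smul_eq_mul]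

theorem isFiniteMeasure_withDensity_unifLaw {g : ℝ → ℝ} (hg : Continuous g) :
    IsFiniteMeasure (unifLaw.withDensity fun x => ENNReal.ofReal (g x)) :=
  isFiniteMeasure_withDensity_ofReal
    ((hg.integrableOn_Icc.mono_set Ioc_subset_Icc_self).hasFiniteIntegral)

theorem integral_betaLaw (f : ℝ → ℝ) :
    ∫ x, f x ∂betaLaw = ∫ x in (0 : ℝ)..1, 6 * x * (1 - x) * f x :=
  integral_withDensity_unifLaw (by fun_prop)
    (fun x hx => mul_nonneg (by linarith [hx.1]) (by linarith [hx.2])) f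

instance isFiniteMeasure_betaLaw : IsFiniteMeasure betaLaw :=
  isFiniteMeasure_withDensity_unifLaw (by fun_prop)

theorem ae_unifLaw_mem : ∀ᵐ x ∂unifLaw, x ∈ Ioc (0 : ℝ) 1 := ae_restrict_mem measurableSet_Ioc

theorem ae_betaLaw_mem : ∀ᵐ x ∂betaLaw, x ∈ Ioc (0 : ℝ) 1 :=
  (withDensity_absolutelyContinuous _ _).ae_le ae_unifLaw_mem

theorem ae_of_continuous_map {α : Type*} [MeasurableSpace α] {μ : Measure α} {f : α → ℝ}
    (hf : Measurable f) (h : ∀ x, f x ∈ Icc (0 : ℝ) 1) :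
    ∀ᵐ x ∂(μ.map f), x ∈ Icc (0 : ℝ) 1 :=
  (ae_map_iff hf.aemeasurable measurableSet_Icc).2 (Filter.Eventually.of_forall h)

theorem blockWeight_sphere_mem {k : ℕ}
    (x : Metric.sphere (0 : EuclideanSpace ℂ (Fin 2 × Fin k)) 1) :
    blockWeight x.1 ∈ Icc (0 : ℝ) 1 := by
  refine ⟨blockWeight_nonneg _, (blockWeight_le _).trans ?_⟩
  rw [mem_sphere_zero_iff_norm.1 x.2, one_pow]

/-- Average `|(U x)₀|^(2n)` over both `U` and a random unit vector `x` of `ℂ²`. For fixed `U` the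
average over `x` is a known sphere moment; for fixed `x` the average over `U` is the integral
sought. Fubini equates them, without a parametrization of `SU(2)`. -/
theorem integral_norm_SU_pow (n : ℕ) :
    ∫ U : SU 2, (‖U.1 0 0‖ ^ 2) ^ n ∂haarSU 2 = 1 / (n + 1) := by
  set P := haarPure 2 (0 + 1)
  have hcont : Continuous fun z : SU 2 × Metric.sphere (0 : EuclideanSpace ℂ (Fin 2 × Fin 1)) 1 =>
      ‖z.1.1 0 0 * z.2.1 (0, 0) + z.1.1 0 1 * z.2.1 (1, 0)‖ ^ 2 := by
    have h1 := (continuous_SU_apply (d := 2) 0 0).comp (continuous_fst (X := SU 2)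
      (Y := Metric.sphere (0 : EuclideanSpace ℂ (Fin 2 × Fin 1)) 1))
    have h2 := (continuous_SU_apply (d := 2) 0 1).comp (continuous_fst (X := SU 2)
      (Y := Metric.sphere (0 : EuclideanSpace ℂ (Fin 2 × Fin 1)) 1))
    have h3 : ∀ q, Continuous fun z : SU 2 ×
        Metric.sphere (0 : EuclideanSpace ℂ (Fin 2 × Fin 1)) 1 => z.2.1 q := fun q =>
      (EuclideanSpace.proj (𝕜 := ℂ) q).continuous.comp
        (continuous_subtype_val.comp continuous_snd)
    exact ((h1.mul (h3 _)).add (h2.mul (h3 _))).norm.pow 2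
  have hw : ∀ (U : SU 2) (x : Metric.sphere (0 : EuclideanSpace ℂ (Fin 2 × Fin 1)) 1),
      ‖U.1 0 0 * x.1 (0, 0) + U.1 0 1 * x.1 (1, 0)‖ ^ 2 =
        blockWeight (sphereMap (localIsometry U) x).1 := fun U x => by
    change _ = blockWeight (localVector U x.1)
    simp [blockWeight, localVector, Fin.sum_univ_two]
  have hint : Integrable (fun z : SU 2 × Metric.sphere (0 : EuclideanSpace ℂ (Fin 2 × Fin 1)) 1 =>
      (‖z.1.1 0 0 * z.2.1 (0, 0) + z.1.1 0 1 * z.2.1 (1, 0)‖ ^ 2) ^ n) ((haarSU 2).prod P) := by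
    refine Integrable.of_bound (hcont.pow n).aestronglyMeasurable 1
      (Filter.Eventually.of_forall fun z => ?_)
    rw [hw, Real.norm_of_nonneg (pow_nonneg (blockWeight_nonneg _) _)]
    exact pow_le_one₀ (blockWeight_nonneg _) (blockWeight_sphere_mem _).2
  have hswap := integral_integral_swap (f := fun (U : SU 2)
    (x : Metric.sphere (0 : EuclideanSpace ℂ (Fin 2 × Fin 1)) 1) =>
      (‖U.1 0 0 * x.1 (0, 0) + U.1 0 1 * x.1 (1, 0)‖ ^ 2) ^ n) hint
  have hL : ∀ U : SU 2, ∫ x, (‖U.1 0 0 * x.1 (0, 0) + U.1 0 1 * x.1 (1, 0)‖ ^ 2) ^ n ∂P =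
      1 / (n + 1) := fun U => by
    simp only [hw]
    rw [← integral_map (measurePreserving_haarPure 0 U).measurable.aemeasurable
      (f := fun x => blockWeight x.1 ^ n) (Continuous.aestronglyMeasurable
        ((continuous_blockWeight.comp continuous_subtype_val).pow n)),
      (measurePreserving_haarPure 0 U).map_eq, integral_blockWeight_pow]
    simp only [zero_add, mul_zero, Nat.factorial_zero, add_comm 1 n,
      Nat.factorial_succ]
    have : (n.factorial : ℝ) ≠ 0 := by positivity
    have : (n : ℝ) + 1 ≠ 0 := by positivity
    push_cast
    field_simp
  have hR : ∀ x : Metric.sphere (0 : EuclideanSpace ℂ (Fin 2 × Fin 1)) 1,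
      ∫ U : SU 2, (‖U.1 0 0 * x.1 (0, 0) + U.1 0 1 * x.1 (1, 0)‖ ^ 2) ^ n ∂haarSU 2 =
        ∫ U : SU 2, (‖U.1 0 0‖ ^ 2) ^ n ∂haarSU 2 := fun x => by
    refine integral_haarSU_column (v := fun i => x.1 (i, 0)) ?_ (fun t => t ^ n)
    have := EuclideanSpace.norm_sq_eq x.1
    rw [mem_sphere_zero_iff_norm.1 x.2, Fintype.sum_prod_type] at this
    simpa using this.symm
  simp only [hL, hR, integral_const, probReal_univ, one_smul] at hswap
  exact hswap.symm

theorem map_norm_SU : (haarSU 2).map (fun U : SU 2 => ‖U.1 0 0‖ ^ 2) = unifLaw := by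
  have hc : Continuous fun U : SU 2 => ‖U.1 0 0‖ ^ 2 := (continuous_SU_apply 0 0).norm.pow 2
  have : IsFiniteMeasure ((haarSU 2).map (fun U : SU 2 => ‖U.1 0 0‖ ^ 2)) :=
    Measure.isFiniteMeasure_map _ _
  refine ext_of_moments (ae_of_continuous_map hc.measurable fun U => ⟨by positivity, ?_⟩)
    (ae_unifLaw_mem.mono fun x hx => Ioc_subset_Icc_self hx) fun n => ?_
  · exact pow_le_one₀ (norm_nonneg _)
      (entry_norm_bound_of_unitary (Matrix.specialUnitaryGroup_le_unitaryGroup U.2) 0 0)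
  · rw [integral_map hc.measurable.aemeasurable (by fun_prop), integral_norm_SU_pow,
      integral_unifLaw, integral_pow]
    simp

theorem integral_haarSU_norm {f : ℝ → ℝ} (hf : AEStronglyMeasurable f unifLaw) :
    ∫ U : SU 2, f (‖U.1 0 0‖ ^ 2) ∂haarSU 2 = ∫ t in (0 : ℝ)..1, f t := by
  have hc : Continuous fun U : SU 2 => ‖U.1 0 0‖ ^ 2 := (continuous_SU_apply 0 0).norm.pow 2
  rw [← integral_unifLaw, ← map_norm_SU, integral_map hc.measurable.aemeasurable]
  rwa [map_norm_SU]

/-- The first diagonal entry of a qubit state. -/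
def entry (ρ : Matrix (Fin 2) (Fin 2) ℂ) : ℝ := (ρ 0 0).re

theorem continuous_entry : Continuous entry :=
  Complex.continuous_re.comp (continuous_id.matrix_elem 0 0)

theorem entry_reducedState {k : ℕ} (x : EuclideanSpace ℂ (Fin 2 × Fin k)) :
    entry (partialTrace (pureState x)) = blockWeight x := by
  simp only [entry, partialTrace, pureState, Matrix.of_apply, blockWeight, Complex.re_sum]
  refine Finset.sum_congr rfl fun a _ => ?_
  rw [Complex.star_def, Complex.mul_conj, Complex.ofReal_re, Complex.normSq_eq_norm_sq]

/-- The first diagonal entry of a state of the ensemble `𝓔_{2,2}` has the `Beta(2,2)` law. -/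
theorem map_entry_stateEnsemble : (stateEnsemble 2 2).map entry = betaLaw := by
  have hc : Continuous fun x : Metric.sphere (0 : EuclideanSpace ℂ (Fin 2 × Fin 2)) 1 =>
    blockWeight x.1 := continuous_blockWeight.comp continuous_subtype_val
  have e : (stateEnsemble 2 2).map entry = (haarPure 2 2).map fun x => blockWeight x.1 := by
    rw [stateEnsemble, Measure.map_map continuous_entry.measurable
      continuous_reducedState.measurable]
    congr 1
    funext x
    exact entry_reducedState x.1
  have : IsFiniteMeasure (haarPure 2 2) :=
    inferInstanceAs (IsFiniteMeasure (haarPure 2 (1 + 1)))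
  rw [e]
  refine ext_of_moments (ae_of_continuous_map hc.measurable blockWeight_sphere_mem)
    (ae_betaLaw_mem.mono fun x hx => Ioc_subset_Icc_self hx) fun n => ?_
  rw [integral_map hc.measurable.aemeasurable (by fun_prop), integral_blockWeight_pow 1 n,
    integral_betaLaw]
  have h1 : ∀ x : ℝ, 6 * x * (1 - x) * x ^ n = 6 * x ^ (n + 1) - 6 * x ^ (n + 2) := fun x => by ring
  simp only [h1]
  rw [intervalIntegral.integral_sub (Continuous.intervalIntegrable (by fun_prop) _ _)
    (Continuous.intervalIntegrable (by fun_prop) _ _), intervalIntegral.integral_const_mul,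
    intervalIntegral.integral_const_mul, integral_pow, integral_pow]
  rw [show 2 * 1 + 1 + n = (((n + 1) + 1) + 1) by ring, show 1 + n = n + 1 by ring,
    Nat.factorial_succ (n + 1 + 1), Nat.factorial_succ (n + 1)]
  have : ((n + 1).factorial : ℝ) ≠ 0 := by positivity
  have : (n : ℝ) + 1 + 1 ≠ 0 := by positivity
  have : (n : ℝ) + 1 + 1 + 1 ≠ 0 := by positivity
  have : (n : ℝ) + 2 + 1 ≠ 0 := by positivity
  norm_num [Nat.factorial]
  field_simp
  ring

open scoped ComplexOrder

/-! ### Entropy of qubit states -/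

/-- Density matrices. -/
structure IsDensity {d : ℕ} (ρ : Matrix (Fin d) (Fin d) ℂ) : Prop where
  posSemidef : ρ.PosSemidef
  trace_eq : ρ.trace = 1

theorem isClosed_setOf_isDensity {d : ℕ} :
    IsClosed {ρ : Matrix (Fin d) (Fin d) ℂ | IsDensity ρ} := by
  have e : {ρ : Matrix (Fin d) (Fin d) ℂ | IsDensity ρ} =
      ({ρ | ρ.IsHermitian} ∩ ⋂ x : Fin d → ℂ, {ρ | 0 ≤ star x ⬝ᵥ (ρ.mulVec x)}) ∩
        {ρ | ρ.trace = 1} := by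
    ext ρ
    simp only [mem_ofPred_eq, mem_inter_iff, mem_iInter]
    rw [← Matrix.posSemidef_iff_dotProduct_mulVec]
    exact ⟨fun h => ⟨h.1, h.2⟩, fun h => ⟨h.1, h.2⟩⟩
  rw [e]
  refine ((isClosed_eq continuous_id.matrix_conjTranspose continuous_id).inter
    (isClosed_iInter fun x => isClosed_le continuous_const ?_)).inter
    (isClosed_eq continuous_id.matrix_trace continuous_const)
  exact continuous_const.dotProduct (continuous_id.matrix_mulVec continuous_const)

theorem vonNeumannEntropy_eq_sum {d : ℕ} {ρ : Matrix (Fin d) (Fin d) ℂ} (h : ρ.IsHermitian) :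
    vonNeumannEntropy ρ = -∑ i, h.eigenvalues i * Real.logb 2 (h.eigenvalues i) := by
  rw [vonNeumannEntropy, h.cfc_eq, Matrix.IsHermitian.cfc, Unitary.conjStarAlgAut_apply,
    Matrix.trace_mul_cycle, Unitary.coe_star_mul_self, one_mul, Matrix.trace_diagonal]
  simp

theorem sum_eigenvalues_eq_one {ρ : Matrix (Fin 2) (Fin 2) ℂ} (h : ρ.IsHermitian)
    (ht : ρ.trace = 1) : h.eigenvalues 0 + h.eigenvalues 1 = 1 := by
  have := h.trace_eq_sum_eigenvalues
  rw [ht, Fin.sum_univ_two] at this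
  simpa using (congrArg Complex.re this).symm

theorem vonNeumannEntropy_eq_H₂ {ρ : Matrix (Fin 2) (Fin 2) ℂ} (h : ρ.IsHermitian)
    (ht : ρ.trace = 1) : vonNeumannEntropy ρ = H₂ (h.eigenvalues 0) := by
  have h1 : h.eigenvalues 1 = 1 - h.eigenvalues 0 := by
    linarith [sum_eigenvalues_eq_one h ht]
  rw [vonNeumannEntropy_eq_sum h, Fin.sum_univ_two, h1, H₂]
  ring

/-- Trace and determinant determine the eigenvalues of the diagonal part up to order, and `H₂` is
symmetric, so the order is irrelevant. -/
theorem vonNeumannEntropy_diagPart {ρ : Matrix (Fin 2) (Fin 2) ℂ} (h : ρ.IsHermitian)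
    (ht : ρ.trace = 1) : vonNeumannEntropy (diagPart ρ) = H₂ (entry ρ) := by
  have hd : (diagPart ρ).IsHermitian := by
    refine Matrix.isHermitian_diagonal_of_self_adjoint _ ?_
    funext i
    exact h.apply i i
  have e0 : ((entry ρ : ℝ) : ℂ) = ρ 0 0 := Complex.conj_eq_iff_re.1 (h.apply 0 0)
  have e1 : ρ 1 1 = 1 - entry ρ := by
    rw [Matrix.trace_fin_two] at ht
    rw [e0]
    linear_combination ht
  have htr : (diagPart ρ).trace = 1 := by
    rw [← ht, diagPart, Matrix.trace_diagonal]
    rfl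
  have hdet : (Matrix.diagonal ρ.diag).det = _ := hd.det_eq_prod_eigenvalues
  rw [Fin.prod_univ_two, Matrix.det_diagonal, Fin.prod_univ_two] at hdet
  simp only [Matrix.diag_apply, e1] at hdet
  rw [← e0] at hdet
  have hdet' : entry ρ * (1 - entry ρ) = hd.eigenvalues 0 * hd.eigenvalues 1 := by
    simpa using congrArg Complex.re hdet
  have hs := sum_eigenvalues_eq_one hd htr
  rw [vonNeumannEntropy_eq_H₂ hd htr]
  have h2 : (hd.eigenvalues 0 - entry ρ) * (hd.eigenvalues 0 - (1 - entry ρ)) = 0 := by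
    have : hd.eigenvalues 1 = 1 - hd.eigenvalues 0 := by linarith
    rw [this] at hdet'
    linear_combination hdet'
  rcases mul_eq_zero.1 h2 with h3 | h3
  · rw [sub_eq_zero.1 h3]
  · rw [sub_eq_zero.1 h3, H₂_one_sub]

theorem measurable_isoEntropy : Measurable isoEntropy := by
  unfold isoEntropy
  fun_prop

/-- The primitive `(x - 1/2) H₂(x)` is odd about `1 / 2`, so its increment over `[1 - l, l]` is `(2
l - 1) H₂ l`. -/
theorem integral_isoEntropy_of_half_lt {l : ℝ} (h : 1 / 2 < l) (h1 : l ≤ 1) :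
    ∫ t in (0 : ℝ)..1, isoEntropy ((1 - l) + (2 * l - 1) * t) = H₂ l := by
  have hF := isPrimitiveChain_isoKernelChain.integral_unif (c := 0) (w := 2 * l - 1) (s := 1 - l)
    le_rfl (by linarith) (by linarith) (by linarith)
  simp only [zero_add] at hF
  refine hF.trans ?_
  change (momentEntropy (1 - l + 0 + (2 * l - 1)) - momentEntropy (1 - l + 0)) / (2 * l - 1) = H₂ l
  rw [show 1 - l + 0 + (2 * l - 1) = l by ring, add_zero]
  simp only [momentEntropy, H₂_one_sub]
  have : 2 * l - 1 ≠ 0 := by linarith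
  rw [div_eq_iff this]
  ring

/-- Averaging `isoEntropy` over the diagonal entries of an orbit gives the entropy. -/
theorem integral_isoEntropy {l : ℝ} (h0 : 0 ≤ l) (h1 : l ≤ 1) :
    ∫ t in (0 : ℝ)..1, isoEntropy ((1 - l) + (2 * l - 1) * t) = H₂ l := by
  rcases lt_trichotomy l (1 / 2) with h | h | h
  · rw [← H₂_one_sub, ← integral_isoEntropy_of_half_lt (l := 1 - l) (by linarith) (by linarith)]
    refine intervalIntegral.integral_congr fun t _ => ?_
    rw [← isoEntropy_one_sub]
    congr 1
    ring
  -- At `l = 1 / 2` the interval degenerates to a point, and both sides equal `1`.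
  · subst h
    have h2 : Real.log 2 ≠ 0 := (Real.log_pos (by norm_num)).ne'
    norm_num [isoEntropy, H₂, Real.logb]
    field_simp
    ring
  · exact integral_isoEntropy_of_half_lt h h1

/-- In an eigenbasis the entry of `U ρ U†` is affine in the squared modulus of the entry of `U`
along an eigenvector, and that squared modulus is uniform on `[0, 1]`. -/
theorem integral_isoEntropy_conj {ρ : Matrix (Fin 2) (Fin 2) ℂ} (hρ : IsDensity ρ) :
    ∫ U : SU 2, isoEntropy (entry (U.1 * ρ * star U.1)) ∂haarSU 2 = vonNeumannEntropy ρ := by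
  have h := hρ.posSemidef.isHermitian
  have hs := sum_eigenvalues_eq_one h hρ.trace_eq
  have hl0 := hρ.posSemidef.eigenvalues_nonneg 0
  have hl1 := hρ.posSemidef.eigenvalues_nonneg 1
  set l := h.eigenvalues 0 with hl
  have hl' : h.eigenvalues 1 = 1 - l := by linarith
  set V : Matrix (Fin 2) (Fin 2) ℂ := (h.eigenvectorUnitary : Matrix (Fin 2) (Fin 2) ℂ) with hV
  have hVu : V ∈ Matrix.unitaryGroup (Fin 2) ℂ := h.eigenvectorUnitary.2
  have hsp : ρ = V * Matrix.diagonal (fun i => (h.eigenvalues i : ℂ)) * star V := by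
    conv_lhs => rw [h.spectral_theorem, Unitary.conjStarAlgAut_apply]
    rfl
  have hcol : ‖V 0 0‖ ^ 2 + ‖V 1 0‖ ^ 2 = 1 := by
    have := congrFun (congrFun (Matrix.mem_unitaryGroup_iff'.1 hVu) 0) 0
    simp only [Matrix.mul_apply, Fin.sum_univ_two, Matrix.star_apply, Complex.star_def,
      Complex.conj_mul', Matrix.one_apply_eq] at this
    exact_mod_cast this
  have hentry : ∀ U : SU 2, entry (U.1 * ρ * star U.1) =
      (1 - l) + (2 * l - 1) * ‖U.1 0 0 * V 0 0 + U.1 0 1 * V 1 0‖ ^ 2 := fun U => by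
    set W : Matrix (Fin 2) (Fin 2) ℂ := U.1 * V with hW
    have hWu : W ∈ Matrix.unitaryGroup (Fin 2) ℂ :=
      mul_mem (Matrix.specialUnitaryGroup_le_unitaryGroup U.2) hVu
    have hrow : ‖W 0 0‖ ^ 2 + ‖W 0 1‖ ^ 2 = 1 := by
      have := congrFun (congrFun (Matrix.mem_unitaryGroup_iff.1 hWu) 0) 0
      simp only [Matrix.mul_apply, Fin.sum_univ_two, Matrix.star_apply, Complex.star_def,
        Complex.mul_conj', Matrix.one_apply_eq] at this
      exact_mod_cast this
    have e1 : U.1 * ρ * star U.1 =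
        W * Matrix.diagonal (fun i => (h.eigenvalues i : ℂ)) * star W := by
      conv_lhs => rw [hsp]
      rw [hW, star_mul]
      simp only [Matrix.mul_assoc]
    have e2 : entry (U.1 * ρ * star U.1) = l * ‖W 0 0‖ ^ 2 + (1 - l) * ‖W 0 1‖ ^ 2 := by
      have : (U.1 * ρ * star U.1) 0 0 = ((l * ‖W 0 0‖ ^ 2 + (1 - l) * ‖W 0 1‖ ^ 2 : ℝ) : ℂ) := by
        rw [e1, Matrix.mul_apply, Fin.sum_univ_two]
        simp only [Matrix.mul_diagonal, Matrix.star_apply, Complex.star_def, hl', ← hl]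
        push_cast
        rw [← Complex.mul_conj', ← Complex.mul_conj']
        ring
      rw [entry, this, Complex.ofReal_re]
    rw [e2, show ‖W 0 1‖ ^ 2 = 1 - ‖W 0 0‖ ^ 2 by linarith, hW, Matrix.mul_apply, Fin.sum_univ_two]
    ring
  simp only [hentry]
  -- The eigenvector matrix need not have determinant `1`; only its first column matters, and that
  -- column extends to an element of `SU(2)`.
  rw [integral_haarSU_column (v := fun i => V i 0) hcol
    (fun t => isoEntropy ((1 - l) + (2 * l - 1) * t)),
    integral_haarSU_norm (f := fun t => isoEntropy ((1 - l) + (2 * l - 1) * t))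
      (measurable_isoEntropy.comp (by fun_prop)).aestronglyMeasurable,
    integral_isoEntropy hl0 (by linarith), vonNeumannEntropy_eq_H₂ h hρ.trace_eq]

/-! ### Averages over unitarily invariant laws -/

/-- Invariance of a law of states under unitary conjugation. -/
def IsConjInvariant (ν : Measure (Matrix (Fin 2) (Fin 2) ℂ)) : Prop :=
  ∀ U : SU 2, MeasurePreserving (fun ρ : Matrix (Fin 2) (Fin 2) ℂ => U.1 * ρ * star U.1) ν ν

theorem continuous_conj_uncurry : Continuous fun z : SU 2 × Matrix (Fin 2) (Fin 2) ℂ =>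
    z.1.1 * z.2 * star z.1.1 := by
  have h1 : Continuous fun z : SU 2 × Matrix (Fin 2) (Fin 2) ℂ => z.1.1 :=
    continuous_subtype_val.comp continuous_fst
  exact (h1.mul continuous_snd).mul h1.star

/-- Fubini for `isoEntropy` at the entry of `U ρ U†`: integrating over `U` first gives `S(ρ)`,
integrating over `ρ` first removes `U` by invariance. Integrability of `S` comes from its being
almost everywhere equal to a partial integral, so the functional calculus needs no separate
measurability argument. -/
theorem integral_vonNeumannEntropy {ν : Measure (Matrix (Fin 2) (Fin 2) ℂ)} [IsFiniteMeasure ν]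
    (hν : IsConjInvariant ν) (hd : ∀ᵐ ρ ∂ν, IsDensity ρ)
    (hi : Integrable (fun ρ => isoEntropy (entry ρ)) ν) :
    Integrable vonNeumannEntropy ν ∧
      ∫ ρ, vonNeumannEntropy ρ ∂ν = ∫ ρ, isoEntropy (entry ρ) ∂ν := by
  have hmeas : Measurable fun ρ : Matrix (Fin 2) (Fin 2) ℂ => isoEntropy (entry ρ) :=
    measurable_isoEntropy.comp continuous_entry.measurable
  have hU : ∀ (U : SU 2) {g : Matrix (Fin 2) (Fin 2) ℂ → ℝ}, AEStronglyMeasurable g ν →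
      ∫ ρ, g (U.1 * ρ * star U.1) ∂ν = ∫ ρ, g ρ ∂ν := fun U g hg => by
    conv_rhs => rw [← (hν U).map_eq]
    rw [integral_map (hν U).measurable.aemeasurable (by rwa [(hν U).map_eq])]
  have hint : Integrable (fun z : SU 2 × Matrix (Fin 2) (Fin 2) ℂ =>
      isoEntropy (entry (z.1.1 * z.2 * star z.1.1))) ((haarSU 2).prod ν) := by
    have hm : Measurable fun z : SU 2 × Matrix (Fin 2) (Fin 2) ℂ =>
        isoEntropy (entry (z.1.1 * z.2 * star z.1.1)) :=
      hmeas.comp continuous_conj_uncurry.measurable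
    rw [integrable_prod_iff hm.aestronglyMeasurable]
    refine ⟨Filter.Eventually.of_forall fun U => (hν U).integrable_comp_of_integrable hi, ?_⟩
    have : (fun U : SU 2 => ∫ ρ, ‖isoEntropy (entry (U.1 * ρ * star U.1))‖ ∂ν) =
        fun _ => ∫ ρ, ‖isoEntropy (entry ρ)‖ ∂ν := by
      funext U
      exact hU U (g := fun ρ => ‖isoEntropy (entry ρ)‖) hmeas.norm.aestronglyMeasurable
    simp only [this]
    exact integrable_const _
  have hae : (fun ρ => ∫ U : SU 2, isoEntropy (entry (U.1 * ρ * star U.1)) ∂haarSU 2) =ᵐ[ν]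
      vonNeumannEntropy := hd.mono fun ρ hρ => integral_isoEntropy_conj hρ
  refine ⟨(integrable_congr hae).1 hint.integral_prod_right, ?_⟩
  rw [← integral_congr_ae hae, ← integral_integral_swap hint]
  simp only [hU _ hmeas.aestronglyMeasurable, integral_const, probReal_univ, one_smul]

theorem continuous_mixture {d n : ℕ} : Continuous (mixture (d := d) (n := n)) := by
  unfold mixture
  fun_prop

theorem mixture_conj {n : ℕ} (U : SU 2) (ρ : Fin n → Matrix (Fin 2) (Fin 2) ℂ) :
    mixture (fun j => U.1 * ρ j * star U.1) = U.1 * mixture ρ * star U.1 := by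
  simp only [mixture, Matrix.mul_smul, Matrix.smul_mul, Finset.mul_sum, Finset.sum_mul]

theorem isConjInvariant_mixture {n : ℕ} {μ : Fin n → Measure (Matrix (Fin 2) (Fin 2) ℂ)}
    [∀ j, IsProbabilityMeasure (μ j)] (h : ∀ j, IsConjInvariant (μ j)) :
    IsConjInvariant ((Measure.pi μ).map mixture) := fun U => by
  refine ⟨(continuous_conj_SU U).measurable, ?_⟩
  have hp := measurePreserving_pi μ μ (fun j => h j U)
  rw [Measure.map_map (continuous_conj_SU U).measurable continuous_mixture.measurable]
  conv_rhs => rw [← hp.map_eq]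
  rw [Measure.map_map continuous_mixture.measurable hp.measurable]
  congr 1
  funext ρ
  exact (mixture_conj U ρ).symm

theorem IsDensity.mixture {d n : ℕ} {ρ : Fin (n + 1) → Matrix (Fin d) (Fin d) ℂ}
    (h : ∀ j, IsDensity (ρ j)) : IsDensity (mixture ρ) := by
  have hn : ((n + 1 : ℕ) : ℂ) ≠ 0 := Nat.cast_ne_zero.2 (Nat.succ_ne_zero n)
  refine ⟨(Matrix.posSemidef_sum _ fun j _ => (h j).posSemidef).smul ?_, ?_⟩
  · have : ((n + 1 : ℕ) : ℂ)⁻¹ = (((n + 1 : ℕ) : ℝ)⁻¹ : ℝ) := by push_cast; rfl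
    rw [this]
    exact Complex.zero_le_real.2 (by positivity)
  · rw [QubitMixture.mixture, Matrix.trace_smul, Matrix.trace_sum]
    simp only [(h _).trace_eq, Finset.sum_const, Finset.card_univ, Fintype.card_fin, nsmul_eq_mul,
      mul_one, smul_eq_mul]
    exact inv_mul_cancel₀ hn

theorem entry_mixture {n : ℕ} (ρ : Fin n → Matrix (Fin 2) (Fin 2) ℂ) :
    entry (mixture ρ) = (n : ℝ)⁻¹ * ∑ j, entry (ρ j) := by
  have : ((n : ℂ))⁻¹ = (((n : ℝ)⁻¹ : ℝ) : ℂ) := by push_cast; rfl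
  simp only [entry, mixture, Matrix.smul_apply, Matrix.sum_apply, smul_eq_mul]
  rw [this, Complex.re_ofReal_mul, Complex.re_sum]

theorem mixture_diagPart {d n : ℕ} (ρ : Fin n → Matrix (Fin d) (Fin d) ℂ) :
    mixture (fun j => diagPart (ρ j)) = diagPart (mixture ρ) := by
  ext i k
  by_cases h : i = k <;> simp [mixture, diagPart, Matrix.sum_apply, h]

section Averages

variable {n : ℕ} {μ : Fin (n + 1) → Measure (Matrix (Fin 2) (Fin 2) ℂ)}
  [∀ j, IsProbabilityMeasure (μ j)]

theorem ae_isDensity_pi (hd : ∀ j, ∀ᵐ ρ ∂μ j, IsDensity ρ) :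
    ∀ᵐ ρ ∂Measure.pi μ, ∀ j, IsDensity (ρ j) :=
  ae_all_iff.2 fun j => (Measure.quasiMeasurePreserving_eval μ j).ae (hd j)

theorem map_entry_pi : (Measure.pi μ).map (fun ρ j => entry (ρ j)) =
    Measure.pi fun j => (μ j).map entry := by
  have : ∀ j, IsProbabilityMeasure ((μ j).map entry) := fun j =>
    Measure.isProbabilityMeasure_map continuous_entry.measurable.aemeasurable
  exact Measure.pi_map_pi fun j => continuous_entry.measurable.aemeasurable

theorem measurable_entry_pi :
    Measurable fun (ρ : Fin (n + 1) → Matrix (Fin 2) (Fin 2) ℂ) j => entry (ρ j) :=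
  measurable_pi_lambda _ fun j => continuous_entry.measurable.comp (measurable_pi_apply j)

/-- The law of the mixture is again invariant and carried by density matrices, so entropy may be
replaced by `isoEntropy` of the entry. The entry of a mixture is the mean of the entries, so only
the laws of the entries remain. -/
theorem avgEntropy_eq (hc : ∀ j, IsConjInvariant (μ j)) (hd : ∀ j, ∀ᵐ ρ ∂μ j, IsDensity ρ)
    (hi : Integrable (fun x : Fin (n + 1) → ℝ => isoEntropy (((n + 1 : ℕ) : ℝ)⁻¹ * ∑ j, x j))
      (Measure.pi fun j => (μ j).map entry)) :
    Integrable (fun ρ => vonNeumannEntropy (mixture ρ)) (Measure.pi μ) ∧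
    avgEntropy μ = ∫ x, isoEntropy (((n + 1 : ℕ) : ℝ)⁻¹ * ∑ j, x j)
      ∂(Measure.pi fun j => (μ j).map entry) := by
  have hm : Measurable (mixture (d := 2) (n := n + 1)) := continuous_mixture.measurable
  have hmeas : Measurable fun ρ : Matrix (Fin 2) (Fin 2) ℂ => isoEntropy (entry ρ) :=
    measurable_isoEntropy.comp continuous_entry.measurable
  have hmeas' : Measurable fun x : Fin (n + 1) → ℝ =>
      isoEntropy (((n + 1 : ℕ) : ℝ)⁻¹ * ∑ j, x j) :=
    measurable_isoEntropy.comp (by fun_prop)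
  rw [← map_entry_pi, integrable_map_measure hmeas'.aestronglyMeasurable
    measurable_entry_pi.aemeasurable] at hi
  have hi' : Integrable (fun ρ => isoEntropy (entry ρ)) ((Measure.pi μ).map mixture) := by
    rw [integrable_map_measure hmeas.aestronglyMeasurable hm.aemeasurable]
    refine hi.congr (Filter.Eventually.of_forall fun ρ => ?_)
    simp only [Function.comp_apply, entry_mixture]
  have hd' : ∀ᵐ ρ ∂(Measure.pi μ).map mixture, IsDensity ρ := by
    rw [ae_map_iff hm.aemeasurable isClosed_setOf_isDensity.measurableSet]
    exact (ae_isDensity_pi hd).mono fun ρ hρ => IsDensity.mixture hρ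
  have : IsProbabilityMeasure ((Measure.pi μ).map mixture) :=
    Measure.isProbabilityMeasure_map hm.aemeasurable
  obtain ⟨hS, hE⟩ := integral_vonNeumannEntropy (isConjInvariant_mixture hc) hd' hi'
  refine ⟨hS.comp_measurable hm, ?_⟩
  rw [avgEntropy, ← integral_map hm.aemeasurable hS.aestronglyMeasurable, hE,
    integral_map hm.aemeasurable hmeas.aestronglyMeasurable, ← map_entry_pi,
    integral_map measurable_entry_pi.aemeasurable hmeas'.aestronglyMeasurable]
  simp only [entry_mixture]

theorem avgDiagEntropy_eq (hd : ∀ j, ∀ᵐ ρ ∂μ j, IsDensity ρ)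
    (hi : Integrable (fun x : Fin (n + 1) → ℝ => H₂ (((n + 1 : ℕ) : ℝ)⁻¹ * ∑ j, x j))
      (Measure.pi fun j => (μ j).map entry)) :
    Integrable (fun ρ => vonNeumannEntropy (diagPart (mixture ρ))) (Measure.pi μ) ∧
    avgDiagEntropy μ = ∫ x, H₂ (((n + 1 : ℕ) : ℝ)⁻¹ * ∑ j, x j)
      ∂(Measure.pi fun j => (μ j).map entry) := by
  have hmeas' : Measurable fun x : Fin (n + 1) → ℝ => H₂ (((n + 1 : ℕ) : ℝ)⁻¹ * ∑ j, x j) :=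
    continuous_H₂.measurable.comp (by fun_prop)
  have hae : (fun ρ => vonNeumannEntropy (diagPart (mixture ρ))) =ᵐ[Measure.pi μ]
      fun ρ => H₂ (((n + 1 : ℕ) : ℝ)⁻¹ * ∑ j, entry (ρ j)) :=
    (ae_isDensity_pi hd).mono fun ρ hρ => by
      have := IsDensity.mixture hρ
      simp only
      rw [vonNeumannEntropy_diagPart this.posSemidef.isHermitian this.trace_eq, entry_mixture]
  rw [← map_entry_pi, integrable_map_measure hmeas'.aestronglyMeasurable
    measurable_entry_pi.aemeasurable] at hi
  refine ⟨hi.congr hae.symm, ?_⟩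
  rw [avgDiagEntropy, ← map_entry_pi,
    integral_map measurable_entry_pi.aemeasurable hmeas'.aestronglyMeasurable]
  simp only [mixture_diagPart]
  exact integral_congr_ae hae

end Averages

/-! ### The two families of laws -/

theorem isDensity_partialTrace {d k : ℕ} (x : EuclideanSpace ℂ (Fin d × Fin k)) (hx : ‖x‖ = 1) :
    IsDensity (partialTrace (pureState x)) := by
  refine ⟨?_, ?_⟩
  · rw [partialTrace_pureState]
    exact Matrix.posSemidef_self_mul_conjTranspose _
  · rw [← norm_sq_eq_trace, hx]
    simp

theorem IsDensity.conj {d : ℕ} {ρ : Matrix (Fin d) (Fin d) ℂ} (h : IsDensity ρ) (U : SU d) :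
    IsDensity (U.1 * ρ * star U.1) := by
  refine ⟨?_, ?_⟩
  · rw [Matrix.star_eq_conjTranspose]
    exact h.posSemidef.mul_mul_conjTranspose_same _
  · rw [Matrix.trace_mul_cycle, star_mul_self_SU, one_mul, h.trace_eq]

theorem isDensity_diagonal {a : ℝ} (ha : a ∈ Icc (0 : ℝ) 1) :
    IsDensity (Matrix.diagonal ![((1 - a : ℝ) : ℂ), ((a : ℝ) : ℂ)]) := by
  refine ⟨?_, ?_⟩
  · rw [Matrix.posSemidef_diagonal_iff]
    intro i
    fin_cases i
    · exact Complex.zero_le_real.2 (by linarith [ha.2])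
    · exact Complex.zero_le_real.2 ha.1
  · rw [Matrix.trace_diagonal, Fin.sum_univ_two]
    simp

/-! ### Iterated integrals over finite products -/

theorem integral_pi_cons {n : ℕ} (m : Fin (n + 1) → Measure ℝ) [∀ j, IsProbabilityMeasure (m j)]
    {f : (Fin (n + 1) → ℝ) → ℝ} (hf : Integrable f (Measure.pi m)) :
    (∀ᵐ x ∂m 0, Integrable (fun y => f (Fin.cons x y)) (Measure.pi fun j : Fin n => m j.succ)) ∧
    ∫ x, f x ∂Measure.pi m =
      ∫ x, ∫ y, f (Fin.cons x y) ∂(Measure.pi fun j : Fin n => m j.succ) ∂m 0 := by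
  have hmp := (measurePreserving_piFinSuccAbove m 0).symm
  have hi := (hmp.integrable_comp_emb (MeasurableEquiv.measurableEmbedding _)).2 hf
  have he := hmp.integral_comp (MeasurableEquiv.measurableEmbedding _) f
  have e : ∀ z : ℝ × (Fin n → ℝ),
      (MeasurableEquiv.piFinSuccAbove (fun _ => ℝ) 0).symm z = Fin.cons z.1 z.2 := fun z => by
    simp [MeasurableEquiv.piFinSuccAbove, Fin.insertNthEquiv]
  refine ⟨?_, ?_⟩
  · have := hi.prod_right_ae
    simp only [Function.comp_def, e] at this
    exact this
  · rw [← he]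
    refine (integral_prod _ hi).trans ?_
    simp only [Function.comp_apply, e]
    rfl

theorem integral_pi_zero (m : Fin 0 → Measure ℝ) (f : (Fin 0 → ℝ) → ℝ) :
    ∫ x, f x ∂Measure.pi m = f ![] := by
  rw [Measure.pi_of_empty m ![], integral_dirac]

theorem integral_pi_two (m : Fin 2 → Measure ℝ) [∀ j, IsProbabilityMeasure (m j)]
    {f : (Fin 2 → ℝ) → ℝ} (hf : Integrable f (Measure.pi m)) :
    ∫ x, f x ∂Measure.pi m = ∫ x, ∫ y, f ![x, y] ∂m 1 ∂m 0 := by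
  obtain ⟨h1, e1⟩ := integral_pi_cons m hf
  rw [e1]
  refine integral_congr_ae (h1.mono fun x hx => ?_)
  obtain ⟨_, e2⟩ := integral_pi_cons _ hx
  simp only [e2, integral_pi_zero]
  rfl

theorem integral_pi_three (m : Fin 3 → Measure ℝ) [∀ j, IsProbabilityMeasure (m j)]
    {f : (Fin 3 → ℝ) → ℝ} (hf : Integrable f (Measure.pi m)) :
    ∫ x, f x ∂Measure.pi m = ∫ x, ∫ y, ∫ z, f ![x, y, z] ∂m 2 ∂m 1 ∂m 0 := by
  obtain ⟨h1, e1⟩ := integral_pi_cons m hf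
  rw [e1]
  refine integral_congr_ae (h1.mono fun x hx => ?_)
  simp only [integral_pi_two (fun j : Fin 2 => m j.succ) hx]
  rfl

/-! ### Integrability of the entropies of means -/

/-- One coordinate already keeps the mean away from `0` and `1`, so the logarithmic singularities of
`isoEntropy` at the mean are dominated by logarithms of that coordinate alone. -/
theorem mean_mem {n : ℕ} {x : Fin (n + 1) → ℝ}
    (hx : ∀ j, x j ∈ Icc (0 : ℝ) 1) :
    x 0 / (n + 1 : ℕ) ≤ ((n + 1 : ℕ) : ℝ)⁻¹ * ∑ j, x j ∧
      (1 - x 0) / (n + 1 : ℕ) ≤ 1 - ((n + 1 : ℕ) : ℝ)⁻¹ * ∑ j, x j := by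
  have hn : (0 : ℝ) < (n + 1 : ℕ) := by positivity
  have h1 : x 0 ≤ ∑ j, x j := Finset.single_le_sum (fun j _ => (hx j).1) (Finset.mem_univ 0)
  have h2 : 1 - x 0 ≤ ∑ j, (1 - x j) :=
    Finset.single_le_sum (f := fun j => 1 - x j) (fun j _ => by linarith [(hx j).2])
      (Finset.mem_univ 0)
  rw [Finset.sum_sub_distrib, Finset.sum_const, Finset.card_univ, Fintype.card_fin, nsmul_eq_mul,
    mul_one] at h2
  constructor
  · rw [div_eq_inv_mul]
    gcongr
  · rw [div_le_iff₀ hn, sub_mul, inv_mul_eq_div, div_mul_cancel₀ _ hn.ne', one_mul]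
    exact h2

/-- The factor `5 / 2` is `1 / 2 + 2`, the sum of the coefficients in `isoEntropy`, the weights `y`
and `1 - y` being at most `1`. -/
theorem abs_isoEntropy_le {y a b : ℝ} (ha : 0 < a) (hb : 0 < b) (hay : a ≤ y) (hby : b ≤ 1 - y) :
    |isoEntropy y| ≤ 1 / Real.log 2 * (5 / 2 * (-Real.log a - Real.log b)) := by
  have h2 : 0 < Real.log 2 := Real.log_pos (by norm_num)
  have hy : 0 < y := ha.trans_le hay
  have hy1 : 0 < 1 - y := hb.trans_le hby
  have l1 := Real.log_le_log ha hay
  have l2 := Real.log_le_log hb hby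
  have l3 := Real.log_nonpos hy.le (by linarith)
  have l4 := Real.log_nonpos hy1.le (by linarith)
  rw [isoEntropy, abs_mul, abs_of_pos (by positivity : 0 < 1 / Real.log 2)]
  refine mul_le_mul_of_nonneg_left ?_ (by positivity)
  rw [abs_le]
  constructor <;> nlinarith [mul_nonneg hy.le (neg_nonneg.2 l3), mul_nonneg hy1.le (neg_nonneg.2 l4),
    mul_nonneg hy1.le (neg_nonneg.2 l3), mul_nonneg hy.le (neg_nonneg.2 l4)]

/-- Hypotheses on a law on `[0, 1]` under which the entropies of means are integrable. -/
structure LogIntegrableLaw (m : Measure ℝ) : Prop where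
  mem : ∀ᵐ x ∂m, x ∈ Ioo (0 : ℝ) 1
  log : Integrable Real.log m
  log_one_sub : Integrable (fun x => Real.log (1 - x)) m

theorem integrable_isoEntropy_mean {n : ℕ} {m : Fin (n + 1) → Measure ℝ}
    [∀ j, IsProbabilityMeasure (m j)] (h : ∀ j, LogIntegrableLaw (m j)) :
    Integrable (fun x : Fin (n + 1) → ℝ => isoEntropy (((n + 1 : ℕ) : ℝ)⁻¹ * ∑ j, x j))
      (Measure.pi m) := by
  have hb : Integrable (fun t : ℝ => 1 / Real.log 2 * (5 / 2 * (-(Real.log t - Real.log (n + 1 : ℕ)) -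
      (Real.log (1 - t) - Real.log (n + 1 : ℕ))))) (m 0) :=
    (((((h 0).log.sub (integrable_const _)).neg).sub
      ((h 0).log_one_sub.sub (integrable_const _))).const_mul _).const_mul _
  have hb' := (measurePreserving_eval m 0).integrable_comp_of_integrable hb
  refine hb'.mono' (measurable_isoEntropy.comp (by fun_prop)).aestronglyMeasurable ?_
  have hae : ∀ᵐ x ∂Measure.pi m, ∀ j, x j ∈ Ioo (0 : ℝ) 1 :=
    ae_all_iff.2 fun j => (Measure.quasiMeasurePreserving_eval m j).ae (h j).mem
  filter_upwards [hae] with x hx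
  have hn : (0 : ℝ) < (n + 1 : ℕ) := by positivity
  have hm := mean_mem fun j => Ioo_subset_Icc_self (hx j)
  have := abs_isoEntropy_le (div_pos (hx 0).1 hn) (div_pos (sub_pos.2 (hx 0).2) hn) hm.1 hm.2
  rw [Real.log_div (hx 0).1.ne' hn.ne', Real.log_div (sub_pos.2 (hx 0).2).ne' hn.ne'] at this
  exact this

theorem integrable_H₂_mean {n : ℕ} {m : Fin (n + 1) → Measure ℝ}
    [∀ j, IsProbabilityMeasure (m j)] (h : ∀ j, LogIntegrableLaw (m j)) :
    Integrable (fun x : Fin (n + 1) → ℝ => H₂ (((n + 1 : ℕ) : ℝ)⁻¹ * ∑ j, x j))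
      (Measure.pi m) := by
  obtain ⟨C, hC⟩ := isCompact_Icc.exists_bound_of_continuousOn (s := Icc (0 : ℝ) 1)
    continuous_H₂.continuousOn
  refine Integrable.of_bound (continuous_H₂.measurable.comp (by fun_prop)).aestronglyMeasurable C ?_
  have hae : ∀ᵐ x ∂Measure.pi m, ∀ j, x j ∈ Ioo (0 : ℝ) 1 :=
    ae_all_iff.2 fun j => (Measure.quasiMeasurePreserving_eval m j).ae (h j).mem
  filter_upwards [hae] with x hx
  have hn : (0 : ℝ) < (n + 1 : ℕ) := by positivity
  have hm := mean_mem fun j => Ioo_subset_Icc_self (hx j)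
  have h1 := div_pos (hx 0).1 hn
  have h2 := div_pos (sub_pos.2 (hx 0).2) hn
  exact hC _ ⟨by linarith [hm.1], by linarith [hm.2]⟩

theorem ae_unifLaw_mem_Ioo : ∀ᵐ x ∂unifLaw, x ∈ Ioo (0 : ℝ) 1 := by
  rw [unifLaw, ← restrict_Ioo_eq_restrict_Ioc]
  exact ae_restrict_mem measurableSet_Ioo

instance isProbabilityMeasure_betaLaw : IsProbabilityMeasure betaLaw := by
  have : IsProbabilityMeasure (stateEnsemble 2 2) := isProbabilityMeasure_stateEnsemble 1
  rw [← map_entry_stateEnsemble]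
  exact Measure.isProbabilityMeasure_map continuous_entry.measurable.aemeasurable

theorem integrable_betaLaw {f : ℝ → ℝ} (hf : IntervalIntegrable f volume 0 1) :
    Integrable f betaLaw := by
  rw [betaLaw, integrable_withDensity_iff_integrable_smul₀' (by fun_prop)
    (Filter.Eventually.of_forall fun _ => ENNReal.ofReal_lt_top)]
  have h1 := (hf.continuousOn_mul (g := fun x : ℝ => 6 * x * (1 - x)) (by fun_prop)).1
  refine (Integrable.congr h1 ?_)
  filter_upwards [ae_unifLaw_mem] with x hx
  rw [ENNReal.toReal_ofReal (mul_nonneg (by linarith [hx.1]) (by linarith [hx.2])), smul_eq_mul]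

theorem logIntegrableLaw_betaLaw : LogIntegrableLaw betaLaw := by
  refine ⟨(withDensity_absolutelyContinuous _ _).ae_le ae_unifLaw_mem_Ioo,
    integrable_betaLaw intervalIntegral.intervalIntegrable_log', integrable_betaLaw ?_⟩
  have := ((intervalIntegral.intervalIntegrable_log' (a := 0) (b := 1)).comp_sub_left 1).symm
  simpa using this

/-! ### The laws of diagonal entries on orbits -/

/-- The diagonal entry of a state on the orbit of Bloch length `r`, from a uniform variable. -/
def orbitEntry (r t : ℝ) : ℝ := (1 - r) / 2 + r * t

/-- The uniform law on `[(1 - r) / 2, (1 + r) / 2]`. -/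
def orbitLaw (r : ℝ) : Measure ℝ := unifLaw.map (orbitEntry r)

theorem continuous_orbitEntry (r : ℝ) : Continuous (orbitEntry r) := by
  unfold orbitEntry
  fun_prop

instance isProbabilityMeasure_orbitLaw (r : ℝ) : IsProbabilityMeasure (orbitLaw r) :=
  Measure.isProbabilityMeasure_map (continuous_orbitEntry r).measurable.aemeasurable

theorem orbitEntry_mem {r t : ℝ} (hr : r ∈ Ioo (0 : ℝ) 1) (ht : t ∈ Icc (0 : ℝ) 1) :
    orbitEntry r t ∈ Ioo (0 : ℝ) 1 := by
  obtain ⟨r0, r1⟩ := hr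
  obtain ⟨t0, t1⟩ := ht
  constructor <;> simp only [orbitEntry] <;> nlinarith

theorem logIntegrableLaw_orbitLaw {r : ℝ} (hr : r ∈ Ioo (0 : ℝ) 1) :
    LogIntegrableLaw (orbitLaw r) := by
  have hm := (continuous_orbitEntry r).measurable
  have hint : ∀ {f : ℝ → ℝ}, Measurable f → ContinuousOn f (Ioo 0 1) →
      Integrable f (orbitLaw r) := fun {f} hf hc => by
    rw [orbitLaw, integrable_map_measure hf.aestronglyMeasurable hm.aemeasurable]
    -- Since `r < 1`, the entries stay in a compact subset of `(0, 1)`, where the logarithms are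
    -- bounded.
    have : ContinuousOn (f ∘ orbitEntry r) (Icc 0 1) :=
      hc.comp (continuous_orbitEntry r).continuousOn fun t ht => orbitEntry_mem hr ht
    exact this.integrableOn_Icc.mono_set Ioc_subset_Icc_self
  refine ⟨?_, hint Real.measurable_log ?_, hint (by fun_prop) ?_⟩
  · exact (ae_map_iff hm.aemeasurable measurableSet_Ioo).2
      (ae_unifLaw_mem.mono fun t ht => orbitEntry_mem hr (Ioc_subset_Icc_self ht))
  · exact Real.continuousOn_log.mono fun x hx => hx.1.ne'
  · exact ContinuousOn.log (by fun_prop) fun x hx => (sub_pos.2 hx.2).ne'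

theorem continuous_orbitMap (a : ℝ) : Continuous fun U : SU 2 =>
    U.1 * Matrix.diagonal ![((1 - a : ℝ) : ℂ), ((a : ℝ) : ℂ)] * star U.1 :=
  (continuous_subtype_val.mul continuous_const).mul continuous_subtype_val.star

instance isProbabilityMeasure_orbitMeasure (a : ℝ) : IsProbabilityMeasure (orbitMeasure a) :=
  Measure.isProbabilityMeasure_map (continuous_orbitMap a).measurable.aemeasurable

theorem isConjInvariant_orbitMeasure (a : ℝ) : IsConjInvariant (orbitMeasure a) := fun V => by
  refine ⟨(continuous_conj_SU V).measurable, ?_⟩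
  rw [orbitMeasure, Measure.map_map (continuous_conj_SU V).measurable
    (continuous_orbitMap a).measurable]
  conv_rhs => rw [← (measurePreserving_mul_left (haarSU 2) V).map_eq]
  rw [Measure.map_map (continuous_orbitMap a).measurable
    (measurePreserving_mul_left (haarSU 2) V).measurable]
  congr 1
  funext U
  simp only [Function.comp_apply, Submonoid.coe_mul, star_mul, Matrix.mul_assoc]

theorem ae_isDensity_orbitMeasure {a : ℝ} (ha : a ∈ Icc (0 : ℝ) 1) :
    ∀ᵐ ρ ∂orbitMeasure a, IsDensity ρ := by
  rw [orbitMeasure, ae_map_iff (continuous_orbitMap a).measurable.aemeasurable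
    isClosed_setOf_isDensity.measurableSet]
  exact Filter.Eventually.of_forall fun U => (isDensity_diagonal ha).conj U

theorem isConjInvariant_stateEnsemble : IsConjInvariant (stateEnsemble 2 2) :=
  measurePreserving_conj_stateEnsemble 1

theorem ae_isDensity_stateEnsemble : ∀ᵐ ρ ∂stateEnsemble 2 2, IsDensity ρ := by
  rw [stateEnsemble, ae_map_iff continuous_reducedState.measurable.aemeasurable
    isClosed_setOf_isDensity.measurableSet]
  exact Filter.Eventually.of_forall fun x =>
    isDensity_partialTrace x.1 (mem_sphere_zero_iff_norm.1 x.2)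

theorem map_entry_orbitMeasure (r : ℝ) :
    (orbitMeasure ((1 - r) / 2)).map entry = orbitLaw r := by
  have hc : Continuous fun U : SU 2 => ‖U.1 0 0‖ ^ 2 := (continuous_SU_apply 0 0).norm.pow 2
  rw [orbitMeasure, Measure.map_map continuous_entry.measurable (continuous_orbitMap _).measurable,
    orbitLaw, ← map_norm_SU, Measure.map_map (continuous_orbitEntry r).measurable hc.measurable]
  congr 1
  funext U
  have hrow : ‖U.1 0 0‖ ^ 2 + ‖U.1 0 1‖ ^ 2 = 1 := by
    have := congrFun (congrFun (mul_star_self_SU U) 0) 0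
    simp only [Matrix.mul_apply, Fin.sum_univ_two, Matrix.star_apply, Complex.star_def,
      Complex.mul_conj', Matrix.one_apply_eq] at this
    exact_mod_cast this
  have : (U.1 * Matrix.diagonal ![((1 - (1 - r) / 2 : ℝ) : ℂ), (((1 - r) / 2 : ℝ) : ℂ)] *
      star U.1) 0 0 =
      (((1 - (1 - r) / 2) * ‖U.1 0 0‖ ^ 2 + (1 - r) / 2 * ‖U.1 0 1‖ ^ 2 : ℝ) : ℂ) := by
    rw [Matrix.mul_apply, Fin.sum_univ_two]
    simp only [Matrix.mul_diagonal, Matrix.star_apply, Complex.star_def, Matrix.cons_val_zero,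
      Matrix.cons_val_one]
    rw [Complex.ofReal_add, Complex.ofReal_mul (1 - (1 - r) / 2), Complex.ofReal_mul ((1 - r) / 2),
      Complex.ofReal_pow, Complex.ofReal_pow, ← Complex.mul_conj', ← Complex.mul_conj']
    ring
  simp only [Function.comp_apply, entry, this, Complex.ofReal_re, orbitEntry]
  linear_combination ((1 - r) / 2) * hrow

/-! ### Averages over three orbits -/

theorem orbitTriple_apply (r₁ r₂ r₃ : ℝ) (j : Fin 3) :
    orbitTriple r₁ r₂ r₃ j = orbitMeasure ((1 - ![r₁, r₂, r₃] j) / 2) := by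
  fin_cases j <;> rfl

instance isProbabilityMeasure_orbitTriple (r₁ r₂ r₃ : ℝ) (j : Fin 3) :
    IsProbabilityMeasure (orbitTriple r₁ r₂ r₃ j) := by
  rw [orbitTriple_apply]
  infer_instance

theorem map_entry_orbitTriple (r₁ r₂ r₃ : ℝ) :
    (fun j => (orbitTriple r₁ r₂ r₃ j).map entry) = fun j => orbitLaw (![r₁, r₂, r₃] j) := by
  funext j
  rw [orbitTriple_apply, map_entry_orbitMeasure]

theorem forall_mem_Ioo {r₁ r₂ r₃ : ℝ} (h₁ : r₁ ∈ Ioo (0 : ℝ) 1) (h₂ : r₂ ∈ Ioo (0 : ℝ) 1)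
    (h₃ : r₃ ∈ Ioo (0 : ℝ) 1) (j : Fin 3) : ![r₁, r₂, r₃] j ∈ Ioo (0 : ℝ) 1 := by
  fin_cases j
  exacts [h₁, h₂, h₃]

theorem avgEntropy_orbitTriple_eq {r₁ r₂ r₃ : ℝ} (h₁ : r₁ ∈ Ioo (0 : ℝ) 1)
    (h₂ : r₂ ∈ Ioo (0 : ℝ) 1) (h₃ : r₃ ∈ Ioo (0 : ℝ) 1) :
    avgEntropy (orbitTriple r₁ r₂ r₃) = ∫ x, isoEntropy (((2 + 1 : ℕ) : ℝ)⁻¹ * ∑ j, x j)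
      ∂(Measure.pi fun j => orbitLaw (![r₁, r₂, r₃] j)) := by
  have hr := forall_mem_Ioo h₁ h₂ h₃
  have hi := integrable_isoEntropy_mean (n := 2) fun j => logIntegrableLaw_orbitLaw (hr j)
  rw [← map_entry_orbitTriple] at hi ⊢
  refine (avgEntropy_eq (n := 2) (fun j => ?_) (fun j => ?_) hi).2
  · rw [orbitTriple_apply]
    exact isConjInvariant_orbitMeasure _
  · rw [orbitTriple_apply]
    exact ae_isDensity_orbitMeasure ⟨by linarith [(hr j).2], by linarith [(hr j).1]⟩

theorem avgDiagEntropy_orbitTriple_eq {r₁ r₂ r₃ : ℝ} (h₁ : r₁ ∈ Ioo (0 : ℝ) 1)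
    (h₂ : r₂ ∈ Ioo (0 : ℝ) 1) (h₃ : r₃ ∈ Ioo (0 : ℝ) 1) :
    avgDiagEntropy (orbitTriple r₁ r₂ r₃) = ∫ x, H₂ (((2 + 1 : ℕ) : ℝ)⁻¹ * ∑ j, x j)
      ∂(Measure.pi fun j => orbitLaw (![r₁, r₂, r₃] j)) := by
  have hr := forall_mem_Ioo h₁ h₂ h₃
  have hi := integrable_H₂_mean (n := 2) fun j => logIntegrableLaw_orbitLaw (hr j)
  rw [← map_entry_orbitTriple] at hi ⊢
  refine (avgDiagEntropy_eq (n := 2) (fun j => ?_) hi).2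
  rw [orbitTriple_apply]
  exact ae_isDensity_orbitMeasure ⟨by linarith [(hr j).2], by linarith [(hr j).1]⟩

theorem pi_orbitLaw_eq_map {n : ℕ} (r : Fin n → ℝ) : (Measure.pi fun j => orbitLaw (r j)) =
    (Measure.pi fun _ : Fin n => unifLaw).map fun t j => orbitEntry (r j) (t j) := by
  have : ∀ j, IsProbabilityMeasure (unifLaw.map (orbitEntry (r j))) := fun j =>
    isProbabilityMeasure_orbitLaw (r j)
  exact (Measure.pi_map_pi fun j => (continuous_orbitEntry (r j)).measurable.aemeasurable).symm

theorem measurable_orbitEntry_pi {n : ℕ} (r : Fin n → ℝ) :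
    Measurable fun (t : Fin n → ℝ) j => orbitEntry (r j) (t j) := by
  unfold orbitEntry
  fun_prop

theorem integral_orbit_mean {F : ℕ → ℝ → ℝ} (hF : IsPrimitiveChain F 0 1) (hm : Measurable (F 0))
    {r₁ r₂ r₃ : ℝ} (h₁ : r₁ ∈ Ioo (0 : ℝ) 1) (h₂ : r₂ ∈ Ioo (0 : ℝ) 1) (h₃ : r₃ ∈ Ioo (0 : ℝ) 1)
    (hi : Integrable (fun x : Fin 3 → ℝ => F 0 (((2 + 1 : ℕ) : ℝ)⁻¹ * ∑ j, x j))
      (Measure.pi fun j => orbitLaw (![r₁, r₂, r₃] j))) :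
    ∫ x, F 0 (((2 + 1 : ℕ) : ℝ)⁻¹ * ∑ j, x j)
      ∂(Measure.pi fun j => orbitLaw (![r₁, r₂, r₃] j)) = unifTriple r₁ r₂ r₃ F := by
  have hm' : Measurable fun x : Fin 3 → ℝ => F 0 (((2 + 1 : ℕ) : ℝ)⁻¹ * ∑ j, x j) :=
    hm.comp (by fun_prop)
  have hφ := measurable_orbitEntry_pi ![r₁, r₂, r₃]
  rw [pi_orbitLaw_eq_map, integrable_map_measure hm'.aestronglyMeasurable hφ.aemeasurable] at hi
  rw [pi_orbitLaw_eq_map, integral_map hφ.aemeasurable hm'.aestronglyMeasurable]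
  refine (integral_pi_three _ hi).trans ?_
  simp only [integral_unifLaw]
  rw [← hF.integral_unif_triple h₁ h₂ h₃]
  refine intervalIntegral.integral_congr fun x _ => intervalIntegral.integral_congr fun y _ =>
    intervalIntegral.integral_congr fun z _ => ?_
  simp only [Function.comp_apply, Fin.sum_univ_three, orbitEntry, Matrix.cons_val_zero,
    Matrix.cons_val_one, Matrix.cons_val]
  congr 1
  push_cast
  ring

theorem avgEntropy_orbitTriple {r₁ r₂ r₃ : ℝ} (h₁ : r₁ ∈ Ioo (0 : ℝ) 1) (h₂ : r₂ ∈ Ioo (0 : ℝ) 1)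
    (h₃ : r₃ ∈ Ioo (0 : ℝ) 1) : avgEntropy (orbitTriple r₁ r₂ r₃) =
      ∫ r in (0 : ℝ)..((r₁ + r₂ + r₃) / 3), H₂ ((1 - r) / 2) * pCond r₁ r₂ r₃ r := by
  rw [avgEntropy_orbitTriple_eq h₁ h₂ h₃, ← unifTriple_isoKernelChain h₁ h₂ h₃]
  exact integral_orbit_mean isPrimitiveChain_isoKernelChain measurable_isoEntropy h₁ h₂ h₃
    (integrable_isoEntropy_mean (n := 2) fun j =>
      logIntegrableLaw_orbitLaw (forall_mem_Ioo h₁ h₂ h₃ j))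

theorem avgDiagEntropy_orbitTriple {r₁ r₂ r₃ : ℝ} (h₁ : r₁ ∈ Ioo (0 : ℝ) 1)
    (h₂ : r₂ ∈ Ioo (0 : ℝ) 1) (h₃ : r₃ ∈ Ioo (0 : ℝ) 1) :
    avgDiagEntropy (orbitTriple r₁ r₂ r₃) = ∫ x in (0 : ℝ)..1, H₂ x * qCond r₁ r₂ r₃ x := by
  rw [avgDiagEntropy_orbitTriple_eq h₁ h₂ h₃, ← unifTriple_entropy h₁ h₂ h₃]
  exact integral_orbit_mean (isPrimitiveChain_kernelChain continuous_H₂ 0 1)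
    continuous_H₂.measurable h₁ h₂ h₃ (integrable_H₂_mean (n := 2) fun j =>
      logIntegrableLaw_orbitLaw (forall_mem_Ioo h₁ h₂ h₃ j))

/-! ### Averages over the ensemble -/

instance isProbabilityMeasure_iidQubits (n : ℕ) (j : Fin n) :
    IsProbabilityMeasure (iidQubits n j) := isProbabilityMeasure_stateEnsemble 1

theorem map_entry_iidQubits (n : ℕ) :
    (fun j => (iidQubits n j).map entry) = fun _ => betaLaw :=
  funext fun _ => map_entry_stateEnsemble

theorem avgEntropy_iidQubits_eq (n : ℕ) :
    Integrable (fun ρ => vonNeumannEntropy (mixture ρ)) (Measure.pi (iidQubits (n + 1))) ∧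
    avgEntropy (iidQubits (n + 1)) = ∫ x, isoEntropy (((n + 1 : ℕ) : ℝ)⁻¹ * ∑ j, x j)
      ∂(Measure.pi fun _ : Fin (n + 1) => betaLaw) := by
  have hi := integrable_isoEntropy_mean (n := n) fun _ => logIntegrableLaw_betaLaw
  rw [← map_entry_iidQubits] at hi ⊢
  exact avgEntropy_eq (fun _ => isConjInvariant_stateEnsemble)
    (fun _ => ae_isDensity_stateEnsemble) hi

theorem avgDiagEntropy_iidQubits_eq (n : ℕ) :
    Integrable (fun ρ => vonNeumannEntropy (diagPart (mixture ρ)))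
      (Measure.pi (iidQubits (n + 1))) ∧
    avgDiagEntropy (iidQubits (n + 1)) = ∫ x, H₂ (((n + 1 : ℕ) : ℝ)⁻¹ * ∑ j, x j)
      ∂(Measure.pi fun _ : Fin (n + 1) => betaLaw) := by
  have hi := integrable_H₂_mean (n := n) fun _ => logIntegrableLaw_betaLaw
  rw [← map_entry_iidQubits] at hi ⊢
  exact avgDiagEntropy_eq (fun _ => ae_isDensity_stateEnsemble) hi

theorem avgCoherence_iidQubits (n : ℕ) : avgCoherence (iidQubits (n + 1)) =
    avgDiagEntropy (iidQubits (n + 1)) - avgEntropy (iidQubits (n + 1)) := by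
  rw [avgCoherence, avgDiagEntropy, avgEntropy]
  simp only [coherence, mixture_diagPart]
  exact integral_sub (avgDiagEntropy_iidQubits_eq n).1 (avgEntropy_iidQubits_eq n).1

theorem integral_beta_mean_three {F : ℕ → ℝ → ℝ} (hF : IsPrimitiveChain F 0 1)
    (hi : Integrable (fun x : Fin 3 → ℝ => F 0 (((2 + 1 : ℕ) : ℝ)⁻¹ * ∑ j, x j))
      (Measure.pi fun _ => betaLaw)) :
    ∫ x, F 0 (((2 + 1 : ℕ) : ℝ)⁻¹ * ∑ j, x j) ∂(Measure.pi fun _ : Fin 3 => betaLaw) =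
      betaTriple F := by
  rw [integral_pi_three _ hi, ← hF.integral_beta_triple]
  simp only [integral_betaLaw, Fin.sum_univ_three, Matrix.cons_val_zero, Matrix.cons_val_one,
    Matrix.cons_val]
  norm_num [mul_add]

theorem integral_beta_mean_two {F : ℕ → ℝ → ℝ} (hF : IsPrimitiveChain F 0 1)
    (hi : Integrable (fun x : Fin 2 → ℝ => F 0 (((1 + 1 : ℕ) : ℝ)⁻¹ * ∑ j, x j))
      (Measure.pi fun _ => betaLaw)) :
    ∫ x, F 0 (((1 + 1 : ℕ) : ℝ)⁻¹ * ∑ j, x j) ∂(Measure.pi fun _ : Fin 2 => betaLaw) =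
      betaPair F := by
  rw [integral_pi_two _ hi, ← hF.integral_beta_pair]
  simp only [integral_betaLaw, Fin.sum_univ_two, Matrix.cons_val_zero, Matrix.cons_val_one]
  norm_num [mul_add]

/-- The chain is left free: any primitives of `isoEntropy` compute the same average. Logarithmic
primitives give the closed form, Cauchy's give the integral against `p₃`. -/
theorem avgEntropy_iidQubits_three_of_chain {F : ℕ → ℝ → ℝ} (hF : IsPrimitiveChain F 0 1)
    (h0 : F 0 = isoEntropy) : avgEntropy (iidQubits 3) = betaTriple F := by
  rw [(avgEntropy_iidQubits_eq 2).2, ← h0]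
  refine integral_beta_mean_three hF ?_
  rw [h0]
  exact integrable_isoEntropy_mean (n := 2) fun _ => logIntegrableLaw_betaLaw

theorem avgEntropy_iidQubits_three : avgEntropy (iidQubits 3) = betaTriple isoEntropyChain :=
  avgEntropy_iidQubits_three_of_chain isPrimitiveChain_isoEntropyChain isoEntropyChain_zero

theorem avgEntropy_iidQubits_three_eq_integral :
    avgEntropy (iidQubits 3) = ∫ r in (0 : ℝ)..1, H₂ ((1 - r) / 2) * p₃ r :=
  (avgEntropy_iidQubits_three_of_chain isPrimitiveChain_isoKernelChain rfl).trans
    betaTriple_isoKernelChain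

theorem avgDiagEntropy_iidQubits_three : avgDiagEntropy (iidQubits 3) = betaTriple entropyChain := by
  rw [(avgDiagEntropy_iidQubits_eq 2).2, ← entropyChain_zero]
  refine integral_beta_mean_three isPrimitiveChain_entropyChain ?_
  rw [entropyChain_zero]
  exact integrable_H₂_mean (n := 2) fun _ => logIntegrableLaw_betaLaw

theorem avgEntropy_iidQubits_two : avgEntropy (iidQubits 2) = betaPair isoEntropyChain := by
  rw [(avgEntropy_iidQubits_eq 1).2, ← isoEntropyChain_zero]
  refine integral_beta_mean_two isPrimitiveChain_isoEntropyChain ?_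
  rw [isoEntropyChain_zero]
  exact integrable_isoEntropy_mean (n := 1) fun _ => logIntegrableLaw_betaLaw

theorem avgDiagEntropy_iidQubits_two : avgDiagEntropy (iidQubits 2) = betaPair entropyChain := by
  rw [(avgDiagEntropy_iidQubits_eq 1).2, ← entropyChain_zero]
  refine integral_beta_mean_two isPrimitiveChain_entropyChain ?_
  rw [entropyChain_zero]
  exact integrable_H₂_mean (n := 1) fun _ => logIntegrableLaw_betaLaw

/-! ### The ensemble as a mixture of orbits -/

/-- The law of the Bloch length of a state of `𝓔_{2,2}`. -/
def radialLaw : Measure ℝ := unifLaw.withDensity fun r => ENNReal.ofReal (3 * r ^ 2)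

theorem integral_radialLaw (f : ℝ → ℝ) :
    ∫ r, f r ∂radialLaw = ∫ r in (0 : ℝ)..1, 3 * r ^ 2 * f r :=
  integral_withDensity_unifLaw (by fun_prop) (fun _ _ => by positivity) f

instance isProbabilityMeasure_radialLaw : IsProbabilityMeasure radialLaw := by
  have : IsFiniteMeasure radialLaw := isFiniteMeasure_withDensity_unifLaw (by fun_prop)
  have h := integral_radialLaw fun _ => 1
  rw [integral_const, smul_eq_mul, mul_one] at h
  simp only [mul_one] at h
  rw [intervalIntegral.integral_const_mul, integral_pow] at h
  norm_num at h
  exact isProbabilityMeasure_iff_real.2 h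

theorem ae_radialLaw_mem : ∀ᵐ r ∂radialLaw, r ∈ Ioo (0 : ℝ) 1 :=
  (withDensity_absolutelyContinuous _ _).ae_le ae_unifLaw_mem_Ioo

/-- Both sides are evaluated with primitives of `f`. The inner integral on the left is an increment
of the first primitive, and one integration by parts in `r` yields the beta step of width `1`. -/
theorem integral_radial_unif {f : ℝ → ℝ} (hf : Continuous f) :
    ∫ r in (0 : ℝ)..1, 3 * r ^ 2 * ∫ t in (0 : ℝ)..1, f (orbitEntry r t) =
      ∫ u in (0 : ℝ)..1, 6 * u * (1 - u) * f u := by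
  have hF := isPrimitiveChain_kernelChain hf 0 1
  have hd := hasDerivAt_kernelChain hf
  have h1 := hF.integral_beta (w := 1) (s := 0) one_pos le_rfl (by norm_num)
  simp only [zero_add, one_mul] at h1
  change ∫ u in (0 : ℝ)..1, 6 * u * (1 - u) * f u = _ at h1
  rw [h1]
  have hin : ∀ r ∈ Icc (0 : ℝ) 1, 3 * r ^ 2 * ∫ t in (0 : ℝ)..1, f (orbitEntry r t) =
      3 * r * (kernelChain f 1 ((1 + r) / 2) - kernelChain f 1 ((1 - r) / 2)) := fun r hr => by
    rcases hr.1.eq_or_lt with h0 | h0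
    -- At `r = 0` the averaging formula divides by zero; the identity holds because both sides
    -- vanish.
    · simp [← h0]
    · have := hF.integral_unif (c := 0) (w := r) (s := (1 - r) / 2) le_rfl h0
        (by linarith [hr.2]) (by linarith [hr.2])
      simp only [zero_add] at this
      change ∫ t in (0 : ℝ)..1, f (orbitEntry r t) = _ at this
      rw [this, unifStep]
      simp only [zero_add, add_zero]
      rw [show (1 - r) / 2 + r = (1 + r) / 2 by ring]
      field_simp
  have hcont : ∀ k, Continuous (kernelChain f (k + 1)) := fun k =>
    continuous_iff_continuousAt.2 fun x => (hd k x).continuousAt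
  have hp : ∀ k r, HasDerivAt (fun r => kernelChain f (k + 1) ((1 + r) / 2))
      (kernelChain f k ((1 + r) / 2) * (1 / 2)) r := fun k r => by
    have h2 : HasDerivAt (fun r : ℝ => (1 + r) / 2) (1 / 2) r :=
      ((hasDerivAt_id r).const_add 1).div_const 2
    exact (hd k _).comp r h2
  have hm : ∀ k r, HasDerivAt (fun r => kernelChain f (k + 1) ((1 - r) / 2))
      (kernelChain f k ((1 - r) / 2) * (-1 / 2)) r := fun k r => by
    have h2 : HasDerivAt (fun r : ℝ => (1 - r) / 2) (-1 / 2) r :=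
      ((hasDerivAt_id r).const_sub 1).div_const 2
    exact (hd k _).comp r h2
  have hc0 := hcont 0
  rw [zero_add] at hc0
  rw [intervalIntegral.integral_congr (g := fun r => 3 * r *
    (kernelChain f 1 ((1 + r) / 2) - kernelChain f 1 ((1 - r) / 2)))
    (fun r hr => hin r (by rwa [uIcc_of_le zero_le_one] at hr)),
    intervalIntegral.integral_eq_sub_of_hasDerivAt (f := fun r =>
      6 * r * (kernelChain f 2 ((1 + r) / 2) + kernelChain f 2 ((1 - r) / 2)) -
      12 * (kernelChain f 3 ((1 + r) / 2) - kernelChain f 3 ((1 - r) / 2)))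
    (fun r _ => ?_) (Continuous.intervalIntegrable (by fun_prop) _ _)]
  · simp only [betaStep]
    norm_num
  · have h3 : HasDerivAt (fun r : ℝ => 6 * r) 6 r := by
      simpa using (hasDerivAt_id r).const_mul 6
    have := (h3.mul ((hp 1 r).add (hm 1 r))).sub (((hp 2 r).sub (hm 2 r)).const_mul 12)
    refine this.congr_deriv ?_
    simp only [Pi.add_apply]
    ring

theorem measurable_orbitEntry_uncurry : Measurable fun p : ℝ × ℝ => orbitEntry p.1 p.2 := by
  unfold orbitEntry
  fun_prop

/-- The density `3 r²` is that of the length of a uniform point of the unit ball: the Bloch vector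
of a random state is such a point, and `x` depends affinely on one of its coordinates. -/
theorem betaLaw_eq_map :
    betaLaw = (radialLaw.prod unifLaw).map fun p : ℝ × ℝ => orbitEntry p.1 p.2 := by
  have hm := measurable_orbitEntry_uncurry
  have : IsProbabilityMeasure ((radialLaw.prod unifLaw).map fun p : ℝ × ℝ => orbitEntry p.1 p.2) :=
    Measure.isProbabilityMeasure_map hm.aemeasurable
  refine ext_of_forall_integral_eq_of_IsFiniteMeasure fun f => ?_
  have hi : Integrable (fun p : ℝ × ℝ => f (orbitEntry p.1 p.2)) (radialLaw.prod unifLaw) :=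
    Integrable.of_bound (f.continuous.measurable.comp hm).aestronglyMeasurable ‖f‖
      (Filter.Eventually.of_forall fun p => f.norm_coe_le_norm _)
  rw [integral_map hm.aemeasurable f.continuous.aestronglyMeasurable, integral_prod _ hi,
    integral_betaLaw, integral_radialLaw]
  simp only [integral_unifLaw]
  exact (integral_radial_unif f.continuous).symm

/-- An average over the ensemble is an average of averages over orbits. -/
theorem integral_pi_betaLaw {g : ℝ → ℝ} (hg : Measurable g) {A : ℝ → ℝ → ℝ → ℝ}
    (hi : Integrable (fun x : Fin 3 → ℝ => g (((2 + 1 : ℕ) : ℝ)⁻¹ * ∑ j, x j))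
      (Measure.pi fun _ => betaLaw))
    (hA : ∀ r₁ ∈ Ioo (0 : ℝ) 1, ∀ r₂ ∈ Ioo (0 : ℝ) 1, ∀ r₃ ∈ Ioo (0 : ℝ) 1,
      A r₁ r₂ r₃ = ∫ x, g (((2 + 1 : ℕ) : ℝ)⁻¹ * ∑ j, x j)
        ∂(Measure.pi fun j => orbitLaw (![r₁, r₂, r₃] j))) :
    ∫ x, g (((2 + 1 : ℕ) : ℝ)⁻¹ * ∑ j, x j) ∂(Measure.pi fun _ : Fin 3 => betaLaw) =
      ∫ r₁ in (0 : ℝ)..1, ∫ r₂ in (0 : ℝ)..1, ∫ r₃ in (0 : ℝ)..1,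
        A r₁ r₂ r₃ * (3 * r₁ ^ 2) * (3 * r₂ ^ 2) * (3 * r₃ ^ 2) := by
  set G : (Fin 3 → ℝ) → ℝ := fun x => g (((2 + 1 : ℕ) : ℝ)⁻¹ * ∑ j, x j) with hG
  have hGm : Measurable G := hg.comp (by fun_prop)
  have hφ : Measurable fun (z : Fin 3 → ℝ × ℝ) j => orbitEntry (z j).1 (z j).2 :=
    measurable_pi_lambda _ fun j => measurable_orbitEntry_uncurry.comp (measurable_pi_apply j)
  have hpi : (Measure.pi fun _ : Fin 3 => betaLaw) =
      (Measure.pi fun _ : Fin 3 => radialLaw.prod unifLaw).map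
        fun z j => orbitEntry (z j).1 (z j).2 := by
    have : ∀ _ : Fin 3, IsProbabilityMeasure
        ((radialLaw.prod unifLaw).map fun p : ℝ × ℝ => orbitEntry p.1 p.2) := fun _ =>
      Measure.isProbabilityMeasure_map measurable_orbitEntry_uncurry.aemeasurable
    rw [betaLaw_eq_map]
    exact (Measure.pi_map_pi fun _ => measurable_orbitEntry_uncurry.aemeasurable).symm
  -- Regroups three pairs (length, uniform variable) as a triple of lengths and a triple of uniform
  -- variables, so that the lengths can be integrated last.
  have hmp := (measurePreserving_arrowProdEquivProdArrow ℝ ℝ (Fin 3) (fun _ => radialLaw)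
    (fun _ => unifLaw)).symm
  rw [hpi, integrable_map_measure hGm.aestronglyMeasurable hφ.aemeasurable] at hi
  have hi2 := (hmp.integrable_comp_emb (MeasurableEquiv.measurableEmbedding _)).2 hi
  rw [hpi, integral_map hφ.aemeasurable hGm.aestronglyMeasurable,
    ← hmp.integral_comp (MeasurableEquiv.measurableEmbedding _)]
  -- `A` is known only on the open cube, which has full measure for the product of the radial laws.
  have hae : (fun r : Fin 3 → ℝ => ∫ t, G (fun j => orbitEntry (r j) (t j))
      ∂(Measure.pi fun _ : Fin 3 => unifLaw)) =ᵐ[Measure.pi fun _ : Fin 3 => radialLaw]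
      fun r => A (r 0) (r 1) (r 2) := by
    have hmem : ∀ᵐ r ∂(Measure.pi fun _ : Fin 3 => radialLaw), ∀ j, r j ∈ Ioo (0 : ℝ) 1 :=
      ae_all_iff.2 fun j =>
        (Measure.quasiMeasurePreserving_eval (fun _ : Fin 3 => radialLaw) j).ae ae_radialLaw_mem
    filter_upwards [hmem] with r hr
    rw [hA _ (hr 0) _ (hr 1) _ (hr 2), pi_orbitLaw_eq_map,
      integral_map (measurable_orbitEntry_pi _).aemeasurable hGm.aestronglyMeasurable,
      show ![r 0, r 1, r 2] = r from by funext j; fin_cases j <;> rfl]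
  refine (integral_prod _ hi2).trans ?_
  have hAi : Integrable (fun r : Fin 3 → ℝ => A (r 0) (r 1) (r 2))
      (Measure.pi fun _ : Fin 3 => radialLaw) := (integrable_congr hae).1 hi2.integral_prod_left
  refine (integral_congr_ae hae).trans ?_
  rw [integral_pi_three _ hAi]
  simp only [integral_radialLaw, Matrix.cons_val_zero, Matrix.cons_val_one, Matrix.cons_val,
    ← intervalIntegral.integral_const_mul]
  refine intervalIntegral.integral_congr fun x _ => intervalIntegral.integral_congr fun y _ =>
    intervalIntegral.integral_congr fun z _ => ?_
  ring

theorem avgEntropy_iidQubits_three_eq_iterated : avgEntropy (iidQubits 3) =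
    ∫ r₁ in (0 : ℝ)..1, ∫ r₂ in (0 : ℝ)..1, ∫ r₃ in (0 : ℝ)..1,
      avgEntropy (orbitTriple r₁ r₂ r₃) * (3 * r₁ ^ 2) * (3 * r₂ ^ 2) * (3 * r₃ ^ 2) := by
  rw [(avgEntropy_iidQubits_eq 2).2]
  exact integral_pi_betaLaw measurable_isoEntropy
    (integrable_isoEntropy_mean (n := 2) fun _ => logIntegrableLaw_betaLaw)
    fun _ h₁ _ h₂ _ h₃ => avgEntropy_orbitTriple_eq h₁ h₂ h₃

theorem avgDiagEntropy_iidQubits_three_eq_iterated : avgDiagEntropy (iidQubits 3) =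
    ∫ r₁ in (0 : ℝ)..1, ∫ r₂ in (0 : ℝ)..1, ∫ r₃ in (0 : ℝ)..1,
      avgDiagEntropy (orbitTriple r₁ r₂ r₃) * (3 * r₁ ^ 2) * (3 * r₂ ^ 2) * (3 * r₃ ^ 2) := by
  rw [(avgDiagEntropy_iidQubits_eq 2).2]
  exact integral_pi_betaLaw continuous_H₂.measurable
    (integrable_H₂_mean (n := 2) fun _ => logIntegrableLaw_betaLaw)
    fun _ h₁ _ h₂ _ h₃ => avgDiagEntropy_orbitTriple_eq h₁ h₂ h₃

end QubitMixture

end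

open QubitMixture

theorem mainTheorem11 :
    (∀ r₁ ∈ Set.Ioo (0 : ℝ) 1, ∀ r₂ ∈ Set.Ioo (0 : ℝ) 1, ∀ r₃ ∈ Set.Ioo (0 : ℝ) 1,
      avgEntropy (orbitTriple r₁ r₂ r₃) =
        ∫ r in (0 : ℝ)..((r₁ + r₂ + r₃) / 3), H₂ ((1 - r) / 2) * pCond r₁ r₂ r₃ r) ∧
    avgEntropy (iidQubits 3) =
      (∫ r₁ in (0 : ℝ)..1, ∫ r₂ in (0 : ℝ)..1, ∫ r₃ in (0 : ℝ)..1,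
        avgEntropy (orbitTriple r₁ r₂ r₃) * (3 * r₁ ^ 2) * (3 * r₂ ^ 2) * (3 * r₃ ^ 2)) ∧
    avgEntropy (iidQubits 3) = (∫ r in (0 : ℝ)..1, H₂ ((1 - r) / 2) * p₃ r) ∧
    avgEntropy (iidQubits 3) =
      (57821 + 94464 * Real.log 2 - 105498 * Real.log 3) / (12600 * Real.log 2) ∧
    |avgEntropy (iidQubits 3) - 0.84696| < 0.000005 ∧
    (∀ r₁ ∈ Set.Ioo (0 : ℝ) 1, ∀ r₂ ∈ Set.Ioo (0 : ℝ) 1, ∀ r₃ ∈ Set.Ioo (0 : ℝ) 1,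
      avgDiagEntropy (orbitTriple r₁ r₂ r₃) =
        ∫ x in (0 : ℝ)..1, H₂ x * qCond r₁ r₂ r₃ x) ∧
    avgDiagEntropy (iidQubits 3) =
      (∫ r₁ in (0 : ℝ)..1, ∫ r₂ in (0 : ℝ)..1, ∫ r₃ in (0 : ℝ)..1,
        avgDiagEntropy (orbitTriple r₁ r₂ r₃) * (3 * r₁ ^ 2) * (3 * r₂ ^ 2) * (3 * r₃ ^ 2)) ∧
    |avgDiagEntropy (iidQubits 3) - 0.95026| < 0.000005 ∧
    avgCoherence (iidQubits 3) = avgDiagEntropy (iidQubits 3) - avgEntropy (iidQubits 3) ∧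
    (0.10329 < avgCoherence (iidQubits 3) ∧ avgCoherence (iidQubits 3) < 0.10330) ∧
    avgCoherence (iidQubits 3) < avgCoherence (iidQubits 2) := by
  refine ⟨fun _ h₁ _ h₂ _ h₃ => avgEntropy_orbitTriple h₁ h₂ h₃,
    avgEntropy_iidQubits_three_eq_iterated, avgEntropy_iidQubits_three_eq_integral,
    avgEntropy_iidQubits_three.trans betaTriple_isoEntropyChain, ?_,
    fun _ h₁ _ h₂ _ h₃ => avgDiagEntropy_orbitTriple h₁ h₂ h₃,
    avgDiagEntropy_iidQubits_three_eq_iterated, ?_, avgCoherence_iidQubits 2, ?_, ?_⟩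
  · rw [avgEntropy_iidQubits_three]
    exact abs_betaTriple_isoEntropyChain_sub_lt
  · rw [avgDiagEntropy_iidQubits_three]
    exact abs_betaTriple_entropyChain_sub_lt
  · rw [avgCoherence_iidQubits 2, avgEntropy_iidQubits_three, avgDiagEntropy_iidQubits_three]
    exact ⟨lt_betaTriple_sub, betaTriple_sub_lt⟩
  · rw [avgCoherence_iidQubits 2, avgEntropy_iidQubits_three, avgDiagEntropy_iidQubits_three,
      avgCoherence_iidQubits 1, avgEntropy_iidQubits_two, avgDiagEntropy_iidQubits_two]
    -- The number `0.10330` separates the two coherences.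
    exact betaTriple_sub_lt.trans lt_betaPair_sub
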